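/- Let $m_1,m_2\ge 1$ and let $W=D_{2m_1}\times D_{2m_2}\subset \mathsf O(4)$ be the reflection group of the root system $R=\{\alpha_p\}_{p=1}^{2m_1}\cup\{\beta_q\}_{q=1}^{2m_2}$ in $\mathbb R^4$, with $\alpha_p=(\sin\frac{p\pi}{m_1},-\cos\frac{p\pi}{m_1},0,0)$, $\beta_q=(0,0,\sin\frac{q\pi}{m_2},-\cos\frac{q\pi}{m_2})$ and $R_+=\{\alpha_1,\dots,\alpha_{m_1},\beta_1,\dots,\beta_{m_2}\}$; let $s_\alpha$ be the reflection in $\alpha^\perp$, and let $\kappa:R\to\mathbb C$ be $W$-invariant. Let $V=\mathbb C^4$ with standard basis $x_1,\dots,x_4$ and complex-bilinear form $(x_i,x_j)=\delta_{ij}$. Let $H_\kappa$ be the rational Cherednik algebra: the quotient of $T(V\oplus V^*)\rtimes\mathbb C W$ by $[x_i,x_j]=0=[\xi_i,\xi_j]$ and $[\xi_i,x_j]=\delta_{ij}+\sum_{\alpha\in R_+}\frac{2\kappa_\alpha}{(\alpha,\alpha)}(x_i,\alpha)(x_j,\alpha)s_\alpha$, where $\xi_1,\dots,\xi_4$ is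 the dual basis. Let $\mathcal C$ be the complex Clifford algebra with generators $e_1,\dots,e_4$, $e_je_k+e_ke_j=2\delta_{jk}$, and let $\gamma:\bigwedge V\to\mathcal C$ be the linear isomorphism given by antisymmetrisation, $\gamma(v_1\wedge\dots\wedge v_p)=\frac1{p!}\sum_{g\in S_p}\operatorname{sgn}(g)\gamma(v_{g(1)})\cdots\gamma(v_{g(p)})$, $\gamma(x_j)=e_j$. In $H_\kappa\otimes\mathcal C$, graded by the parity of $\mathcal C$ and with graded commutator $\llbracket\cdot,\cdot\rrbracket$, put $\underline D=\sum_j\xi_j\otimes e_j$, $\underline x=\sum_j x_j\otimes e_j$ and, for $v\in\bigwedge V$, $$O(v)=-\tfrac12\Big(\gamma(v)-\tfrac12\llbracket\underline D,\llbracket\underline x,\gamma(v)\rrbracket\rrbracket\Big).$$ For $a\in\{1,2\}$ and $\delta\in\{+1,-1\}$ put $z_a^{\delta}=x_{2a-1}+\delta i\,x_{2a}$, $O_a^\delta=O(z_a^\delta)$, $H_a=\frac12O(z_a^+\wedge z_a^-)$, $Z=O(x_1\wedge x_2\wedge x_3\wedge x_4)$. With $\{\cdot,\cdot\}$ the (ungraded)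 anti-commutator, define the ladder elements $$L_{\delta\varpi_1+\varepsilon\varpi_2}=\{H_1,\{H_2,O(z_1^\delta\wedge z_2^\varepsilon)\}\},\qquad L_{\varepsilon\varpi_b}=\{H_b,O(z_b^\varepsilon\wedge z_a^+\wedge z_a^-)\}\quad(\{a,b\}=\{1,2\}).$$ Let $\tilde s_\alpha=s_\alpha\otimes\gamma(\alpha)$, $\tilde r_1=-\tilde s_{\alpha_{m_1}}\tilde s_{\alpha_1}$, $\tilde r_2=-\tilde s_{\beta_{m_2}}\tilde s_{\beta_1}$, $\mathfrak t_0=\operatorname{span}\{H_1,H_2,Z,\tilde r_1,\tilde r_2\}$, and let $\mathfrak T_0$ be the associative unital subalgebra generated by $\mathfrak t_0$. Put $p_a^\delta=(H_a-\frac12\delta)^2-O_a^\delta O_a^{-\delta}$. Then, for all $\delta,\varepsilon\in\{+1,-1\}$ and $\{a,b\}=\{1,2\}$: 1. $O_a^\delta O_a^{-\delta}\in\mathfrak T_0$ (so the right-hand sides in 2 and 3 and the last factors in 4 lie in $\mathfrak T_0$). 2. $L_{\delta\varpi_a}L_{-\delta\varpi_a}=16\,p_a^\delta\big((Z-\delta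 H_b)^2-(H_a-\tfrac12\delta)^2\big)$. 3. $L_{\alpha}L_{-\alpha}=16\,p_1^\delta p_2^\varepsilon\big((\delta H_1+\varepsilon H_2-1)^2-(Z-\tfrac12\delta\varepsilon)^2\big)$ for $\alpha=\delta\varpi_1+\varepsilon\varpi_2$. 4. $L_{\delta\varpi_1}L_{\varepsilon\varpi_2}=4L_{\delta\varpi_1+\varepsilon\varpi_2}\big(Z+\varepsilon H_1-\delta H_2-\tfrac12\delta\varepsilon\big)$ and $L_{\delta\varpi_2}L_{\varepsilon\varpi_1}=-4L_{\varepsilon\varpi_1+\delta\varpi_2}\big(Z+\varepsilon H_2-\delta H_1-\tfrac12\delta\varepsilon\big)$. -/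

import Mathlib

open scoped TensorProduct

noncomputable section

namespace DoubleDihedral

/-! The Euclidean space `ℝ⁴ = V₁ ⊕ V₂`, with `V_a` spanned by `x_{2a-1}, x_{2a}`. Blocks are indexed
by `Fin 2` and coordinates by `Fin 4` (both starting at `0`). -/

abbrev VR : Type := EuclideanSpace ℝ (Fin 4)

abbrev V : Type := Fin 4 → ℂ

/-- The index of the first basis vector of the block `a`. -/
def fstIdx (a : Fin 2) : Fin 4 := ![0, 2] a

/-- The index of the second basis vector of the block `a`. -/
def sndIdx (a : Fin 2) : Fin 4 := ![1, 3] a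

/-- The root `(sin (pπ/m_a), -cos (pπ/m_a))` in the block `a`. -/
def root (m : Fin 2 → ℕ) (a : Fin 2) (p : ℕ) : VR :=
  EuclideanSpace.single (fstIdx a) (Real.sin (p * Real.pi / m a))
    - EuclideanSpace.single (sndIdx a) (Real.cos (p * Real.pi / m a))

/-- The root system of type `I₂(m₁) ⊕ I₂(m₂)`. -/
def rootSystem (m : Fin 2 → ℕ) : Set VR :=
  {α | ∃ (a : Fin 2) (p : ℕ), 1 ≤ p ∧ p ≤ 2 * m a ∧ α = root m a p}

/-- Indices of the positive roots: `⟨a, j⟩` stands for the root `root m a (j + 1)`, so that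
`j + 1` runs through `1, …, m_a`. -/
abbrev PosIdx (m : Fin 2 → ℕ) : Type := (a : Fin 2) × Fin (m a)

/-- The positive roots. -/
def posRoot (m : Fin 2 → ℕ) (i : PosIdx m) : rootSystem m :=
  ⟨root m i.1 (i.2 + 1), i.1, i.2 + 1, by omega, by have := i.2.isLt; omega, rfl⟩

/-- The orthogonal reflection in the hyperplane orthogonal to `α`. -/
def refl (α : VR) : VR ≃ₗᵢ[ℝ] VR := (Submodule.span ℝ {α})ᗮ.reflection

/-- The reflection group `W = D_{2m₁} × D_{2m₂} ⊂ O(4)`. -/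
def W (m : Fin 2 → ℕ) : Subgroup (VR ≃ₗᵢ[ℝ] VR) :=
  Subgroup.closure {s | ∃ α ∈ rootSystem m, s = refl α}

/-- The reflection `s_α` as an element of `W`. -/
def reflW (m : Fin 2 → ℕ) (α : rootSystem m) : W m :=
  ⟨refl α, Subgroup.subset_closure ⟨α, α.2, rfl⟩⟩

/-- `κ : R → ℂ` is `W`-invariant. -/
def IsInvariant (m : Fin 2 → ℕ) (κ : rootSystem m → ℂ) : Prop :=
  ∀ w ∈ W m, ∀ α β : rootSystem m, w (α : VR) = (β : VR) → κ β = κ α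

/-! ### The rational Cherednik algebra -/

/-- Generators `x_j`, `ξ_j = B(x_j)` and `w ∈ W` of the rational Cherednik algebra. -/
inductive Gen (m : Fin 2 → ℕ) : Type
  | x (j : Fin 4) : Gen m
  | xi (j : Fin 4) : Gen m
  | grp (w : W m) : Gen m

/-- The entry `(i, j)` of the matrix of `w`, i.e. `w x_j = ∑ i, entry w i j • x_i`. As `w` is
orthogonal and `ξ_j = B(x_j)`, also `w ξ_j = ∑ i, entry w i j • ξ_i`. -/
def entry {m : Fin 2 → ℕ} (w : W m) (i j : Fin 4) : ℂ :=
  (((w : VR ≃ₗᵢ[ℝ] VR) (EuclideanSpace.single j (1 : ℝ)) i : ℝ) : ℂ)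

section

variable (m : Fin 2 → ℕ)

/-- Free generators. -/
abbrev gx (j : Fin 4) : FreeAlgebra ℂ (Gen m) := FreeAlgebra.ι ℂ (Gen.x j)

/-- Free generators. -/
abbrev gxi (j : Fin 4) : FreeAlgebra ℂ (Gen m) := FreeAlgebra.ι ℂ (Gen.xi j)

/-- Free generators. -/
abbrev gw (w : W m) : FreeAlgebra ℂ (Gen m) := FreeAlgebra.ι ℂ (Gen.grp w)

/-- `ψ_κ(x_i, x_j) = ∑_{α > 0} 2 κ_α / (α, α) (x_i, α) (x_j, α) s_α`. -/
def psi (κ : rootSystem m → ℂ) (i j : Fin 4) : FreeAlgebra ℂ (Gen m) :=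
  ∑ r : PosIdx m,
    (2 * κ (posRoot m r) / ((inner ℝ (posRoot m r : VR) (posRoot m r : VR) : ℝ) : ℂ)
      * (((posRoot m r : VR) i : ℝ) : ℂ) * (((posRoot m r : VR) j : ℝ) : ℂ))
      • gw m (reflW m (posRoot m r))

/-- The defining relations of the rational Cherednik algebra: the first four present the smash
product `T(V ⊕ V^*) ⋊ ℂW`. -/
inductive CherednikRel (κ : rootSystem m → ℂ) :
    FreeAlgebra ℂ (Gen m) → FreeAlgebra ℂ (Gen m) → Prop
  | grp_one : CherednikRel κ (gw m 1) 1
  | grp_mul (v w : W m) : CherednikRel κ (gw m v * gw m w) (gw m (v * w))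
  | grp_x (w : W m) (j : Fin 4) :
      CherednikRel κ (gw m w * gx m j) ((∑ i, entry w i j • gx m i) * gw m w)
  | grp_xi (w : W m) (j : Fin 4) :
      CherednikRel κ (gw m w * gxi m j) ((∑ i, entry w i j • gxi m i) * gw m w)
  | x_comm (i j : Fin 4) : CherednikRel κ (gx m i * gx m j) (gx m j * gx m i)
  | xi_comm (i j : Fin 4) : CherednikRel κ (gxi m i * gxi m j) (gxi m j * gxi m i)
  | xi_x (i j : Fin 4) :
      CherednikRel κ (gxi m i * gx m j - gx m j * gxi m i) ((if i = j then 1 else 0) + psi m κ i j)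

/-- The rational Cherednik algebra `H_κ(V, W)`. -/
def Cherednik (κ : rootSystem m → ℂ) : Type := RingQuot (CherednikRel m κ)

instance (κ : rootSystem m → ℂ) : Ring (Cherednik m κ) :=
  inferInstanceAs (Ring (RingQuot (CherednikRel m κ)))

instance (κ : rootSystem m → ℂ) : Algebra ℂ (Cherednik m κ) :=
  inferInstanceAs (Algebra ℂ (RingQuot (CherednikRel m κ)))

end

/-! ### The Clifford algebra -/

/-- The quadratic form `v ↦ (v, v)` on `V = ℂ⁴`. -/
def quadForm : QuadraticForm ℂ V := QuadraticMap.weightedSumSquares ℂ (fun _ : Fin 4 => (1 : ℂ))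

/-- The complex Clifford algebra, with `e_j e_k + e_k e_j = 2 δ_{jk}`. -/
abbrev Cl : Type := CliffordAlgebra quadForm

/-- The standard basis vector `x_j`. -/
def stdVec (j : Fin 4) : V := Pi.single j 1

/-- The Clifford generator `e_j`. -/
def e (j : Fin 4) : Cl := CliffordAlgebra.ι quadForm (stdVec j)

/-- `(v_1, …, v_p) ↦ (1 / p!) ∑_g sgn(g) v_{g(1)} ⋯ v_{g(p)}` as an alternating map. -/
def antisym (p : ℕ) : V [⋀^Fin p]→ₗ[ℂ] Cl :=
  ((p.factorial : ℂ)⁻¹) •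
    MultilinearMap.alternatization
      ((MultilinearMap.mkPiAlgebraFin ℂ p Cl).compLinearMap
        (fun _ : Fin p => CliffordAlgebra.ι quadForm))

/-- The quantisation map `γ : ⋀ V → C`. -/
def gam : ExteriorAlgebra ℂ V →ₗ[ℂ] Cl := ExteriorAlgebra.liftAlternating antisym

/-! ### The algebra `H_κ ⊗ C` and the symmetries -/

section

variable (m : Fin 2 → ℕ) (κ : rootSystem m → ℂ)

/-- `H_κ ⊗ C`. -/
def HC : Type := Cherednik m κ ⊗[ℂ] Cl

instance : Ring (HC m κ) := inferInstanceAs (Ring (Cherednik m κ ⊗[ℂ] Cl))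

instance : Algebra ℂ (HC m κ) := inferInstanceAs (Algebra ℂ (Cherednik m κ ⊗[ℂ] Cl))

/-- The pure tensor `h ⊗ c`. -/
def pureTensor (h : Cherednik m κ) (c : Cl) : HC m κ := h ⊗ₜ[ℂ] c

/-- The image of a generator of `H_κ` in `H_κ`. -/
def gen (g : Gen m) : Cherednik m κ :=
  RingQuot.mkAlgHom ℂ (CherednikRel m κ) (FreeAlgebra.ι ℂ g)

/-- The automorphism of `H_κ ⊗ C` that is `(-1)^j` on the part of parity `j`, where
`(H_κ ⊗ C)_j = H_κ ⊗ C_j`. -/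
def parity : HC m κ →ₐ[ℂ] HC m κ :=
  (Algebra.TensorProduct.map (AlgHom.id ℂ (Cherednik m κ)) CliffordAlgebra.involute :
    Cherednik m κ ⊗[ℂ] Cl →ₐ[ℂ] Cherednik m κ ⊗[ℂ] Cl)

/-- The even component. -/
def evenPart (u : HC m κ) : HC m κ := (2⁻¹ : ℂ) • (u + parity m κ u)

/-- The odd component. -/
def oddPart (u : HC m κ) : HC m κ := (2⁻¹ : ℂ) • (u - parity m κ u)

/-- The graded commutator, `uv - (-1)^{|u||v|} vu` on homogeneous elements. -/
def gradedComm (u v : HC m κ) : HC m κ :=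
  u * v - (evenPart m κ v * evenPart m κ u + evenPart m κ v * oddPart m κ u
    + oddPart m κ v * evenPart m κ u - oddPart m κ v * oddPart m κ u)

/-- The Dunkl--Dirac operator `∑ ξ_j ⊗ e_j`. -/
def dirac : HC m κ := ∑ j : Fin 4, pureTensor m κ (gen m κ (Gen.xi j)) (e j)

/-- The vector variable `∑ x_j ⊗ e_j`. -/
def vecVar : HC m κ := ∑ j : Fin 4, pureTensor m κ (gen m κ (Gen.x j)) (e j)

/-- `P = id - (1/2) ad(dirac) ad(vecVar)`. -/
def proj (u : HC m κ) : HC m κ :=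
  u - (2⁻¹ : ℂ) • gradedComm m κ (dirac m κ) (gradedComm m κ (vecVar m κ) u)

/-- `O(v) = -(1/2) P(γ(v))` for `v ∈ ⋀ V`. -/
def O (v : ExteriorAlgebra ℂ V) : HC m κ :=
  -((2⁻¹ : ℂ) • proj m κ (pureTensor m κ 1 (gam v)))

end

/-- The value `±1 ∈ ℂ` of a sign. -/
def sgn (δ : ℤˣ) : ℂ := ((δ : ℤ) : ℂ)

/-- The isotropic vectors `z_a^± = x_{2a-1} ± i x_{2a}`, as elements of `⋀ V`. -/
def z (a : Fin 2) (δ : ℤˣ) : ExteriorAlgebra ℂ V :=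
  ExteriorAlgebra.ι ℂ (stdVec (fstIdx a) + (sgn δ * Complex.I) • stdVec (sndIdx a))

/-- The anti-commutator. -/
def acomm {A : Type} [Ring A] (u v : A) : A := u * v + v * u

section

variable (m : Fin 2 → ℕ) (κ : rootSystem m → ℂ)

/-- `O_a^δ = O(z_a^δ)`. -/
def O1 (a : Fin 2) (δ : ℤˣ) : HC m κ := O m κ (z a δ)

/-- `H_a = (1/2) O(z_a ∧ z̄_a)`. -/
def Hop (a : Fin 2) : HC m κ := (2⁻¹ : ℂ) • O m κ (z a 1 * z a (-1))

/-- `Z = O(x_1 ∧ x_2 ∧ x_3 ∧ x_4)`. -/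
def Zop : HC m κ := O m κ (ExteriorAlgebra.ιMulti ℂ 4 stdVec)

/-- The ladder element of the even root `δ ϖ_1 + ε ϖ_2`. -/
def evenLadder (δ ε : ℤˣ) : HC m κ :=
  acomm (Hop m κ 0) (acomm (Hop m κ 1) (O m κ (z 0 δ * z 1 ε)))

/-- The ladder element of the odd root `ε ϖ_b`; here `1 - b` is the other index. -/
def oddLadder (b : Fin 2) (ε : ℤˣ) : HC m κ :=
  acomm (Hop m κ b) (O m κ (z b ε * z (1 - b) 1 * z (1 - b) (-1)))

/-- `s̃_α = s_α ⊗ γ(α)` for a positive root `α`. -/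
def sTilde (i : PosIdx m) : HC m κ :=
  pureTensor m κ (gen m κ (Gen.grp (reflW m (posRoot m i))))
    (CliffordAlgebra.ι quadForm (fun j => (((posRoot m i : VR) j : ℝ) : ℂ)))

/-- `r̃_a = z s̃_{m_a} s̃_1` in the block `a`, where the central element `z` of the double cover
acts as `-1`. -/
def rTilde [∀ a, NeZero (m a)] (a : Fin 2) : HC m κ :=
  -(sTilde m κ ⟨a, Fin.rev 0⟩ * sTilde m κ ⟨a, 0⟩)

/-- The associative algebra `T_0` generated by `t_0 = span {H_1, H_2, Z, r̃_1, r̃_2}`. -/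
def T0 [∀ a, NeZero (m a)] : Subalgebra ℂ (HC m κ) :=
  Algebra.adjoin ℂ
    {Hop m κ 0, Hop m κ 1, Zop m κ, rTilde m κ 0, rTilde m κ 1}

/-- The scalar `c` in `H_κ ⊗ C`. -/
def sc (c : ℂ) : HC m κ := algebraMap ℂ (HC m κ) c

/-- `p_a^δ = (H_a - δ/2)² - O_a^δ O_a^{-δ}`. -/
def pPoly (a : Fin 2) (δ : ℤˣ) : HC m κ :=
  (Hop m κ a - sc m κ (sgn δ / 2)) ^ 2 - O1 m κ a δ * O1 m κ a (-δ)

end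

end DoubleDihedral

end

open scoped TensorProduct

noncomputable section

namespace DoubleDihedral

/-! Everything splits into two planes. Each root lies in one plane, so elements of `H_κ ⊗ C` built
from one block supercommute with those built from the other (`BlockHom.koszul`). In block `a`, let
`x` and `D` be the parts of the vector variable and of the Dirac operator, `w = -i e_{2a-1} e_{2a}`
the chirality and `S = (D x - x D - 1) / 2` the Scasimir. Both `w` and `S` anticommute with `x` and
with `D`, hence `H = w S` commutes with both. Evaluating `O` gives `H_a = w S` (`Hop_eq`), and `Z`
and the symmetries with two and three indices become short expressions in block elements (`Zop_eq`,
`O_z_z_eq`, `O_z_z_z_eq`).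

The one-index symmetries `O_a^δ` anticommute with `H_a`, so the anticommutators in the ladder
elements erase every term containing them. What remains are words in the ladder vectors `c`, `z`,
`d`, the anticommutators of `H_a` with the isotropic Clifford generator, coordinate and Dunkl
operator: `z d - d z + c c / 2` for an even root, and `2 (z D - d x + c S + c / 2) w` for an odd one
(`evenWord`, `oddWord`).

The essential computation takes place in a single plane (`BlockRel`). With `M` the angular momentum,
`{H, c^±} = 2 M c^±`, `M c^+` raises `H` by one, and `M² c^+ c^- = ((H - 1/2)² - O^+ O^-) c^+ c^-`
(`BlockRel.M_sq_cp_cm`). The last identity is the source of the factor `p`: every product of two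
opposite ladder vectors is `p` times a word in `x`, `D`, `w`, `S` (`OppositeCore.oppositeRel`).
Together with the exchange relations of `LadderCore.ladderRel`, this turns claims 2, 3 and 4 into
identities between words in two supercommuting alphabets. They are checked by comparing normal forms
(`oddWord_mul_opposite`, `evenWord_mul_opposite`, `oddWord_mul_oddWord`).

Claim 1 is independent of this. `O_a^δ` is a linear combination of lifted reflections of block `a`,
and the product of two of these is a product of powers of `r̃_a`, up to sign (`sTilde_mul_mem`). -/

/-! ### Ladder words in two super-commuting families -/

/-- Names for the elements attached to one block: the vector variable `x`, the Dirac operator `D`,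
the chirality `w`, the Scasimir `S`, two opposite triples `(c, z, d)`, `(c', z', d')` of ladder
vectors and the polynomial `p`. -/
inductive Sym
  | c | z | d | c' | z' | d' | x | D | w | S | p

/-- The parity of a symbol; `true` stands for odd. -/
def Sym.odd : Sym → Bool
  | .x | .D | .c | .c' => true
  | _ => false

/-- The Koszul sign of two parities. -/
def koszul : Bool → Bool → ℂ
  | true, true => -1
  | _, _ => 1

section

variable {A : Type} [Ring A] [Algebra ℂ A]

/-- Relations that bring words in `x`, `D`, `S`, `w` and one of `c`, `z`, `d` to normal form. -/
structure LadderRel (u : Sym → A) : Prop where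
  D_x : u .D * u .x = u .x * u .D + (2 : ℂ) • u .S + 1
  S_x : u .S * u .x = -(u .x * u .S)
  S_D : u .S * u .D = -(u .D * u .S)
  x_w : u .x * u .w = -(u .w * u .x)
  D_w : u .D * u .w = -(u .w * u .D)
  S_w : u .S * u .w = u .w * u .S
  w_w : u .w * u .w = 1
  x_c : u .x * u .c = (2 : ℂ) • u .z - u .c * u .x
  D_c : u .D * u .c = (2 : ℂ) • u .d - u .c * u .D
  w_c : u .w * u .c = u .c
  c_w : u .c * u .w = -u .c
  S_c : u .S * u .c = u .c - u .c * u .S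
  x_z : u .x * u .z = u .z * u .x
  D_z : u .D * u .z = u .z * u .D + u .c
  w_z : u .w * u .z = u .c * u .x - u .z
  z_w : u .z * u .w = u .c * u .x - u .z
  S_z : u .S * u .z = u .z * u .S + u .c * u .x - u .z
  x_d : u .x * u .d = u .z * u .D + u .c * u .S - (2⁻¹ : ℂ) • u .c
  D_d : u .D * u .d = u .d * u .D
  w_d : u .w * u .d = u .c * u .D - u .d
  d_w : u .d * u .w = u .c * u .D - u .d
  S_d : u .S * u .d = u .d * u .S + u .c * u .D - u .d
  d_x : u .d * u .x = u .z * u .D + u .c * u .S + (2⁻¹ : ℂ) • u .c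

/-- Products of opposite ladder vectors. -/
structure OppositeRel (u : Sym → A) : Prop where
  c_c : u .c * u .c' = (8 : ℂ) • (u .p * (1 + u .w))
  c_z : u .c * u .z' = (4 : ℂ) • (u .p * ((1 + u .w) * u .x))
  c_d : u .c * u .d' = (4 : ℂ) • (u .p * ((1 + u .w) * u .D))
  z_c : u .z * u .c' = (4 : ℂ) • (u .p * (u .x * (1 + u .w)))
  d_c : u .d * u .c' = (4 : ℂ) • (u .p * (u .D * (1 + u .w)))
  z_z : u .z * u .z' = (4 : ℂ) • (u .p * (u .x * u .x))
  d_d : u .d * u .d' = (4 : ℂ) • (u .p * (u .D * u .D))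
  z_d : u .z * u .d' =
    (4 : ℂ) • (u .p * (u .x * u .D + (1 + u .w) * (u .S - (2⁻¹ : ℂ) • 1)))
  d_z : u .d * u .z' =
    (4 : ℂ) • (u .p * (u .D * u .x - (1 + u .w) * (u .S - (2⁻¹ : ℂ) • 1)))

lemma mul_mul_of_eq {A : Type} [Ring A] {a b c : A} (h : a * b = c) (t : A) :
    a * (b * t) = c * t := by
  rw [← mul_assoc, h]

/-- The two families generate subalgebras that commute in the graded sense. -/
def SuperCommute (u v : Sym → A) : Prop :=
  ∀ i j, v j * u i = koszul i.odd j.odd • (u i * v j)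

/-- The normalised ladder element of an even root. -/
def evenWord (u v : Sym → A) : A :=
  u .z * v .d - u .d * v .z + (2⁻¹ : ℂ) • (u .c * v .c)

/-- The normalised ladder element of an odd root. -/
def oddWord (u v : Sym → A) : A :=
  (2 : ℂ) • ((u .z * v .D - u .d * v .x + u .c * v .S + (2⁻¹ : ℂ) • u .c) * v .w)

/-- The normalised pseudoscalar. -/
def zWord (u v : Sym → A) : A :=
  -((u .S + v .S + (2⁻¹ : ℂ) • 1 + u .D * v .x - u .x * v .D) * (u .w * v .w))

variable {u v : Sym → A}

/-- Koszul signs move every letter of `v` to the right of every letter of `u`. The relations of each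
family then reduce both factors to normal form, and the two sides are the same linear combination of
normal words. -/
theorem oddWord_mul_oddWord (hu : LadderRel u) (hv : LadderRel v) (h : SuperCommute u v) :
    oddWord u v * oddWord v u =
      (4 : ℂ) • (evenWord u v *
        (zWord u v + u .w * u .S - v .w * v .S - (2⁻¹ : ℂ) • 1)) := by
  simp only [oddWord, evenWord, zWord, mul_add, add_mul, mul_sub, sub_mul, mul_assoc, mul_neg,
    neg_mul, neg_neg, mul_one, one_mul, smul_mul_assoc, mul_smul_comm, h _ _, mul_mul_of_eq (h _ _),
    koszul, Sym.odd, one_smul, neg_smul, smul_add, smul_sub, smul_neg, mul_mul_of_eq hu.D_x,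
    mul_mul_of_eq hu.x_w, mul_mul_of_eq hu.D_w, mul_mul_of_eq hu.S_w, mul_mul_of_eq hu.c_w,
    mul_mul_of_eq hu.z_w, mul_mul_of_eq hu.d_w, mul_mul_of_eq hu.d_x, hv.D_x, hv.x_w, hv.D_w,
    hv.S_w, hv.x_c, hv.D_c, hv.w_c, hv.c_w, hv.S_c, hv.x_z, hv.D_z, hv.w_z, hv.z_w, hv.S_z, hv.x_d,
    hv.D_d, hv.w_d, hv.d_w, hv.S_d, hv.d_x, mul_mul_of_eq hv.w_c, mul_mul_of_eq hv.c_w,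
    mul_mul_of_eq hv.w_z, mul_mul_of_eq hv.z_w, mul_mul_of_eq hv.w_d, mul_mul_of_eq hv.d_w]
  module

/-- Once the letters of `v` have moved to the right, the ladder vectors of `u` stand next to their
opposites and collapse to `p` times a word in `x`, `D`, `w`, `S`. The family `v` contributes only
such letters from the start, so opposite relations are needed for `u` alone. -/
theorem oddWord_mul_opposite (hu : LadderRel u) (hv : LadderRel v)
    (hp : OppositeRel u) (h : SuperCommute u v) :
    oddWord u v * ((2 : ℂ) •
        ((u .z' * v .D - u .d' * v .x + u .c' * v .S + (2⁻¹ : ℂ) • u .c') * v .w)) =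
      (16 : ℂ) • (u .p * ((zWord u v - v .w * v .S) ^ 2
        - (u .w * u .S - (2⁻¹ : ℂ) • 1) ^ 2)) := by
  simp only [oddWord, zWord, sq, mul_add, add_mul, mul_sub, sub_mul, mul_assoc, mul_neg, neg_mul,
    neg_neg, mul_one, one_mul, smul_mul_assoc, mul_smul_comm, mul_mul_of_eq (h _ _), koszul,
    Sym.odd, one_smul, neg_smul, smul_add, smul_sub, smul_neg, hu.D_x, hu.x_w, hu.D_w, hu.S_w,
    hu.w_w, mul_mul_of_eq hu.D_x, mul_mul_of_eq hu.S_x, mul_mul_of_eq hu.S_D, mul_mul_of_eq hu.x_w,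
    mul_mul_of_eq hu.D_w, mul_mul_of_eq hu.S_w, mul_mul_of_eq hu.w_w, hv.D_x, hv.S_x, hv.S_D,
    hv.x_w, hv.D_w, hv.S_w, hv.w_w, mul_mul_of_eq hv.x_w, mul_mul_of_eq hv.D_w,
    mul_mul_of_eq hv.S_w, mul_mul_of_eq hv.w_w, hp.c_c, hp.z_d, mul_mul_of_eq hp.c_c,
    mul_mul_of_eq hp.c_z, mul_mul_of_eq hp.c_d, mul_mul_of_eq hp.z_c, mul_mul_of_eq hp.d_c,
    mul_mul_of_eq hp.z_z, mul_mul_of_eq hp.d_d, mul_mul_of_eq hp.z_d, mul_mul_of_eq hp.d_z]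
  module

theorem evenWord_mul_opposite (hu : LadderRel u) (hv : LadderRel v)
    (hp : OppositeRel u) (hq : OppositeRel v) (h : SuperCommute u v) :
    evenWord u v * (u .z' * v .d' - u .d' * v .z' + (2⁻¹ : ℂ) • (u .c' * v .c')) =
      (16 : ℂ) • (u .p * v .p * ((u .w * u .S + v .w * v .S - 1) ^ 2
        - (zWord u v - (2⁻¹ : ℂ) • 1) ^ 2)) := by
  simp only [evenWord, zWord, sq, mul_add, add_mul, mul_sub, sub_mul, mul_assoc, mul_neg, neg_mul,
    neg_neg, mul_one, one_mul, smul_mul_assoc, mul_smul_comm, h _ _, mul_mul_of_eq (h _ _), koszul,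
    Sym.odd, one_smul, neg_smul, smul_add, smul_sub, smul_neg, hu.D_x, hu.x_w, hu.D_w, hu.S_w,
    hu.w_w, mul_mul_of_eq hu.D_x, mul_mul_of_eq hu.S_x, mul_mul_of_eq hu.S_D, mul_mul_of_eq hu.x_w,
    mul_mul_of_eq hu.D_w, mul_mul_of_eq hu.S_w, mul_mul_of_eq hu.w_w, hv.D_x, hv.S_x, hv.S_D,
    hv.x_w, hv.D_w, hv.S_w, hv.w_w, mul_mul_of_eq hv.x_w, mul_mul_of_eq hv.D_w,
    mul_mul_of_eq hv.S_w, mul_mul_of_eq hv.w_w, mul_mul_of_eq hp.c_c, mul_mul_of_eq hp.c_z,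
    mul_mul_of_eq hp.c_d, mul_mul_of_eq hp.z_c, mul_mul_of_eq hp.d_c, mul_mul_of_eq hp.z_z,
    mul_mul_of_eq hp.d_d, mul_mul_of_eq hp.z_d, mul_mul_of_eq hp.d_z, hq.c_c, hq.c_z, hq.c_d,
    hq.z_c, hq.d_c, hq.z_z, hq.d_d, hq.z_d, hq.d_z]
  module

end

/-! ### Derived relations of a ladder family -/

section

variable {A : Type} [Ring A] [Algebra ℂ A] {u : Sym → A}

lemma eq_zero_of_eq_neg {a : A} (h : a = -a) : a = 0 := by
  have h2 : (2 : ℂ) • a = 0 := by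
    rw [two_smul]
    nth_rewrite 1 [h]
    exact neg_add_cancel a
  simpa using h2

/-- Defining relations from which `LadderRel` follows. -/
structure LadderCore (u : Sym → A) : Prop where
  S_eq : u .S = (2⁻¹ : ℂ) • (u .D * u .x - u .x * u .D - 1)
  S_x : u .S * u .x = -(u .x * u .S)
  S_D : u .S * u .D = -(u .D * u .S)
  x_w : u .x * u .w = -(u .w * u .x)
  D_w : u .D * u .w = -(u .w * u .D)
  S_w : u .S * u .w = u .w * u .S
  w_w : u .w * u .w = 1
  x_c : u .x * u .c = (2 : ℂ) • u .z - u .c * u .x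
  D_c : u .D * u .c = (2 : ℂ) • u .d - u .c * u .D
  w_c : u .w * u .c = u .c
  c_w : u .c * u .w = -u .c
  S_c : u .S * u .c = u .c - u .c * u .S
  x_z : u .x * u .z = u .z * u .x
  D_z : u .D * u .z = u .z * u .D + u .c
  x_d : u .x * u .d = u .d * u .x - u .c
  D_d : u .D * u .d = u .d * u .D

namespace LadderCore

lemma z_eq (h : LadderCore u) : u .z = (2⁻¹ : ℂ) • (u .x * u .c + u .c * u .x) := by
  rw [h.x_c]; module

lemma d_eq (h : LadderCore u) : u .d = (2⁻¹ : ℂ) • (u .D * u .c + u .c * u .D) := by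
  rw [h.D_c]; module

lemma w_x (h : LadderCore u) : u .w * u .x = -(u .x * u .w) := by rw [h.x_w, neg_neg]

lemma w_D (h : LadderCore u) : u .w * u .D = -(u .D * u .w) := by rw [h.D_w, neg_neg]

/-- After expanding `S = (D x - x D - 1) / 2`, the relation between `S` and `c` contains `d x` and
can be solved for it. Thus neither `x d` nor `d x` survives in normal form. -/
lemma d_x (h : LadderCore u) : u .d * u .x = u .z * u .D + u .c * u .S + (2⁻¹ : ℂ) • u .c := by
  have key := h.S_c
  simp only [h.S_eq, mul_sub, sub_mul, mul_assoc, smul_mul_assoc, mul_smul_comm, one_mul, mul_one,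
    h.x_c, h.D_c, h.x_d, h.D_z, mul_mul_of_eq h.x_c, mul_mul_of_eq h.D_c] at key ⊢
  linear_combination (norm := module) (-2⁻¹ : ℂ) • key

theorem ladderRel (h : LadderCore u) : LadderRel u where
  D_x := by rw [h.S_eq]; module
  S_x := h.S_x
  S_D := h.S_D
  x_w := h.x_w
  D_w := h.D_w
  S_w := h.S_w
  w_w := h.w_w
  x_c := h.x_c
  D_c := h.D_c
  w_c := h.w_c
  c_w := h.c_w
  S_c := h.S_c
  x_z := h.x_z
  D_z := h.D_z
  w_z := by
    rw [h.z_eq]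
    simp only [mul_add, mul_smul_comm, mul_mul_of_eq h.w_c, mul_mul_of_eq h.w_x, mul_assoc, neg_mul,
      h.w_c]
    module
  z_w := by
    rw [h.z_eq]
    simp only [add_mul, smul_mul_assoc, mul_mul_of_eq h.c_w, h.x_w, h.c_w, mul_assoc, neg_mul,
      mul_neg]
    module
  S_z := by
    simp only [h.S_eq, mul_add, add_mul, mul_sub, sub_mul, mul_assoc, smul_mul_assoc, mul_smul_comm,
      one_mul, mul_one, h.x_z, h.D_z, mul_mul_of_eq h.x_z, mul_mul_of_eq h.D_z, h.x_c]
    module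
  x_d := by
    rw [h.x_d, h.d_x]; module
  D_d := h.D_d
  w_d := by
    rw [h.d_eq]
    simp only [mul_add, mul_smul_comm, mul_mul_of_eq h.w_c, mul_mul_of_eq h.w_D, mul_assoc, neg_mul,
      h.w_c]
    module
  d_w := by
    rw [h.d_eq]
    simp only [add_mul, smul_mul_assoc, mul_mul_of_eq h.c_w, h.D_w, h.c_w, mul_assoc, neg_mul,
      mul_neg]
    module
  S_d := by
    simp only [h.S_eq, mul_sub, sub_mul, mul_assoc, smul_mul_assoc, mul_smul_comm, one_mul, mul_one,
      h.x_d, h.D_d, mul_mul_of_eq h.x_d, mul_mul_of_eq h.D_d, h.D_c]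
    module
  d_x := h.d_x

end LadderCore

/-- Defining relations from which `OppositeRel` follows. -/
structure OppositeCore (u : Sym → A) : Prop where
  x_p : u .x * u .p = u .p * u .x
  D_p : u .D * u .p = u .p * u .D
  c_c : u .c * u .c' = (8 : ℂ) • (u .p * (1 + u .w))
  w_c' : u .w * u .c' = -u .c'
  x_c' : u .x * u .c' = (2 : ℂ) • u .z' - u .c' * u .x
  D_c' : u .D * u .c' = (2 : ℂ) • u .d' - u .c' * u .D
  D_z' : u .D * u .z' = u .z' * u .D + u .c'
  x_d' : u .x * u .d' = u .d' * u .x - u .c'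

namespace OppositeCore

lemma z'_eq (h' : OppositeCore u) :
    u .z' = (2⁻¹ : ℂ) • (u .x * u .c' + u .c' * u .x) := by
  rw [h'.x_c']; module

lemma d'_eq (h' : OppositeCore u) :
    u .d' = (2⁻¹ : ℂ) • (u .D * u .c' + u .c' * u .D) := by
  rw [h'.D_c']; module

/-- The vectors `c` and `c'` absorb `w` from the inside: `c = -c w` and `c' = -w c'`. Inserting both
and moving one `w` through `y` to meet the other, where `w² = 1`, changes the sign. -/
lemma c_odd_c' (h : LadderCore u) (h' : OppositeCore u)
    {y : A} (hy : y * u .w = -(u .w * y)) : u .c * (y * u .c') = 0 := by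
  apply eq_zero_of_eq_neg
  nth_rewrite 1 [← neg_neg (u .c'), ← h'.w_c', ← neg_neg (u .c), ← h.c_w]
  simp only [mul_neg, neg_mul, neg_neg, mul_assoc, mul_mul_of_eq hy, mul_mul_of_eq h.w_w, one_mul]

lemma c_z' (h : LadderCore u) (h' : OppositeCore u) :
    u .c * u .z' = (4 : ℂ) • (u .p * ((1 + u .w) * u .x)) := by
  rw [z'_eq h']
  simp only [mul_add, mul_smul_comm, c_odd_c' h h' h.x_w, ← mul_assoc, h'.c_c, zero_add]
  simp only [add_mul, smul_mul_assoc, mul_assoc, mul_one]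
  module

lemma c_d' (h : LadderCore u) (h' : OppositeCore u) :
    u .c * u .d' = (4 : ℂ) • (u .p * ((1 + u .w) * u .D)) := by
  rw [d'_eq h']
  simp only [mul_add, mul_smul_comm, c_odd_c' h h' h.D_w, ← mul_assoc, h'.c_c, zero_add]
  simp only [add_mul, smul_mul_assoc, mul_assoc, mul_one]
  module

lemma z_c' (h : LadderCore u) (h' : OppositeCore u) :
    u .z * u .c' = (4 : ℂ) • (u .p * (u .x * (1 + u .w))) := by
  rw [h.z_eq]
  simp only [add_mul, smul_mul_assoc, mul_assoc, c_odd_c' h h' h.x_w, h'.c_c, mul_smul_comm,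
    mul_mul_of_eq h'.x_p, add_zero]
  module

lemma d_c' (h : LadderCore u) (h' : OppositeCore u) :
    u .d * u .c' = (4 : ℂ) • (u .p * (u .D * (1 + u .w))) := by
  rw [h.d_eq]
  simp only [add_mul, smul_mul_assoc, mul_assoc, c_odd_c' h h' h.D_w, h'.c_c, mul_smul_comm,
    mul_mul_of_eq h'.D_p, add_zero]
  module

theorem oppositeRel (h : LadderCore u) (h' : OppositeCore u) : OppositeRel u where
  c_c := h'.c_c
  c_z := c_z' h h'
  c_d := c_d' h h'
  z_c := z_c' h h'
  d_c := d_c' h h'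
  z_z := by
    rw [z'_eq h', mul_smul_comm, mul_add, ← mul_assoc, ← mul_assoc, ← h.x_z, mul_assoc,
      z_c' h h']
    simp only [mul_add, add_mul, smul_mul_assoc, mul_smul_comm, mul_assoc, mul_one,
      mul_mul_of_eq h'.x_p, h.x_w, mul_neg, mul_mul_of_eq h.x_w, neg_mul]
    module
  d_d := by
    rw [d'_eq h', mul_smul_comm, mul_add, ← mul_assoc, ← mul_assoc, ← h.D_d, mul_assoc,
      d_c' h h']
    simp only [mul_add, add_mul, smul_mul_assoc, mul_smul_comm, mul_assoc, mul_one,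
      mul_mul_of_eq h'.D_p, h.D_w, mul_neg, mul_mul_of_eq h.D_w, neg_mul]
    module
  z_d := by
    -- The letters `x` and `D` are pushed through `c'`, which leaves only products of `c` with `c'`,
    -- `z'`, `d'`, already known.
    have e1 : u .c * (u .x * (u .D * u .c')) =
        (8 : ℂ) • (u .p * ((1 + u .w) * (u .D * u .x - (2 : ℂ) • 1))) := by
      have : u .c * (u .x * (u .D * u .c')) = (2 : ℂ) • (u .c * u .d' * u .x)
          - (2 : ℂ) • (u .c * u .c') - (2 : ℂ) • (u .c * u .z' * u .D)
          + u .c * u .c' * (u .x * u .D) := by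
        simp only [h'.D_c', mul_sub, mul_smul_comm, h'.x_d', mul_mul_of_eq h'.x_c', sub_mul,
          smul_mul_assoc, mul_assoc]
        module
      rw [this, c_d' h h', c_z' h h', h'.c_c]
      simp only [mul_add, add_mul, smul_mul_assoc, mul_smul_comm, mul_assoc, mul_one, one_mul,
        mul_sub]
      module
    -- In `z = (x c + c x) / 2` the first summand drops out, because `c D c' = 0`.
    have e2 : u .z * (u .D * u .c') = (2⁻¹ : ℂ) • (u .c * (u .x * (u .D * u .c'))) := by
      rw [h.z_eq]
      simp only [add_mul, smul_mul_assoc, mul_assoc, c_odd_c' h h' h.D_w, mul_zero, zero_add]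
    rw [d'_eq h', mul_smul_comm, mul_add, e2, e1, mul_mul_of_eq (z_c' h h'), h.S_eq]
    simp only [mul_add, add_mul, smul_mul_assoc, mul_smul_comm, mul_assoc, mul_one, one_mul,
      mul_sub, mul_mul_of_eq h.x_w, neg_mul, mul_neg]
    module
  d_z := by
    have e1 : u .c * (u .D * (u .x * u .c')) =
        (8 : ℂ) • (u .p * ((1 + u .w) * (u .x * u .D + (2 : ℂ) • 1))) := by
      have : u .c * (u .D * (u .x * u .c')) = (2 : ℂ) • (u .c * u .z' * u .D)
          + (2 : ℂ) • (u .c * u .c') - (2 : ℂ) • (u .c * u .d' * u .x)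
          + u .c * u .c' * (u .D * u .x) := by
        simp only [h'.x_c', mul_sub, mul_smul_comm, h'.D_z', mul_mul_of_eq h'.D_c', sub_mul,
          smul_mul_assoc, mul_assoc, mul_add]
        module
      rw [this, c_d' h h', c_z' h h', h'.c_c]
      simp only [mul_add, add_mul, smul_mul_assoc, mul_smul_comm, mul_assoc, mul_one, one_mul]
      module
    have e2 : u .d * (u .x * u .c') = (2⁻¹ : ℂ) • (u .c * (u .D * (u .x * u .c'))) := by
      rw [h.d_eq]
      simp only [add_mul, smul_mul_assoc, mul_assoc, c_odd_c' h h' h.x_w, mul_zero, zero_add]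
    rw [z'_eq h', mul_smul_comm, mul_add, e2, e1, mul_mul_of_eq (d_c' h h'), h.S_eq]
    simp only [mul_add, add_mul, smul_mul_assoc, mul_smul_comm, mul_assoc, mul_one, one_mul,
      mul_sub, mul_mul_of_eq h.D_w, neg_mul, mul_neg]
    module

end OppositeCore

end

/-! ### Ladder families of a plane -/

section

variable {A : Type} [Ring A] [Algebra ℂ A]

/-- The pairing `(z⁺ c⁻ + z⁻ c⁺) / 2` of two vectors in isotropic coordinates. -/
def pairing (zp zm cp cm : A) : A := (2⁻¹ : ℂ) • (zp * cm + zm * cp)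

/-- The pairing `(z⁺ d⁻ - z⁻ d⁺) / 2` of two vectors in isotropic coordinates. -/
def momentum (zp zm dp dm : A) : A := (2⁻¹ : ℂ) • (zp * dm - zm * dp)

/-- The chirality element of a plane. -/
def chirality (cp cm : A) : A := (2⁻¹ : ℂ) • (cp * cm) - 1

/-- The Scasimir element. -/
def scasimir (x D : A) : A := (2⁻¹ : ℂ) • (D * x - x * D - 1)

/-- Relations between coordinates, Dunkl operators, Clifford generators and one-index symmetries of
one plane, in isotropic coordinates. -/
structure BlockRel (zp zm dp dm cp cm Op Om : A) : Prop where
  cp_cp : cp * cp = 0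
  cm_cm : cm * cm = 0
  cm_cp : cm * cp = (4 : ℂ) • 1 - cp * cm
  cp_zp : cp * zp = zp * cp
  cp_zm : cp * zm = zm * cp
  cm_zp : cm * zp = zp * cm
  cm_zm : cm * zm = zm * cm
  cp_dp : cp * dp = dp * cp
  cp_dm : cp * dm = dm * cp
  cm_dp : cm * dp = dp * cm
  cm_dm : cm * dm = dm * cm
  zm_zp : zm * zp = zp * zm
  dm_dp : dm * dp = dp * dm
  dp_zm : dp * zm = zm * dp + (2 : ℂ) • 1 + (cp * Om + cm * Op)
  dm_zp : dm * zp = zp * dm + (2 : ℂ) • 1 + (cp * Om + cm * Op)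
  Op_cm : Op * cm = cp * Om
  Om_cp : Om * cp = cm * Op
  Op_zm : Op * zm = -(zp * Om)
  Op_dm : Op * dm = -(dp * Om)
  D_zp : pairing dp dm cp cm * zp = zp * pairing dp dm cp cm + cp + (2 : ℂ) • Op
  D_zm : pairing dp dm cp cm * zm = zm * pairing dp dm cp cm + cm + (2 : ℂ) • Om
  x_dp : pairing zp zm cp cm * dp = dp * pairing zp zm cp cm - cp - (2 : ℂ) • Op
  x_dm : pairing zp zm cp cm * dm = dm * pairing zp zm cp cm - cm - (2 : ℂ) • Om
  Op_x : Op * pairing zp zm cp cm = -(pairing zp zm cp cm * Op)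
  Om_x : Om * pairing zp zm cp cm = -(pairing zp zm cp cm * Om)
  Op_D : Op * pairing dp dm cp cm = -(pairing dp dm cp cm * Op)
  Om_D : Om * pairing dp dm cp cm = -(pairing dp dm cp cm * Om)
  Op_W : Op * chirality cp cm = -(chirality cp cm * Op)
  Om_W : Om * chirality cp cm = -(chirality cp cm * Om)
  Op_M : Op * momentum zp zm dp dm = -(momentum zp zm dp dm * Op)
  Om_M : Om * momentum zp zm dp dm = -(momentum zp zm dp dm * Om)

namespace BlockRel

variable {zp zm dp dm cp cm Op Om : A}

local notation "x₀" => pairing zp zm cp cm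
local notation "D₀" => pairing dp dm cp cm
local notation "W₀" => chirality cp cm
local notation "M₀" => momentum zp zm dp dm
local notation "S₀" => scasimir x₀ D₀
local notation "H₀" => W₀ * S₀

/-! ### Chirality, angular momentum and Scasimir of one plane -/

lemma x_sq (h : BlockRel zp zm dp dm cp cm Op Om) : x₀ * x₀ = zp * zm := by
  simp only [pairing, mul_add, add_mul, smul_mul_assoc, mul_smul_comm, mul_assoc, mul_sub,
    mul_mul_of_eq h.cp_zp, mul_mul_of_eq h.cp_zm, mul_mul_of_eq h.cm_zp, mul_mul_of_eq h.cm_zm,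
    h.cp_cp, h.cm_cm, h.cm_cp, mul_zero, mul_one, mul_mul_of_eq h.zm_zp]
  module

lemma D_sq (h : BlockRel zp zm dp dm cp cm Op Om) : D₀ * D₀ = dp * dm := by
  simp only [pairing, mul_add, add_mul, smul_mul_assoc, mul_smul_comm, mul_assoc, mul_sub,
    mul_mul_of_eq h.cp_dp, mul_mul_of_eq h.cp_dm, mul_mul_of_eq h.cm_dp, mul_mul_of_eq h.cm_dm,
    h.cp_cp, h.cm_cm, h.cm_cp, mul_zero, mul_one, mul_mul_of_eq h.dm_dp]
  module

lemma W_cp (h : BlockRel zp zm dp dm cp cm Op Om) : W₀ * cp = cp := by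
  simp only [chirality, sub_mul, mul_assoc, smul_mul_assoc, h.cm_cp, mul_sub, mul_smul_comm,
    mul_one, one_mul, mul_mul_of_eq h.cp_cp, zero_mul]
  module

lemma cp_W (h : BlockRel zp zm dp dm cp cm Op Om) : cp * W₀ = -cp := by
  simp only [chirality, mul_sub, mul_smul_comm, mul_mul_of_eq h.cp_cp, zero_mul, mul_one]
  module

lemma W_cm (h : BlockRel zp zm dp dm cp cm Op Om) : W₀ * cm = -cm := by
  simp only [chirality, sub_mul, mul_assoc, smul_mul_assoc, h.cm_cm, mul_zero, one_mul]
  module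

lemma cm_W (h : BlockRel zp zm dp dm cp cm Op Om) : cm * W₀ = cm := by
  simp only [chirality, mul_sub, mul_assoc, mul_smul_comm, mul_mul_of_eq h.cm_cp, sub_mul,
    smul_mul_assoc, h.cm_cm, one_mul, mul_one, mul_zero]
  module

lemma W_W (h : BlockRel zp zm dp dm cp cm Op Om) : W₀ * W₀ = 1 := by
  nth_rewrite 2 [chirality]
  rw [mul_sub, mul_smul_comm, ← mul_assoc, h.W_cp, mul_one, chirality]
  abel

lemma W_zp (h : BlockRel zp zm dp dm cp cm Op Om) : W₀ * zp = zp * W₀ := by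
  simp only [chirality, sub_mul, mul_sub, smul_mul_assoc, mul_smul_comm, mul_assoc, h.cm_zp,
    mul_mul_of_eq h.cp_zp, one_mul, mul_one]

lemma W_zm (h : BlockRel zp zm dp dm cp cm Op Om) : W₀ * zm = zm * W₀ := by
  simp only [chirality, sub_mul, mul_sub, smul_mul_assoc, mul_smul_comm, mul_assoc, h.cm_zm,
    mul_mul_of_eq h.cp_zm, one_mul, mul_one]

lemma W_dp (h : BlockRel zp zm dp dm cp cm Op Om) : W₀ * dp = dp * W₀ := by
  simp only [chirality, sub_mul, mul_sub, smul_mul_assoc, mul_smul_comm, mul_assoc, h.cm_dp,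
    mul_mul_of_eq h.cp_dp, one_mul, mul_one]

lemma W_dm (h : BlockRel zp zm dp dm cp cm Op Om) : W₀ * dm = dm * W₀ := by
  simp only [chirality, sub_mul, mul_sub, smul_mul_assoc, mul_smul_comm, mul_assoc, h.cm_dm,
    mul_mul_of_eq h.cp_dm, one_mul, mul_one]

lemma W_M (h : BlockRel zp zm dp dm cp cm Op Om) : W₀ * M₀ = M₀ * W₀ := by
  simp only [momentum, sub_mul, mul_sub, smul_mul_assoc, mul_smul_comm, mul_assoc, h.W_dm, h.W_dp,
    mul_mul_of_eq h.W_zp, mul_mul_of_eq h.W_zm]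

lemma cp_M (h : BlockRel zp zm dp dm cp cm Op Om) : cp * M₀ = M₀ * cp := by
  simp only [momentum, sub_mul, mul_sub, smul_mul_assoc, mul_smul_comm, mul_assoc, h.cp_dm, h.cp_dp,
    mul_mul_of_eq h.cp_zp, mul_mul_of_eq h.cp_zm]

lemma cm_M (h : BlockRel zp zm dp dm cp cm Op Om) : cm * M₀ = M₀ * cm := by
  simp only [momentum, sub_mul, mul_sub, smul_mul_assoc, mul_smul_comm, mul_assoc, h.cm_dm, h.cm_dp,
    mul_mul_of_eq h.cm_zp, mul_mul_of_eq h.cm_zm]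

lemma x_W (h : BlockRel zp zm dp dm cp cm Op Om) : x₀ * W₀ = -(W₀ * x₀) := by
  simp only [pairing, mul_add, add_mul, smul_mul_assoc, mul_smul_comm, mul_assoc, h.cm_W, h.cp_W,
    mul_mul_of_eq h.W_zp, mul_mul_of_eq h.W_zm, h.W_cm, h.W_cp, mul_neg]
  module

lemma D_W (h : BlockRel zp zm dp dm cp cm Op Om) : D₀ * W₀ = -(W₀ * D₀) := by
  simp only [pairing, mul_add, add_mul, smul_mul_assoc, mul_smul_comm, mul_assoc, h.cm_W, h.cp_W,
    mul_mul_of_eq h.W_dp, mul_mul_of_eq h.W_dm, h.W_cm, h.W_cp, mul_neg]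
  module

lemma D_x_sub (h : BlockRel zp zm dp dm cp cm Op Om) : D₀ * x₀ - x₀ * D₀ =
    (2 : ℂ) • (M₀ * W₀) + (2 : ℂ) • 1 + (cp * Om + cm * Op) := by
  have h1 := h.dp_zm
  have h2 := h.dm_zp
  -- Treating the reflection part of `[d^±, z^∓]` as one atom keeps the normal form free of `O^±`;
  -- both commutators contain the same `ψ`, so it never has to be opened.
  generalize cp * Om + cm * Op = ψ at *
  simp only [pairing, momentum, chirality, mul_add, add_mul, mul_sub, sub_mul, smul_mul_assoc,
    mul_smul_comm, mul_assoc, mul_mul_of_eq h.cp_zp, mul_mul_of_eq h.cp_zm, mul_mul_of_eq h.cm_zp,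
    mul_mul_of_eq h.cm_zm, mul_mul_of_eq h.cp_dp, mul_mul_of_eq h.cp_dm, mul_mul_of_eq h.cm_dp,
    mul_mul_of_eq h.cm_dm, h.cp_cp, h.cm_cm, h.cm_cp, mul_zero, mul_one, one_mul, h1,
    mul_mul_of_eq h1, mul_mul_of_eq h2]
  module

/-- Equivalent to `[D, x²] = 2 x`. As `x² = z^+ z^-`, the operator `D` acts as a derivation on two
factors, and the reflection terms `O^+ z^-` and `z^+ O^-` cancel. -/
lemma S_x (h : BlockRel zp zm dp dm cp cm Op Om) : S₀ * x₀ = -(x₀ * S₀) := by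
  have key : D₀ * (x₀ * x₀) = x₀ * x₀ * D₀ + (2 : ℂ) • x₀ := by
    rw [h.x_sq, mul_mul_of_eq h.D_zp]
    simp only [add_mul, smul_mul_assoc, mul_assoc, h.Op_zm, h.D_zm, mul_add, mul_smul_comm,
      h.cp_zm]
    simp only [pairing]
    module
  simp only [scasimir, smul_mul_assoc, mul_smul_comm, sub_mul, mul_sub, mul_assoc, one_mul,
    mul_one] at key ⊢
  linear_combination (norm := module) (2⁻¹ : ℂ) • key

lemma S_D (h : BlockRel zp zm dp dm cp cm Op Om) : S₀ * D₀ = -(D₀ * S₀) := by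
  have key : x₀ * (D₀ * D₀) = D₀ * D₀ * x₀ - (2 : ℂ) • D₀ := by
    rw [h.D_sq, mul_mul_of_eq h.x_dp]
    simp only [sub_mul, smul_mul_assoc, mul_assoc, h.Op_dm, h.x_dm, mul_sub, mul_smul_comm,
      h.cp_dm]
    simp only [pairing]
    module
  simp only [scasimir, smul_mul_assoc, mul_smul_comm, sub_mul, mul_sub, mul_assoc, one_mul,
    mul_one] at key ⊢
  linear_combination (norm := module) (-2⁻¹ : ℂ) • key

lemma S_W (h : BlockRel zp zm dp dm cp cm Op Om) : S₀ * W₀ = W₀ * S₀ := by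
  simp only [scasimir, smul_mul_assoc, mul_smul_comm, sub_mul, mul_sub, mul_assoc, one_mul,
    mul_one, h.x_W, h.D_W, mul_neg, neg_mul, mul_mul_of_eq h.x_W, mul_mul_of_eq h.D_W, neg_neg]

lemma H_eq (h : BlockRel zp zm dp dm cp cm Op Om) :
    H₀ = M₀ + (2⁻¹ : ℂ) • W₀ + (2⁻¹ : ℂ) • (cp * Om - cm * Op) := by
  rw [scasimir, h.D_x_sub]
  simp only [mul_smul_comm, mul_add, mul_sub, mul_one, mul_mul_of_eq h.W_M, mul_mul_of_eq h.W_cp,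
    mul_mul_of_eq h.W_cm, mul_assoc, h.W_W, neg_mul]
  module

lemma cm_Op_cp (h : BlockRel zp zm dp dm cp cm Op Om) (t : A) : cm * (Op * (cp * t)) = 0 := by
  rw [← mul_assoc, ← h.Om_cp, mul_assoc, mul_mul_of_eq h.cp_cp, zero_mul, mul_zero]

lemma cp_Om_cm (h : BlockRel zp zm dp dm cp cm Op Om) (t : A) : cp * (Om * (cm * t)) = 0 := by
  rw [← mul_assoc, ← h.Op_cm, mul_assoc, mul_mul_of_eq h.cm_cm, zero_mul, mul_zero]

/-- In `H = M + W / 2 + (c^+ O^- - c^- O^+) / 2` only `M` contributes: `W` anticommutes with `c^+`,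
and the reflection terms cancel by `O^- c^+ = c^- O^+` and `(c^+)² = 0`. -/
lemma H_cp_add (h : BlockRel zp zm dp dm cp cm Op Om) :
    H₀ * cp + cp * H₀ = (2 : ℂ) • (M₀ * cp) := by
  have e := h.cm_Op_cp 1
  rw [mul_one] at e
  simp only [h.H_eq, mul_add, add_mul, mul_sub, sub_mul, smul_mul_assoc, mul_smul_comm, mul_assoc,
    h.W_cp, h.cp_W, h.cp_M, h.Om_cp, e, mul_mul_of_eq h.cp_cp, zero_mul]
  module

lemma H_cm_add (h : BlockRel zp zm dp dm cp cm Op Om) :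
    H₀ * cm + cm * H₀ = (2 : ℂ) • (M₀ * cm) := by
  have e := h.cp_Om_cm 1
  rw [mul_one] at e
  simp only [h.H_eq, mul_add, add_mul, mul_sub, sub_mul, smul_mul_assoc, mul_smul_comm, mul_assoc,
    h.W_cm, h.cm_W, h.cm_M, h.Op_cm, e, mul_mul_of_eq h.cm_cm, zero_mul]
  module

/-- Both factors of `H = W S` anticommute with `x`. -/
lemma H_x (h : BlockRel zp zm dp dm cp cm Op Om) : H₀ * x₀ = x₀ * H₀ := by
  rw [mul_assoc, h.S_x, mul_neg, ← mul_assoc x₀, h.x_W, neg_mul, mul_assoc]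

lemma H_D (h : BlockRel zp zm dp dm cp cm Op Om) : H₀ * D₀ = D₀ * H₀ := by
  rw [mul_assoc, h.S_D, mul_neg, ← mul_assoc D₀, h.D_W, neg_mul, mul_assoc]

/-- `O^+` anticommutes with `x`, `D` and `W`, so it commutes with `S` and anticommutes with `W S`.
This is what removes the one-index symmetries from the ladder elements. -/
lemma H_Op (h : BlockRel zp zm dp dm cp cm Op Om) : H₀ * Op = -(Op * H₀) := by
  simp only [scasimir, smul_mul_assoc, mul_smul_comm, sub_mul, mul_sub, mul_assoc, mul_one,
    mul_mul_of_eq h.Op_W, h.Op_W, mul_mul_of_eq h.Op_x, h.Op_x, mul_mul_of_eq h.Op_D, h.Op_D,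
    mul_neg, neg_mul, neg_neg]
  module

lemma H_Om (h : BlockRel zp zm dp dm cp cm Op Om) : H₀ * Om = -(Om * H₀) := by
  simp only [scasimir, smul_mul_assoc, mul_smul_comm, sub_mul, mul_sub, mul_assoc, mul_one,
    mul_mul_of_eq h.Om_W, h.Om_W, mul_mul_of_eq h.Om_x, h.Om_x, mul_mul_of_eq h.Om_D, h.Om_D,
    mul_neg, neg_mul, neg_neg]
  module

/-- The ladder property proper: `M c^+` shifts `H` by one. -/
lemma H_M_cp (h : BlockRel zp zm dp dm cp cm Op Om) : H₀ * (M₀ * cp) = M₀ * cp * H₀ + M₀ * cp := by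
  have e := h.cm_Op_cp 1
  rw [mul_one] at e
  simp only [h.H_eq, mul_add, add_mul, mul_sub, sub_mul, smul_mul_assoc, mul_smul_comm, mul_assoc,
    h.W_cp, h.cp_W, h.cp_M, h.Om_cp, e, mul_mul_of_eq h.cp_cp, zero_mul, mul_mul_of_eq h.W_M,
    mul_mul_of_eq h.Om_M, mul_mul_of_eq h.Op_M, mul_mul_of_eq h.cp_M, mul_mul_of_eq h.cm_M,
    neg_mul, mul_neg, mul_zero]
  module

/-- Applied to `c^+ c^-`, the factor `H - 1/2` acts as `M` up to the term `2 c^+ O^-`. Applying it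
again, the cross terms `M c^+ O^-` cancel because `O^±` anticommute with `M`, and `c^+ c^- O^+ O^-`
is left over. This remainder is what `p` subtracts. -/
lemma M_sq_cp_cm (h : BlockRel zp zm dp dm cp cm Op Om) : M₀ * (M₀ * (cp * cm)) =
    ((H₀ - (2⁻¹ : ℂ) • 1) ^ 2 - Op * Om) * (cp * cm) := by
  have e1 : (H₀ - (2⁻¹ : ℂ) • 1) * (cp * cm) = M₀ * (cp * cm) + (2 : ℂ) • (cp * Om) := by
    simp only [h.H_eq, add_mul, sub_mul, smul_mul_assoc, mul_assoc, one_mul, mul_mul_of_eq h.W_cp,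
      mul_mul_of_eq h.Om_cp, h.Op_cm, h.cm_Op_cp, mul_mul_of_eq h.cm_cp, mul_mul_of_eq h.cp_cp,
      mul_sub, mul_smul_comm, zero_mul]
    module
  have e2 : (H₀ - (2⁻¹ : ℂ) • 1) * (cp * Om) = M₀ * (cp * Om)
      + (2⁻¹ : ℂ) • (cp * (cm * (Op * Om))) := by
    simp only [h.H_eq, add_mul, sub_mul, smul_mul_assoc, mul_assoc, one_mul, mul_mul_of_eq h.W_cp,
      mul_mul_of_eq h.Om_cp, h.cm_Op_cp]
    module
  have e3 : (H₀ - (2⁻¹ : ℂ) • 1) * (M₀ * (cp * cm)) = M₀ * (M₀ * (cp * cm))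
      - (2 : ℂ) • (M₀ * (cp * Om)) := by
    have e4 : (H₀ - (2⁻¹ : ℂ) • 1) * M₀ = M₀ * ((2 : ℂ) • M₀ + W₀ - (2⁻¹ : ℂ) • 1 - H₀) := by
      simp only [h.H_eq, mul_add, add_mul, mul_sub, sub_mul, smul_mul_assoc, mul_smul_comm,
        mul_assoc, mul_one, one_mul, h.W_M, h.Om_M, h.Op_M, mul_mul_of_eq h.cp_M,
        mul_mul_of_eq h.cm_M, mul_neg]
      module
    rw [mul_mul_of_eq e4, mul_assoc M₀]
    have e5 : ((2 : ℂ) • M₀ + W₀ - (2⁻¹ : ℂ) • 1 - H₀) * (cp * cm) =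
        (2 : ℂ) • (M₀ * (cp * cm)) + W₀ * (cp * cm) - cp * cm
          - (H₀ - (2⁻¹ : ℂ) • 1) * (cp * cm) := by
      simp only [add_mul, sub_mul, smul_mul_assoc, one_mul]
      module
    rw [e5, e1, mul_mul_of_eq h.W_cp]
    simp only [mul_add, mul_sub, mul_smul_comm]
    module
  have e6 : Op * (Om * (cp * cm)) = cp * (cm * (Op * Om)) := by
    rw [mul_mul_of_eq h.Om_cp, mul_assoc, mul_mul_of_eq h.Op_cm, mul_assoc, h.Op_cm,
      mul_mul_of_eq h.Om_cp, mul_assoc]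
  rw [sub_mul, sq, mul_assoc, e1, mul_add, mul_smul_comm, e2, e3, mul_assoc, e6]
  module

lemma x_p (h : BlockRel zp zm dp dm cp cm Op Om) : x₀ * ((H₀ - (2⁻¹ : ℂ) • 1) ^ 2 - Op * Om) =
    ((H₀ - (2⁻¹ : ℂ) • 1) ^ 2 - Op * Om) * x₀ := by
  have e : Commute x₀ (H₀ - (2⁻¹ : ℂ) • 1) :=
    Commute.sub_right h.H_x.symm ((Commute.one_right _).smul_right _)
  have e' : Commute x₀ (Op * Om) := by
    rw [Commute, SemiconjBy, mul_assoc, h.Om_x, mul_neg, ← mul_assoc, ← mul_assoc, h.Op_x, neg_mul,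
      neg_neg]
  exact (e.pow_right 2).sub_right e'

lemma D_p (h : BlockRel zp zm dp dm cp cm Op Om) : D₀ * ((H₀ - (2⁻¹ : ℂ) • 1) ^ 2 - Op * Om) =
    ((H₀ - (2⁻¹ : ℂ) • 1) ^ 2 - Op * Om) * D₀ := by
  have e : Commute D₀ (H₀ - (2⁻¹ : ℂ) • 1) :=
    Commute.sub_right h.H_D.symm ((Commute.one_right _).smul_right _)
  have e' : Commute D₀ (Op * Om) := by
    rw [Commute, SemiconjBy, mul_assoc, h.Om_D, mul_neg, ← mul_assoc, ← mul_assoc, h.Op_D, neg_mul,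
      neg_neg]
  exact (e.pow_right 2).sub_right e'

lemma x_cp (h : BlockRel zp zm dp dm cp cm Op Om) : x₀ * cp = (2 : ℂ) • zp - cp * x₀ := by
  simp only [pairing, mul_add, add_mul, smul_mul_assoc, mul_smul_comm, mul_assoc, h.cp_cp,
    h.cm_cp, mul_mul_of_eq h.cp_zp, mul_mul_of_eq h.cp_zm, mul_sub, mul_zero, mul_one]
  module

lemma x_cm (h : BlockRel zp zm dp dm cp cm Op Om) : x₀ * cm = (2 : ℂ) • zm - cm * x₀ := by
  simp only [pairing, mul_add, add_mul, smul_mul_assoc, mul_smul_comm, mul_assoc, h.cm_cm,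
    h.cm_cp, mul_mul_of_eq h.cm_zp, mul_mul_of_eq h.cm_zm, mul_sub, mul_zero, mul_one]
  module

lemma D_cp (h : BlockRel zp zm dp dm cp cm Op Om) : D₀ * cp = (2 : ℂ) • dp - cp * D₀ := by
  simp only [pairing, mul_add, add_mul, smul_mul_assoc, mul_smul_comm, mul_assoc, h.cp_cp,
    h.cm_cp, mul_mul_of_eq h.cp_dp, mul_mul_of_eq h.cp_dm, mul_sub, mul_zero, mul_one]
  module

lemma D_cm (h : BlockRel zp zm dp dm cp cm Op Om) : D₀ * cm = (2 : ℂ) • dm - cm * D₀ := by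
  simp only [pairing, mul_add, add_mul, smul_mul_assoc, mul_smul_comm, mul_assoc, h.cm_cm,
    h.cm_cp, mul_mul_of_eq h.cm_dp, mul_mul_of_eq h.cm_dm, mul_sub, mul_zero, mul_one]
  module

lemma x_zp (h : BlockRel zp zm dp dm cp cm Op Om) : x₀ * zp = zp * x₀ := by
  simp only [pairing, mul_add, add_mul, smul_mul_assoc, mul_smul_comm, mul_assoc, h.cm_zp,
    h.cp_zp, mul_mul_of_eq h.zm_zp]

lemma D_dp (h : BlockRel zp zm dp dm cp cm Op Om) : D₀ * dp = dp * D₀ := by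
  simp only [pairing, mul_add, add_mul, smul_mul_assoc, mul_smul_comm, mul_assoc, h.cm_dp,
    h.cp_dp, mul_mul_of_eq h.dm_dp]

end BlockRel

/-- The anticommutators with `H = W S`, together with the elements they are expressed in. -/
def blockFamily (zp zm dp dm cp cm Op Om : A) : Sym → A :=
  let x := pairing zp zm cp cm
  let D := pairing dp dm cp cm
  let W := chirality cp cm
  let S := scasimir x D
  let H := W * S
  fun
  | .x => x
  | .D => D
  | .w => W
  | .S => S
  | .c => H * cp + cp * H
  | .z => H * zp + zp * H
  | .d => H * dp + dp * H
  | .c' => H * cm + cm * H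
  | .z' => H * zm + zm * H
  | .d' => H * dm + dm * H
  | .p => (H - (2⁻¹ : ℂ) • 1) ^ 2 - Op * Om

/-- Anticommutators with `H` inherit relations with elements that commute with `H`. -/
lemma mul_acomm_of_anticomm {A : Type} [Ring A] {H y a b : A}
    (hy : H * y = y * H) (h : y * a = b - a * y) :
    y * (H * a + a * H) = (H * b + b * H) - (H * a + a * H) * y := by
  have e1 : y * (H * a + a * H) = H * (y * a) + y * a * H := by
    rw [mul_add, ← mul_assoc, ← hy, mul_assoc, mul_assoc]
  have e2 : (H * a + a * H) * y = H * (a * y) + a * y * H := by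
    rw [add_mul, mul_assoc, mul_assoc, hy, mul_assoc]
  rw [e1, e2, h]
  noncomm_ring

lemma mul_acomm_of_comm {A : Type} [Ring A] {H y a r : A}
    (hy : H * y = y * H) (h : y * a = a * y + r) :
    y * (H * a + a * H) = (H * a + a * H) * y + (H * r + r * H) := by
  have e1 : y * (H * a + a * H) = H * (y * a) + y * a * H := by
    rw [mul_add, ← mul_assoc, ← hy, mul_assoc, mul_assoc]
  have e2 : (H * a + a * H) * y = H * (a * y) + a * y * H := by
    rw [add_mul, mul_assoc, mul_assoc, hy, mul_assoc]
  rw [e1, e2, h]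
  noncomm_ring

namespace BlockRel

variable {zp zm dp dm cp cm Op Om : A}

theorem ladderCore (h : BlockRel zp zm dp dm cp cm Op Om) :
    LadderCore (blockFamily zp zm dp dm cp cm Op Om) where
  S_eq := rfl
  S_x := h.S_x
  S_D := h.S_D
  x_w := h.x_W
  D_w := h.D_W
  S_w := h.S_W
  w_w := h.W_W
  x_c := by
    simp only [blockFamily]
    rw [mul_acomm_of_anticomm h.H_x h.x_cp, mul_smul_comm, smul_mul_assoc, smul_add]
  D_c := by
    simp only [blockFamily]
    rw [mul_acomm_of_anticomm h.H_D h.D_cp, mul_smul_comm, smul_mul_assoc, smul_add]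
  w_c := by
    simp only [blockFamily]
    rw [h.H_cp_add, mul_smul_comm, mul_mul_of_eq h.W_M, mul_assoc, h.W_cp]
  c_w := by
    simp only [blockFamily]
    rw [h.H_cp_add, smul_mul_assoc, mul_assoc, h.cp_W, mul_neg, smul_neg]
  S_c := by
    simp only [blockFamily]
    rw [h.H_cp_add, mul_smul_comm, smul_mul_assoc]
    -- Left multiplication by `W`, with `W² = 1`, converts the shift relation for `H = W S` into one
    -- for `S`.
    have e := congrArg (chirality cp cm * ·) h.H_M_cp
    simp only [← mul_assoc, h.W_W, one_mul, mul_add, h.W_M] at e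
    simp only [mul_assoc, h.W_cp] at e
    rw [e, ← mul_assoc cp, h.cp_W]
    simp only [neg_mul, mul_neg, mul_assoc]
    module
  x_z := by
    simp only [blockFamily]
    rw [mul_acomm_of_comm (r := 0) h.H_x (by rw [h.x_zp, add_zero]), zero_mul, mul_zero, add_zero,
      add_zero]
  D_z := by
    simp only [blockFamily]
    -- The commutator `[D, z^+]` is `c^+ + 2 O^+`; its anticommutator with `H` keeps only the part
    -- coming from `c^+`.
    rw [mul_acomm_of_comm (r := cp + (2 : ℂ) • Op) h.H_D (by rw [h.D_zp, add_assoc]), mul_add,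
      add_mul cp, mul_smul_comm, smul_mul_assoc, h.H_Op]
    module
  x_d := by
    simp only [blockFamily]
    rw [mul_acomm_of_comm (r := -(cp + (2 : ℂ) • Op)) h.H_x (by rw [h.x_dp]; abel), mul_neg,
      neg_mul, mul_add, add_mul cp, mul_smul_comm, smul_mul_assoc, h.H_Op]
    module
  D_d := by
    simp only [blockFamily]
    rw [mul_acomm_of_comm (r := 0) h.H_D (by rw [h.D_dp, add_zero]), zero_mul, mul_zero, add_zero,
      add_zero]

theorem oppositeCore (h : BlockRel zp zm dp dm cp cm Op Om) :
    OppositeCore (blockFamily zp zm dp dm cp cm Op Om) where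
  x_p := h.x_p
  D_p := h.D_p
  c_c := by
    -- With `1 + w = c^+ c^- / 2`, the claim reads `2 M c^+ · 2 M c^- = 4 M² c^+ c^-`, which is the
    -- formula for `M² c^+ c^-`.
    have e : (1 : A) + chirality cp cm = (2⁻¹ : ℂ) • (cp * cm) := by rw [chirality]; abel
    simp only [blockFamily]
    rw [h.H_cp_add, h.H_cm_add, e, mul_smul_comm _ _ (cp * cm), ← h.M_sq_cp_cm, smul_mul_assoc,
      mul_smul_comm, mul_assoc, mul_mul_of_eq h.cp_M, mul_assoc]
    module
  w_c' := by
    simp only [blockFamily]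
    rw [h.H_cm_add, mul_smul_comm, mul_mul_of_eq h.W_M, mul_assoc, h.W_cm, mul_neg, smul_neg]
  x_c' := by
    simp only [blockFamily]
    rw [mul_acomm_of_anticomm h.H_x h.x_cm, mul_smul_comm, smul_mul_assoc, smul_add]
  D_c' := by
    simp only [blockFamily]
    rw [mul_acomm_of_anticomm h.H_D h.D_cm, mul_smul_comm, smul_mul_assoc, smul_add]
  D_z' := by
    simp only [blockFamily]
    rw [mul_acomm_of_comm (r := cm + (2 : ℂ) • Om) h.H_D (by rw [h.D_zm, add_assoc]), mul_add,
      add_mul cm, mul_smul_comm, smul_mul_assoc, h.H_Om]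
    module
  x_d' := by
    simp only [blockFamily]
    rw [mul_acomm_of_comm (r := -(cm + (2 : ℂ) • Om)) h.H_x (by rw [h.x_dm]; abel), mul_neg,
      neg_mul, mul_add, add_mul cm, mul_smul_comm, smul_mul_assoc, h.H_Om]
    module

theorem ladderRel (h : BlockRel zp zm dp dm cp cm Op Om) :
    LadderRel (blockFamily zp zm dp dm cp cm Op Om) :=
  h.ladderCore.ladderRel

theorem oppositeRel (h : BlockRel zp zm dp dm cp cm Op Om) :
    OppositeRel (blockFamily zp zm dp dm cp cm Op Om) :=
  OppositeCore.oppositeRel h.ladderCore h.oppositeCore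

end BlockRel

end

/-! ### Generators of the tensor product -/

section

variable {m : Fin 2 → ℕ} {κ : rootSystem m → ℂ}

/-- The inclusion of the Cherednik algebra in `H_κ ⊗ C`. -/
def inH : Cherednik m κ →ₐ[ℂ] HC m κ :=
  (Algebra.TensorProduct.includeLeft : Cherednik m κ →ₐ[ℂ] Cherednik m κ ⊗[ℂ] Cl)

/-- The inclusion of the Clifford algebra in `H_κ ⊗ C`. -/
def inC : Cl →ₐ[ℂ] HC m κ :=
  (Algebra.TensorProduct.includeRight : Cl →ₐ[ℂ] Cherednik m κ ⊗[ℂ] Cl)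

lemma pureTensor_eq (h : Cherednik m κ) (c : Cl) : pureTensor m κ h c = inH h * inC c := by
  change _ = (h ⊗ₜ[ℂ] (1 : Cl) : Cherednik m κ ⊗[ℂ] Cl) * ((1 : Cherednik m κ) ⊗ₜ[ℂ] c)
  rw [Algebra.TensorProduct.tmul_mul_tmul, mul_one, one_mul]
  rfl

lemma inC_mul_inH (h : Cherednik m κ) (c : Cl) :
    (inC c : HC m κ) * inH h = inH h * inC c := by
  rw [← pureTensor_eq]
  change ((1 : Cherednik m κ) ⊗ₜ[ℂ] c) * (h ⊗ₜ[ℂ] (1 : Cl) : Cherednik m κ ⊗[ℂ] Cl) = _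
  rw [Algebra.TensorProduct.tmul_mul_tmul, mul_one, one_mul]
  rfl

/-! ### Defining relations of `H_κ ⊗ C` and the two parities of `O` -/

variable (m κ)

/-- The coordinate `x_j` in `H_κ ⊗ C`. -/
def X (j : Fin 4) : HC m κ := inH (gen m κ (Gen.x j))

/-- The Dunkl operator `ξ_j` in `H_κ ⊗ C`. -/
def Xi (j : Fin 4) : HC m κ := inH (gen m κ (Gen.xi j))

/-- The group element `w` in `H_κ ⊗ C`. -/
def G (w : W m) : HC m κ := inH (gen m κ (Gen.grp w))

/-- The Clifford generator `e_j` in `H_κ ⊗ C`. -/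
def E (j : Fin 4) : HC m κ := inC (e j)

lemma E_X (i j : Fin 4) : E m κ i * X m κ j = X m κ j * E m κ i := inC_mul_inH _ _

lemma E_Xi (i j : Fin 4) : E m κ i * Xi m κ j = Xi m κ j * E m κ i := inC_mul_inH _ _

lemma E_G (i : Fin 4) (w : W m) : E m κ i * G m κ w = G m κ w * E m κ i := inC_mul_inH _ _

lemma E_E_add (i j : Fin 4) :
    E m κ i * E m κ j + E m κ j * E m κ i = if i = j then (2 : ℂ) • 1 else 0 := by
  rw [E, E, ← map_mul, ← map_mul, ← map_add, e, e, CliffordAlgebra.ι_mul_ι_add_swap]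
  have : QuadraticMap.polar quadForm (stdVec i) (stdVec j) = if i = j then (2 : ℂ) else 0 := by
    fin_cases i <;> fin_cases j <;>
      simp [QuadraticMap.polar, quadForm, stdVec, QuadraticMap.weightedSumSquares_apply,
        Fin.sum_univ_four] <;> norm_num
  rw [this, AlgHom.commutes, Algebra.algebraMap_eq_smul_one]
  split_ifs <;> simp

lemma E_sq (j : Fin 4) : E m κ j * E m κ j = 1 := by
  have h := E_E_add m κ j j
  rw [if_pos rfl, ← two_smul ℂ] at h
  exact smul_right_injective _ (two_ne_zero' ℂ) h

lemma E_anticomm {i j : Fin 4} (h : i ≠ j) : E m κ i * E m κ j = -(E m κ j * E m κ i) := by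
  have := E_E_add m κ i j
  rw [if_neg h] at this
  exact eq_neg_of_add_eq_zero_left this

/-- The quotient map onto the Cherednik algebra. -/
def quot : FreeAlgebra ℂ (Gen m) →ₐ[ℂ] Cherednik m κ := RingQuot.mkAlgHom ℂ (CherednikRel m κ)

lemma quot_rel {a b : FreeAlgebra ℂ (Gen m)} (h : CherednikRel m κ a b) :
    quot m κ a = quot m κ b := RingQuot.mkAlgHom_rel ℂ h

lemma inH_quot_x (j : Fin 4) : inH (quot m κ (gx m j)) = X m κ j := rfl

lemma inH_quot_xi (j : Fin 4) : inH (quot m κ (gxi m j)) = Xi m κ j := rfl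

lemma inH_quot_grp (w : W m) : inH (quot m κ (gw m w)) = G m κ w := rfl

lemma G_one : G m κ 1 = 1 := by
  have h := congrArg inH (quot_rel m κ CherednikRel.grp_one)
  rwa [map_one, map_one, inH_quot_grp] at h

lemma G_mul (v w : W m) : G m κ v * G m κ w = G m κ (v * w) := by
  have h := congrArg inH (quot_rel m κ (CherednikRel.grp_mul v w))
  simpa only [map_mul, inH_quot_grp] using h

lemma G_X (w : W m) (j : Fin 4) :
    G m κ w * X m κ j = (∑ i, entry w i j • X m κ i) * G m κ w := by
  have h := congrArg inH (quot_rel m κ (CherednikRel.grp_x w j))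
  simpa only [map_mul, map_sum, map_smul, inH_quot_grp, inH_quot_x] using h

lemma G_Xi (w : W m) (j : Fin 4) :
    G m κ w * Xi m κ j = (∑ i, entry w i j • Xi m κ i) * G m κ w := by
  have h := congrArg inH (quot_rel m κ (CherednikRel.grp_xi w j))
  simpa only [map_mul, map_sum, map_smul, inH_quot_grp, inH_quot_xi] using h

lemma X_X (i j : Fin 4) : X m κ i * X m κ j = X m κ j * X m κ i := by
  have h := congrArg inH (quot_rel m κ (CherednikRel.x_comm i j))
  simpa only [map_mul, inH_quot_x] using h

lemma Xi_Xi (i j : Fin 4) : Xi m κ i * Xi m κ j = Xi m κ j * Xi m κ i := by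
  have h := congrArg inH (quot_rel m κ (CherednikRel.xi_comm i j))
  simpa only [map_mul, inH_quot_xi] using h

/-- The coefficient of a positive root in the commutator `[ξ_i, x_j]`. -/
def rootCoeff (r : PosIdx m) (i j : Fin 4) : ℂ :=
  2 * κ (posRoot m r) / ((inner ℝ (posRoot m r : VR) (posRoot m r : VR) : ℝ) : ℂ)
      * (((posRoot m r : VR) i : ℝ) : ℂ) * (((posRoot m r : VR) j : ℝ) : ℂ)

lemma Xi_X (i j : Fin 4) : Xi m κ i * X m κ j - X m κ j * Xi m κ i =
    (if i = j then 1 else 0) + ∑ r, rootCoeff m κ r i j • G m κ (reflW m (posRoot m r)) := by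
  have h := congrArg inH (quot_rel m κ (CherednikRel.xi_x i j))
  have e1 : (quot m κ) (if i = j then 1 else 0) = if i = j then 1 else 0 := by
    split_ifs <;> simp
  have e2 : inH (m := m) (κ := κ) (if i = j then 1 else 0) = if i = j then 1 else 0 := by
    split_ifs <;> simp
  simpa only [psi, rootCoeff, map_mul, map_sub, map_add, map_sum, map_smul, inH_quot_x, inH_quot_xi,
    inH_quot_grp, e1, e2] using h

lemma dirac_eq : dirac m κ = ∑ j, Xi m κ j * E m κ j := by
  simp only [dirac, pureTensor_eq]; rfl

lemma vecVar_eq : vecVar m κ = ∑ j, X m κ j * E m κ j := by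
  simp only [vecVar, pureTensor_eq]; rfl

lemma parity_inH (h : Cherednik m κ) : parity m κ (inH h) = inH h := by
  change (Algebra.TensorProduct.map (AlgHom.id ℂ (Cherednik m κ)) CliffordAlgebra.involute :
    Cherednik m κ ⊗[ℂ] Cl →ₐ[ℂ] Cherednik m κ ⊗[ℂ] Cl) (h ⊗ₜ[ℂ] (1 : Cl)) = _
  rw [Algebra.TensorProduct.map_tmul, map_one]
  rfl

lemma parity_inC (c : Cl) : parity m κ (inC c) = inC (CliffordAlgebra.involute c) := by
  change (Algebra.TensorProduct.map (AlgHom.id ℂ (Cherednik m κ)) CliffordAlgebra.involute :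
    Cherednik m κ ⊗[ℂ] Cl →ₐ[ℂ] Cherednik m κ ⊗[ℂ] Cl) ((1 : Cherednik m κ) ⊗ₜ[ℂ] c) = _
  rw [Algebra.TensorProduct.map_tmul, map_one]
  rfl

lemma parity_X (j : Fin 4) : parity m κ (X m κ j) = X m κ j := parity_inH m κ _

lemma parity_Xi (j : Fin 4) : parity m κ (Xi m κ j) = Xi m κ j := parity_inH m κ _

lemma parity_E (j : Fin 4) : parity m κ (E m κ j) = -E m κ j := by
  rw [E, parity_inC, e, CliffordAlgebra.involute_ι, map_neg]

lemma parity_dirac : parity m κ (dirac m κ) = -dirac m κ := by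
  simp only [dirac_eq, map_sum, map_mul, parity_Xi, parity_E, mul_neg, Finset.sum_neg_distrib]

lemma parity_vecVar : parity m κ (vecVar m κ) = -vecVar m κ := by
  simp only [vecVar_eq, map_sum, map_mul, parity_X, parity_E, mul_neg, Finset.sum_neg_distrib]

variable {m κ}

lemma gradedComm_odd_odd {u v : HC m κ} (hu : parity m κ u = -u) (hv : parity m κ v = -v) :
    gradedComm m κ u v = u * v + v * u := by
  simp only [gradedComm, evenPart, oddPart, hu, hv, add_neg_cancel, smul_zero, zero_mul, mul_zero,
    sub_neg_eq_add, smul_mul_assoc, mul_smul_comm, add_mul, mul_add]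
  module

lemma gradedComm_odd_even {u v : HC m κ} (hu : parity m κ u = -u) (hv : parity m κ v = v) :
    gradedComm m κ u v = u * v - v * u := by
  simp only [gradedComm, evenPart, oddPart, hu, hv, add_neg_cancel, smul_zero, zero_mul, mul_zero,
    sub_neg_eq_add, smul_mul_assoc, mul_smul_comm, add_mul, mul_add, sub_self]
  module

/-- `O(v)` for `v` of even degree. -/
lemma O_of_even {v : ExteriorAlgebra ℂ V} {γ : HC m κ} (hγ : inC (gam v) = γ)
    (h : parity m κ γ = γ) : O m κ v = -((2⁻¹ : ℂ) • (γ - (2⁻¹ : ℂ) •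
      (dirac m κ * (vecVar m κ * γ - γ * vecVar m κ)
        + (vecVar m κ * γ - γ * vecVar m κ) * dirac m κ))) := by
  rw [O, proj, pureTensor_eq, map_one, one_mul, hγ, gradedComm_odd_even (parity_vecVar m κ) h,
    gradedComm_odd_odd (parity_dirac m κ)]
  simp only [map_sub, map_mul, h, parity_vecVar]
  noncomm_ring

/-- `O(v)` for `v` of odd degree. -/
lemma O_of_odd {v : ExteriorAlgebra ℂ V} {γ : HC m κ} (hγ : inC (gam v) = γ)
    (h : parity m κ γ = -γ) : O m κ v = -((2⁻¹ : ℂ) • (γ - (2⁻¹ : ℂ) •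
      (dirac m κ * (vecVar m κ * γ + γ * vecVar m κ)
        - (vecVar m κ * γ + γ * vecVar m κ) * dirac m κ))) := by
  rw [O, proj, pureTensor_eq, map_one, one_mul, hγ, gradedComm_odd_odd (parity_vecVar m κ) h,
    gradedComm_odd_even (parity_dirac m κ)]
  simp only [map_add, map_mul, h, parity_vecVar, neg_mul_neg]

end

/-! ### Antisymmetrised products of orthogonal vectors -/

/-- Only adjacent transpositions are treated: they exchange neighbouring factors, cost one sign, and
generate the symmetric group. -/
lemma ofFn_comp_swap_prod {R : Type} [Ring R] {n : ℕ} {f : Fin (n + 1) → R}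
    (hf : ∀ i j, i ≠ j → f i * f j = -(f j * f i)) (i : Fin n) :
    (List.ofFn (f ∘ Equiv.swap i.castSucc i.succ)).prod = -(List.ofFn f).prod := by
  induction n with
  | zero => exact i.elim0
  | succ n ih =>
    refine Fin.cases ?_ (fun i => ?_) i
    · rw [List.ofFn_succ, List.ofFn_succ, List.ofFn_succ (f := f),
        List.ofFn_succ (f := fun i => f i.succ)]
      simp only [List.prod_cons, Function.comp_apply]
      have h1 : (Equiv.swap (Fin.castSucc (0 : Fin (n + 1))) (Fin.succ 0)) 0 = Fin.succ 0 :=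
        Equiv.swap_apply_left _ _
      have h2 : (Equiv.swap (Fin.castSucc (0 : Fin (n + 1))) (Fin.succ 0)) (Fin.succ 0) = 0 :=
        Equiv.swap_apply_right _ _
      have h3 : ∀ k : Fin n, (Equiv.swap (Fin.castSucc (0 : Fin (n + 1))) (Fin.succ 0)) k.succ.succ
          = k.succ.succ := fun k => Equiv.swap_apply_of_ne_of_ne (Fin.succ_ne_zero _)
            (fun h => Fin.succ_ne_zero k (Fin.succ_injective _ h))
      simp only [h1, h2, h3]
      rw [← mul_assoc, ← mul_assoc, hf _ _ (Fin.succ_ne_zero _), neg_mul]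
    · have h0 : (Equiv.swap i.succ.castSucc i.succ.succ) 0 = 0 :=
        Equiv.swap_apply_of_ne_of_ne
          (by rw [← Fin.succ_castSucc]; exact (Fin.succ_ne_zero _).symm) (Fin.succ_ne_zero _).symm
      have hs : ∀ k, (Equiv.swap i.succ.castSucc i.succ.succ) k.succ
          = (Equiv.swap i.castSucc i.succ k).succ := fun k => by
        rw [← Fin.succ_castSucc]
        exact ((Fin.succ_injective _).map_swap _ _ k).symm
      rw [List.ofFn_succ, List.ofFn_succ (f := f)]
      simp only [List.prod_cons, Function.comp_apply, h0, hs]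
      have := ih (f := fun k => f k.succ)
        (fun a b hab => hf _ _ (fun h => hab (Fin.succ_injective _ h))) i
      simp only [Function.comp_def] at this
      rw [this, mul_neg]

lemma ofFn_comp_perm_prod {R : Type} [Ring R] {n : ℕ} (σ : Equiv.Perm (Fin n)) {f : Fin n → R}
    (hf : ∀ i j, i ≠ j → f i * f j = -(f j * f i)) :
    (List.ofFn (f ∘ σ)).prod = Equiv.Perm.sign σ • (List.ofFn f).prod := by
  cases n with
  | zero => simp [Subsingleton.elim σ 1]
  | succ n =>
    have hσ : σ ∈ Submonoid.closure
        (Set.range fun i : Fin n => Equiv.swap i.castSucc i.succ) := by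
      rw [Equiv.Perm.mclosure_swap_castSucc_succ]; trivial
    induction hσ using Submonoid.closure_induction generalizing f with
    | mem σ h =>
      obtain ⟨i, rfl⟩ := h
      rw [ofFn_comp_swap_prod hf, Equiv.Perm.sign_swap (Fin.castSucc_lt_succ).ne]
      simp
    | one => simp
    | mul σ τ _ _ h1 h2 =>
      have := h2 (f := f ∘ σ) (fun i j h => hf _ _ (σ.injective.ne h))
      rw [Equiv.Perm.coe_mul, ← Function.comp_assoc, this, h1 hf, smul_smul, map_mul, mul_comm]

/-- For pairwise anticommuting factors all `n!` signed terms are equal, so their average is the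
ordered product. Nothing is required of the squares, hence isotropic vectors are allowed. -/
lemma antisym_of_anticomm {n : ℕ} {v : Fin n → V}
    (h : ∀ i j, i ≠ j → CliffordAlgebra.ι quadForm (v i) * CliffordAlgebra.ι quadForm (v j)
      = -(CliffordAlgebra.ι quadForm (v j) * CliffordAlgebra.ι quadForm (v i))) :
    antisym n v = (List.ofFn fun i => CliffordAlgebra.ι quadForm (v i)).prod := by
  rw [antisym, AlternatingMap.smul_apply, MultilinearMap.alternatization_apply]
  have : ∀ σ : Equiv.Perm (Fin n), Equiv.Perm.sign σ • (MultilinearMap.domDomCongr σ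
      ((MultilinearMap.mkPiAlgebraFin ℂ n Cl).compLinearMap
        (fun _ : Fin n => CliffordAlgebra.ι quadForm))) v
      = (List.ofFn fun i => CliffordAlgebra.ι quadForm (v i)).prod := fun σ => by
    rw [MultilinearMap.domDomCongr_apply, MultilinearMap.compLinearMap_apply,
      MultilinearMap.mkPiAlgebraFin_apply]
    have := ofFn_comp_perm_prod σ (f := fun i => CliffordAlgebra.ι quadForm (v i)) h
    simp only [Function.comp_def] at this
    rw [this, smul_smul, Int.units_mul_self, one_smul]
  simp only [this, Finset.sum_const, Finset.card_univ, Fintype.card_perm, Fintype.card_fin]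
  rw [← Nat.cast_smul_eq_nsmul ℂ, smul_smul, inv_mul_cancel₀, one_smul]
  exact_mod_cast n.factorial_ne_zero

/-! ### Roots and reflections in coordinates -/

/-- The block of a coordinate. -/
def blk (j : Fin 4) : Fin 2 := ![0, 0, 1, 1] j

lemma blk_fstIdx (a : Fin 2) : blk (fstIdx a) = a := by fin_cases a <;> rfl

lemma blk_sndIdx (a : Fin 2) : blk (sndIdx a) = a := by fin_cases a <;> rfl

lemma fstIdx_ne_sndIdx (a : Fin 2) : fstIdx a ≠ sndIdx a := by fin_cases a <;> decide

lemma sum_eq_of_blk {M : Type} [AddCommMonoid M] {a : Fin 2} {f : Fin 4 → M}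
    (h : ∀ j, blk j ≠ a → f j = 0) : ∑ j, f j = f (fstIdx a) + f (sndIdx a) := by
  fin_cases a
  · rw [Fin.sum_univ_four, h 2 (by decide), h 3 (by decide), add_zero, add_zero]; rfl
  · rw [Fin.sum_univ_four, h 0 (by decide), h 1 (by decide), zero_add, zero_add]; rfl

section

variable (m : Fin 2 → ℕ)

lemma root_fstIdx (a : Fin 2) (p : ℕ) :
    root m a p (fstIdx a) = Real.sin (p * Real.pi / m a) := by
  simp [root, fstIdx_ne_sndIdx a]

lemma root_sndIdx (a : Fin 2) (p : ℕ) :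
    root m a p (sndIdx a) = -Real.cos (p * Real.pi / m a) := by
  simp [root, (fstIdx_ne_sndIdx a).symm]

lemma root_of_blk_ne {a : Fin 2} (p : ℕ) {j : Fin 4} (h : blk j ≠ a) : root m a p j = 0 := by
  have h1 : j ≠ fstIdx a := fun e => h (by rw [e, blk_fstIdx])
  have h2 : j ≠ sndIdx a := fun e => h (by rw [e, blk_sndIdx])
  simp [root, h1, h2]

lemma inner_root (a : Fin 2) (p : ℕ) (v : VR) :
    inner ℝ (root m a p) v
      = root m a p (fstIdx a) * v (fstIdx a) + root m a p (sndIdx a) * v (sndIdx a) := by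
  rw [PiLp.inner_apply, sum_eq_of_blk (a := a)]
  · simp [mul_comm]
  · intro j hj
    simp [root_of_blk_ne m p hj]

lemma inner_root_self (a : Fin 2) (p : ℕ) : inner ℝ (root m a p) (root m a p) = (1 : ℝ) := by
  rw [inner_root, root_fstIdx, root_sndIdx]
  nlinarith [Real.sin_sq_add_cos_sq (p * Real.pi / m a)]

lemma refl_apply_of_inner {α : VR} (h : inner ℝ α α = (1 : ℝ)) (v : VR) :
    refl α v = v - (2 * inner ℝ α v) • α := by
  have hn : ‖α‖ = 1 := by
    have := real_inner_self_eq_norm_sq α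
    rw [h] at this
    nlinarith [norm_nonneg α]
  rw [refl, Submodule.reflection_orthogonal_apply, Submodule.reflection_singleton_apply, hn]
  simp [mul_smul, two_smul]

lemma entry_reflW (α : rootSystem m) (h : inner ℝ (α : VR) (α : VR) = (1 : ℝ)) (i j : Fin 4) :
    entry (reflW m α) i j = (if i = j then 1 else 0) - 2 * ((α : VR) j : ℂ) * ((α : VR) i : ℂ) := by
  rw [entry]
  change (((refl (α : VR)) (EuclideanSpace.single j (1 : ℝ)) i : ℝ) : ℂ) = _
  rw [refl_apply_of_inner h]
  simp only [PiLp.sub_apply, PiLp.smul_apply, smul_eq_mul, EuclideanSpace.inner_single_right]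
  rw [PiLp.single_apply]
  split_ifs <;> simp

/-- The coordinate `(x_j, α)` of a positive root. -/
def coord (r : PosIdx m) (j : Fin 4) : ℂ := (((posRoot m r : VR) j : ℝ) : ℂ)

lemma coord_of_blk_ne {r : PosIdx m} {j : Fin 4} (h : blk j ≠ r.1) : coord m r j = 0 := by
  rw [coord]
  change ((root m r.1 (r.2 + 1) j : ℝ) : ℂ) = 0
  rw [root_of_blk_ne m _ h, Complex.ofReal_zero]

lemma coord_sq_add_sq (r : PosIdx m) :
    coord m r (fstIdx r.1) * coord m r (fstIdx r.1)
      + coord m r (sndIdx r.1) * coord m r (sndIdx r.1)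
      = 1 := by
  have h := inner_root_self m r.1 (r.2 + 1)
  rw [inner_root] at h
  rw [coord, coord]
  exact_mod_cast h

lemma entry_posRoot (r : PosIdx m) (i j : Fin 4) :
    entry (reflW m (posRoot m r)) i j = (if i = j then 1 else 0) - 2 * coord m r j * coord m r i :=
  entry_reflW m _ (inner_root_self m _ _) i j

lemma reflW_comm {r s : PosIdx m} (h : r.1 ≠ s.1) :
    reflW m (posRoot m r) * reflW m (posRoot m s) =
      reflW m (posRoot m s) * reflW m (posRoot m r) := by
  have e1 : inner ℝ (root m r.1 (r.2 + 1)) (root m s.1 (s.2 + 1)) = (0 : ℝ) := by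
    rw [inner_root, root_of_blk_ne m (a := s.1) _ (j := fstIdx r.1) (by rwa [blk_fstIdx]),
      root_of_blk_ne m (a := s.1) _ (j := sndIdx r.1) (by rwa [blk_sndIdx])]
    simp
  have e2 : inner ℝ (root m s.1 (s.2 + 1)) (root m r.1 (r.2 + 1)) = (0 : ℝ) := by
    rw [real_inner_comm, e1]
  apply Subtype.ext
  apply LinearIsometryEquiv.ext
  intro v
  change refl (root m r.1 (r.2 + 1)) (refl (root m s.1 (s.2 + 1)) v) =
    refl (root m s.1 (s.2 + 1)) (refl (root m r.1 (r.2 + 1)) v)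
  simp only [refl_apply_of_inner (inner_root_self m _ _), inner_sub_right, inner_smul_right, e1, e2,
    mul_zero, sub_zero]
  abel

variable (κ : rootSystem m → ℂ)

/-- Stated for any family that transforms as a vector, so that it covers the coordinates and the
Dunkl operators at once. -/
lemma G_sum {F : Fin 4 → HC m κ}
    (hF : ∀ (w : W m) j, G m κ w * F j = (∑ i, entry w i j • F i) * G m κ w)
    (r : PosIdx m) (j : Fin 4) :
    G m κ (reflW m (posRoot m r)) * F j =
      (F j - (2 * coord m r j) • (coord m r (fstIdx r.1) • F (fstIdx r.1)
        + coord m r (sndIdx r.1) • F (sndIdx r.1))) * G m κ (reflW m (posRoot m r)) := by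
  rw [hF]
  congr 1
  simp only [entry_posRoot, sub_smul, Finset.sum_sub_distrib, ite_smul, one_smul, zero_smul,
    Finset.sum_ite_eq', Finset.mem_univ, if_true]
  rw [sum_eq_of_blk (a := r.1) (f := fun x => (2 * coord m r j * coord m r x) • F x)]
  · simp only [smul_add, smul_smul]
  · intro i hi
    rw [coord_of_blk_ne m hi, mul_zero, zero_smul]

lemma inC_ι_root (r : PosIdx m) :
    inC (CliffordAlgebra.ι quadForm (fun j => (((posRoot m r : VR) j : ℝ) : ℂ)))
      = coord m r (fstIdx r.1) • E m κ (fstIdx r.1)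
        + coord m r (sndIdx r.1) • E m κ (sndIdx r.1) := by
  have h : (fun j => (((posRoot m r : VR) j : ℝ) : ℂ)) = ∑ j, coord m r j • stdVec j := by
    funext k
    rw [Finset.sum_apply]
    simp [stdVec, coord, Pi.single_apply]
  rw [h, map_sum, map_sum, sum_eq_of_blk (a := r.1)]
  · simp only [map_smul, E, e]
  · intro j hj
    rw [coord_of_blk_ne m hj, zero_smul, map_zero, map_zero]

lemma sTilde_eq (r : PosIdx m) : sTilde m κ r = G m κ (reflW m (posRoot m r)) *
    (coord m r (fstIdx r.1) • E m κ (fstIdx r.1)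
      + coord m r (sndIdx r.1) • E m κ (sndIdx r.1)) := by
  rw [sTilde, pureTensor_eq, inC_ι_root]
  rfl

/-- The symmetry `O(x_j)`, as a combination of lifted reflections. -/
def Osum (j : Fin 4) : HC m κ := ∑ r, (κ (posRoot m r) * coord m r j) • sTilde m κ r

/-- The roots are unit vectors. In `∑ i, [ξ_i, x_j] e_i` each reflection `s_α` therefore comes with
`2 κ_α (x_j, α) γ(α)`, which assembles the lifted reflection `s̃_α`. -/
lemma dirac_X (j : Fin 4) :
    dirac m κ * X m κ j - X m κ j * dirac m κ = E m κ j + (2 : ℂ) • Osum m κ j := by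
  have h1 : dirac m κ * X m κ j - X m κ j * dirac m κ =
      ∑ i, (Xi m κ i * X m κ j - X m κ j * Xi m κ i) * E m κ i := by
    rw [dirac_eq, Finset.sum_mul, Finset.mul_sum, ← Finset.sum_sub_distrib]
    refine Finset.sum_congr rfl fun i _ => ?_
    rw [sub_mul, mul_assoc, mul_assoc, mul_assoc, E_X]
  simp only [h1, Xi_X, add_mul, Finset.sum_add_distrib, ite_mul, one_mul, zero_mul,
    Finset.sum_ite_eq', Finset.mem_univ, if_true]
  congr 1
  simp only [Finset.sum_mul, Osum, Finset.smul_sum]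
  rw [Finset.sum_comm]
  refine Finset.sum_congr rfl fun r _ => ?_
  rw [sum_eq_of_blk (a := r.1), sTilde_eq]
  · have hc : ∀ i, rootCoeff m κ r i j = 2 * κ (posRoot m r) * coord m r i * coord m r j := by
      intro i
      have e : (inner ℝ (posRoot m r : VR) (posRoot m r : VR) : ℝ) = 1 := inner_root_self m _ _
      rw [rootCoeff, e, Complex.ofReal_one, div_one]
      rfl
    simp only [hc, mul_add, smul_mul_assoc, mul_smul_comm]
    module
  · intro i hi
    have : rootCoeff m κ r i j = 0 := by
      have := coord_of_blk_ne m hi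
      rw [coord] at this
      rw [rootCoeff, this, mul_zero, zero_mul]
    rw [this, zero_smul, zero_mul]

end

/-! ### Lifted reflections in isotropic coordinates -/

section

variable {A : Type} [Ring A] [Algebra ℂ A]

/-- The commutation relations of a lifted reflection with isotropic coordinates. -/
structure ReflRel (zp zm dp dm cp cm s : A) (μp μm : ℂ) : Prop where
  mul_eq_one : μp * μm = 1
  s_zp : s * zp = -(μp ^ 2 • (zm * s))
  s_zm : s * zm = -(μm ^ 2 • (zp * s))
  s_dp : s * dp = -(μp ^ 2 • (dm * s))
  s_dm : s * dm = -(μm ^ 2 • (dp * s))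
  s_cp : s * cp = μp ^ 2 • (cm * s)
  s_cm : s * cm = μm ^ 2 • (cp * s)

namespace ReflRel

variable {zp zm dp dm cp cm s : A} {μp μm : ℂ}

lemma sq_mul_sq (h : ReflRel zp zm dp dm cp cm s μp μm) : μp ^ 2 * μm ^ 2 = 1 := by
  rw [← mul_pow, h.mul_eq_one, one_pow]

lemma sq_mul_sq' (h : ReflRel zp zm dp dm cp cm s μp μm) : μm ^ 2 * μp ^ 2 = 1 := by
  rw [mul_comm, h.sq_mul_sq]

lemma x_anticomm (h : ReflRel zp zm dp dm cp cm s μp μm) :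
    s * pairing zp zm cp cm = -(pairing zp zm cp cm * s) := by
  simp only [pairing, mul_add, add_mul, smul_mul_assoc, mul_smul_comm, mul_assoc,
    mul_mul_of_eq h.s_zp, mul_mul_of_eq h.s_zm, h.s_cp, h.s_cm, neg_mul, smul_smul, h.sq_mul_sq,
    h.sq_mul_sq', one_smul]
  module

lemma D_anticomm (h : ReflRel zp zm dp dm cp cm s μp μm) :
    s * pairing dp dm cp cm = -(pairing dp dm cp cm * s) := by
  simp only [pairing, mul_add, add_mul, smul_mul_assoc, mul_smul_comm, mul_assoc,
    mul_mul_of_eq h.s_dp, mul_mul_of_eq h.s_dm, h.s_cp, h.s_cm, neg_mul, smul_smul, h.sq_mul_sq,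
    h.sq_mul_sq', one_smul]
  module

lemma M_anticomm (h : ReflRel zp zm dp dm cp cm s μp μm) :
    s * momentum zp zm dp dm = -(momentum zp zm dp dm * s) := by
  simp only [momentum, mul_sub, sub_mul, smul_mul_assoc, mul_smul_comm, mul_assoc,
    mul_mul_of_eq h.s_zp, mul_mul_of_eq h.s_zm, h.s_dp, h.s_dm, neg_mul, mul_neg, neg_neg,
    smul_smul,
    smul_neg, h.sq_mul_sq, h.sq_mul_sq', one_smul]
  module

lemma W_anticomm (h : ReflRel zp zm dp dm cp cm s μp μm)
    (hc : cm * cp = (4 : ℂ) • 1 - cp * cm) :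
    s * chirality cp cm = -(chirality cp cm * s) := by
  simp only [chirality, mul_sub, sub_mul, smul_mul_assoc, mul_smul_comm, mul_assoc,
    mul_mul_of_eq h.s_cp, h.s_cm, smul_smul, h.sq_mul_sq, one_smul, mul_one, one_mul,
    mul_mul_of_eq hc]
  module

end ReflRel

/-- Relations from which `BlockRel` follows. -/
structure BlockCore (zp zm dp dm cp cm Op Om : A) : Prop where
  cp_cp : cp * cp = 0
  cm_cm : cm * cm = 0
  cm_cp : cm * cp = (4 : ℂ) • 1 - cp * cm
  cp_zp : cp * zp = zp * cp
  cp_zm : cp * zm = zm * cp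
  cm_zp : cm * zp = zp * cm
  cm_zm : cm * zm = zm * cm
  cp_dp : cp * dp = dp * cp
  cp_dm : cp * dm = dm * cp
  cm_dp : cm * dp = dp * cm
  cm_dm : cm * dm = dm * cm
  zm_zp : zm * zp = zp * zm
  dm_dp : dm * dp = dp * dm
  D_zp : pairing dp dm cp cm * zp = zp * pairing dp dm cp cm + cp + (2 : ℂ) • Op
  D_zm : pairing dp dm cp cm * zm = zm * pairing dp dm cp cm + cm + (2 : ℂ) • Om
  exists_sum : ∃ (ι : Type) (_ : Fintype ι) (s : ι → A) (k μp μm : ι → ℂ),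
    (∀ i, μp i = 0 ∧ μm i = 0 ∨ ReflRel zp zm dp dm cp cm (s i) (μp i) (μm i)) ∧
      Op = ∑ i, (k i * μp i) • s i ∧ Om = ∑ i, (k i * μm i) • s i

namespace BlockCore

variable {zp zm dp dm cp cm Op Om : A}

/-- A lifted reflection exchanges the `+` and `-` variants at the cost of a square of `μ^±`, and
`μ^+ μ^- = 1` turns the coefficient of `O^+` into that of `O^-`. Indices with vanishing coefficients
are allowed because the sum will run over all positive roots, including those of the other block. -/
lemma O_mul_eq {ι : Type} [Fintype ι] {s : ι → A} {k μp μm : ι → ℂ}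
    (hs : ∀ i, μp i = 0 ∧ μm i = 0 ∨ ReflRel zp zm dp dm cp cm (s i) (μp i) (μm i)) :
    (∑ i, (k i * μp i) • s i) * cm = cp * ∑ i, (k i * μm i) • s i ∧
    (∑ i, (k i * μm i) • s i) * cp = cm * ∑ i, (k i * μp i) • s i ∧
    (∑ i, (k i * μp i) • s i) * zm = -(zp * ∑ i, (k i * μm i) • s i) ∧
    (∑ i, (k i * μp i) • s i) * dm = -(dp * ∑ i, (k i * μm i) • s i) := by
  simp only [Finset.sum_mul, Finset.mul_sum, ← Finset.sum_neg_distrib]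
  refine ⟨Finset.sum_congr rfl fun i _ => ?_, Finset.sum_congr rfl fun i _ => ?_,
    Finset.sum_congr rfl fun i _ => ?_, Finset.sum_congr rfl fun i _ => ?_⟩
  all_goals
    rcases hs i with ⟨h1, h2⟩ | h
    · simp [h1, h2]
    · have e := h.mul_eq_one
      have e1 : k i * μp i * μm i ^ 2 = k i * μm i := by linear_combination k i * μm i * e
      have e2 : k i * μm i * μp i ^ 2 = k i * μp i := by linear_combination k i * μp i * e
      simp only [smul_mul_assoc, mul_smul_comm, h.s_cm, h.s_cp, h.s_zm, h.s_dm, smul_neg,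
        smul_smul, e1, e2]

lemma O_anticomm {ι : Type} [Fintype ι] {s : ι → A} {k μ : ι → ℂ} {y : A}
    (hs : ∀ i, μ i = 0 ∨ s i * y = -(y * s i)) :
    (∑ i, (k i * μ i) • s i) * y = -(y * ∑ i, (k i * μ i) • s i) := by
  simp only [Finset.sum_mul, Finset.mul_sum, ← Finset.sum_neg_distrib]
  refine Finset.sum_congr rfl fun i _ => ?_
  rcases hs i with h | h
  · simp [h]
  · rw [smul_mul_assoc, mul_smul_comm, h, smul_neg]

theorem blockRel (h : BlockCore zp zm dp dm cp cm Op Om) :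
    BlockRel zp zm dp dm cp cm Op Om := by
  obtain ⟨ι, _, s, k, μp, μm, hs, hp, hm⟩ := h.exists_sum
  obtain ⟨o1, o2, o3, o4⟩ := O_mul_eq (k := k) hs
  rw [← hp, ← hm] at o1 o2 o3 o4
  have anti : ∀ y, (∀ i, ReflRel zp zm dp dm cp cm (s i) (μp i) (μm i) →
      s i * y = -(y * s i)) → Op * y = -(y * Op) ∧ Om * y = -(y * Om) := fun y hy => by
    rw [hp, hm]
    exact ⟨O_anticomm fun i => (hs i).imp And.left (hy i),
      O_anticomm fun i => (hs i).imp And.right (hy i)⟩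
  have ax := anti _ fun i hi => hi.x_anticomm
  have aD := anti _ fun i hi => hi.D_anticomm
  have aM := anti _ fun i hi => hi.M_anticomm
  have aW := anti _ fun i hi => hi.W_anticomm h.cm_cp
  -- Anticommuting `[D, y]` with a Clifford vector `c'` isolates one Dunkl operator, since `{c^±, D}
  -- = 2 d^±`. This recovers `[d^±, z^∓]`.
  have dz : ∀ y c o c', pairing dp dm cp cm * y = y * pairing dp dm cp cm + c + (2 : ℂ) • o →
      c' * (pairing dp dm cp cm * y - y * pairing dp dm cp cm)
        + (pairing dp dm cp cm * y - y * pairing dp dm cp cm) * c'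
      = c' * c + c * c' + (2 : ℂ) • (c' * o + o * c') := fun y c o c' e => by
    rw [e]
    simp only [mul_add, mul_sub, add_mul, sub_mul, smul_mul_assoc, mul_smul_comm]
    module
  have dp_zm : dp * zm = zm * dp + (2 : ℂ) • 1 + (cp * Om + cm * Op) := by
    have e := dz zm cm Om cp h.D_zm
    rw [h.cm_cp, o2] at e
    simp only [pairing, mul_add, add_mul, mul_sub, sub_mul, smul_mul_assoc, mul_smul_comm,
      mul_assoc, h.cp_zm, h.cm_zm, mul_mul_of_eq h.cp_zm, mul_mul_of_eq h.cp_dp,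
      mul_mul_of_eq h.cp_dm, h.cp_cp, h.cm_cp, mul_zero, mul_one] at e
    linear_combination (norm := module) (2⁻¹ : ℂ) • e
  have dm_zp : dm * zp = zp * dm + (2 : ℂ) • 1 + (cp * Om + cm * Op) := by
    have e := dz zp cp Op cm h.D_zp
    rw [h.cm_cp, o1] at e
    simp only [pairing, mul_add, add_mul, mul_sub, sub_mul, smul_mul_assoc, mul_smul_comm,
      mul_assoc, h.cp_zp, h.cm_zp, mul_mul_of_eq h.cm_zp, mul_mul_of_eq h.cm_dp,
      mul_mul_of_eq h.cm_dm, h.cm_cm, h.cm_cp, mul_zero, mul_one] at e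
    linear_combination (norm := module) (2⁻¹ : ℂ) • e
  -- Since `[d^+, z^-] = [d^-, z^+]`, the commutator `[x, d^+]` is the negative of `[D, z^+]`.
  have x_dp : pairing zp zm cp cm * dp = dp * pairing zp zm cp cm - cp - (2 : ℂ) • Op := by
    have e := h.D_zp
    have e1 := congrArg (· * cp) dp_zm
    have e2 := congrArg (· * cp) dm_zp
    simp only [pairing, mul_add, add_mul, smul_mul_assoc, mul_smul_comm, mul_assoc, h.cp_zp,
      h.cm_zp, h.cm_dp, h.cp_dp] at e e1 e2 ⊢
    linear_combination (norm := module) (2⁻¹ : ℂ) • (e2 - e1) - e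
  have x_dm : pairing zp zm cp cm * dm = dm * pairing zp zm cp cm - cm - (2 : ℂ) • Om := by
    have e := h.D_zm
    have e1 := congrArg (· * cm) dp_zm
    have e2 := congrArg (· * cm) dm_zp
    simp only [pairing, mul_add, add_mul, smul_mul_assoc, mul_smul_comm, mul_assoc, h.cp_zm,
      h.cm_zm, h.cm_dm, h.cp_dm] at e e1 e2 ⊢
    linear_combination (norm := module) (2⁻¹ : ℂ) • (e1 - e2) - e
  exact ⟨h.cp_cp, h.cm_cm, h.cm_cp, h.cp_zp, h.cp_zm, h.cm_zp, h.cm_zm, h.cp_dp, h.cp_dm, h.cm_dp,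
    h.cm_dm, h.zm_zp, h.dm_dp, dp_zm, dm_zp, o1, o2, o3, o4, h.D_zp, h.D_zm, x_dp, x_dm, ax.1, ax.2,
    aD.1, aD.2, aW.1, aW.2, aM.1, aM.2⟩

end BlockCore

end

/-! ### Elements supported on one block -/

section

variable {m : Fin 2 → ℕ} {κ : rootSystem m → ℂ}

/-- Homogeneous elements of the subalgebra of `H_κ ⊗ C` attached to the block `a`; `true` stands for
odd. -/
inductive BlockHom (a : Fin 2) : Bool → HC m κ → Prop
  | X (j : Fin 4) (h : blk j = a) : BlockHom a false (X m κ j)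
  | Xi (j : Fin 4) (h : blk j = a) : BlockHom a false (Xi m κ j)
  | E (j : Fin 4) (h : blk j = a) : BlockHom a true (E m κ j)
  | G (r : PosIdx m) (h : r.1 = a) : BlockHom a false (G m κ (reflW m (posRoot m r)))
  | one : BlockHom a false 1
  | zero (p : Bool) : BlockHom a p 0
  | add (p : Bool) (u v : HC m κ) : BlockHom a p u → BlockHom a p v → BlockHom a p (u + v)
  | smul (p : Bool) (c : ℂ) (u : HC m κ) : BlockHom a p u → BlockHom a p (c • u)
  | mul (p q : Bool) (u v : HC m κ) : BlockHom a p u → BlockHom a q v →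
      BlockHom a (xor p q) (u * v)

lemma koszul_xor (p q r : Bool) : koszul (xor p q) r = koszul p r * koszul q r := by
  cases p <;> cases q <;> cases r <;> simp [koszul]

lemma koszul_symm (p q : Bool) : koszul p q = koszul q p := by
  cases p <;> cases q <;> rfl

lemma koszul_false (p : Bool) : koszul p false = 1 := by cases p <;> rfl

lemma koszul_false_left (p : Bool) : koszul false p = 1 := by cases p <;> rfl

lemma koszul_mul_self (p q : Bool) : koszul p q * koszul p q = 1 := by
  cases p <;> cases q <;> simp [koszul]

lemma BlockHom.koszul_of_generators {a : Fin 2} {p q : Bool} {u v : HC m κ} (hu : BlockHom a p u)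
    (hX : ∀ j, blk j = a → v * DoubleDihedral.X m κ j = DoubleDihedral.X m κ j * v)
    (hXi : ∀ j, blk j = a → v * DoubleDihedral.Xi m κ j = DoubleDihedral.Xi m κ j * v)
    (hE : ∀ j, blk j = a → v * DoubleDihedral.E m κ j
      = koszul true q • (DoubleDihedral.E m κ j * v))
    (hG : ∀ r : PosIdx m, r.1 = a → v * DoubleDihedral.G m κ (reflW m (posRoot m r))
      = DoubleDihedral.G m κ (reflW m (posRoot m r)) * v) :
    v * u = koszul p q • (u * v) := by
  induction hu with
  | X j h => rw [hX j h, koszul_false_left, one_smul]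
  | Xi j h => rw [hXi j h, koszul_false_left, one_smul]
  | E j h => exact hE j h
  | G r h => rw [hG r h, koszul_false_left, one_smul]
  | one => rw [koszul_false_left, one_smul, mul_one, one_mul]
  | zero p => rw [mul_zero, zero_mul, smul_zero]
  | add p u w _ _ h1 h2 => rw [mul_add, add_mul, h1, h2, smul_add]
  | smul p c u _ h => rw [mul_smul_comm, smul_mul_assoc, h, smul_comm]
  | mul p q' u w _ _ h1 h2 =>
    rw [← mul_assoc, h1, smul_mul_assoc, mul_assoc, h2, mul_smul_comm, smul_smul, koszul_xor,
      mul_assoc]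

lemma G_mul_of_blk_ne {F : Fin 4 → HC m κ}
    (hF : ∀ (w : W m) j, G m κ w * F j = (∑ i, entry w i j • F i) * G m κ w)
    {r : PosIdx m} {j : Fin 4} (h : blk j ≠ r.1) :
    G m κ (reflW m (posRoot m r)) * F j = F j * G m κ (reflW m (posRoot m r)) := by
  rw [G_sum m κ hF, coord_of_blk_ne m h, mul_zero, zero_smul, sub_zero]

/-- No root has nonzero coordinates in both blocks, so every coefficient `(x_i, α) (x_j, α)`
vanishes. -/
lemma Xi_X_of_blk_ne {i j : Fin 4} (h : blk i ≠ blk j) :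
    Xi m κ i * X m κ j = X m κ j * Xi m κ i := by
  have hij : i ≠ j := fun e => h (by rw [e])
  rw [← sub_eq_zero, Xi_X, if_neg hij, zero_add]
  refine Finset.sum_eq_zero fun r _ => ?_
  have : rootCoeff m κ r i j = 0 := by
    rw [rootCoeff]
    by_cases hi : blk i = r.1
    · have := coord_of_blk_ne m (r := r) (j := j) (by rw [← hi]; exact h.symm)
      rw [coord] at this
      rw [this, mul_zero]
    · have := coord_of_blk_ne m hi
      rw [coord] at this
      rw [this, mul_zero, zero_mul]
  rw [this, zero_smul]

/-- Elements of different blocks commute in the graded sense. -/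
theorem BlockHom.koszul {a b : Fin 2} (hab : a ≠ b) {p q : Bool} {u v : HC m κ}
    (hu : BlockHom a p u) (hv : BlockHom b q v) :
    v * u = DoubleDihedral.koszul p q • (u * v) := by
  have flip : ∀ {x y : HC m κ} {p q : Bool}, x * y = DoubleDihedral.koszul p q • (y * x) →
      y * x = DoubleDihedral.koszul q p • (x * y) := fun {x y p q} h => by
    rw [h, smul_smul, koszul_symm, koszul_mul_self, one_smul]
  have flip1 : ∀ {x y : HC m κ} {p : Bool}, x * y = DoubleDihedral.koszul p false • (y * x) →
      y * x = x * y := fun {x y p} h => by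
    rw [h, koszul_false, one_smul]
  have ne : ∀ {i j : Fin 4}, blk i = a → blk j = b → blk j ≠ blk i := fun hi hj h =>
    hab (by rw [← hi, ← hj, h])
  -- Induction on `u` reduces to a generator of block `a`. For each generator a second induction, on
  -- `v`, reduces to pairs of generators, with `flip` interchanging the roles.
  refine hu.koszul_of_generators (fun j hj => ?_) (fun j hj => ?_) (fun j hj => ?_)
    (fun r hr => ?_)
  · refine flip1 (hv.koszul_of_generators (fun i hi => X_X m κ _ _)
      (fun i hi => (Xi_X_of_blk_ne (ne hj hi)).symm)
      (fun i hi => ?_) fun r hr => (G_mul_of_blk_ne (G_X m κ) ?_).symm)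
    · rw [koszul_false, one_smul, E_X]
    · rw [hj, hr]; exact hab
  · refine flip1 (hv.koszul_of_generators (fun i hi => Xi_X_of_blk_ne (ne hj hi).symm)
      (fun i hi => Xi_Xi m κ _ _)
      (fun i hi => ?_) fun r hr => (G_mul_of_blk_ne (G_Xi m κ) ?_).symm)
    · rw [koszul_false, one_smul, E_Xi]
    · rw [hj, hr]; exact hab
  · refine flip (hv.koszul_of_generators (fun i hi => E_X m κ _ _) (fun i hi => E_Xi m κ _ _)
      (fun i hi => ?_) fun r hr => E_G m κ _ _)
    rw [E_anticomm m κ (fun h => ne hj hi (by rw [h]))]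
    simp [DoubleDihedral.koszul]
  · refine flip1 (hv.koszul_of_generators
      (fun i hi => G_mul_of_blk_ne (G_X m κ) ?_) (fun i hi => G_mul_of_blk_ne (G_Xi m κ) ?_)
      (fun i hi => ?_) fun s hs => ?_)
    · rw [hi, hr]; exact hab.symm
    · rw [hi, hr]; exact hab.symm
    · rw [koszul_false, one_smul, E_G]
    · rw [G_mul, G_mul, reflW_comm m (by rw [hr, hs]; exact hab)]

end

/-! ### Isotropic combinations within a block -/

lemma sgn_mul_self (δ : ℤˣ) : sgn δ * sgn δ = 1 := by
  rcases Int.units_eq_one_or δ with rfl | rfl <;> simp [sgn]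

lemma sgn_I_mul_self (δ : ℤˣ) : sgn δ * Complex.I * (sgn δ * Complex.I) = -1 := by
  linear_combination (sgn δ * sgn δ) * Complex.I_mul_I - sgn_mul_self δ

lemma sgn_neg (δ : ℤˣ) : sgn (-δ) = -sgn δ := by simp [sgn]

lemma sgn_one : sgn 1 = 1 := by simp [sgn]

/-- The combination `f_{2a-1} ± i f_{2a}` of the entries of a family. -/
def iso {A : Type} [Ring A] [Algebra ℂ A] (f : Fin 4 → A) (a : Fin 2) (δ : ℤˣ) : A :=
  f (fstIdx a) + (sgn δ * Complex.I) • f (sndIdx a)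

/-- The part `f_{2a-1} g_{2a-1} + f_{2a} g_{2a}` of a scalar product. -/
def blockDot {A : Type} [Ring A] (f g : Fin 4 → A) (a : Fin 2) : A :=
  f (fstIdx a) * g (fstIdx a) + f (sndIdx a) * g (sndIdx a)

lemma pairing_iso {A : Type} [Ring A] [Algebra ℂ A] (f g : Fin 4 → A) (a : Fin 2) (δ : ℤˣ) :
    pairing (iso f a δ) (iso f a (-δ)) (iso g a δ) (iso g a (-δ)) = blockDot f g a := by
  have h := sgn_mul_self δ
  simp only [pairing, iso, blockDot, sgn_neg, mul_add, add_mul, smul_mul_assoc, mul_smul_comm]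
  match_scalars
  · ring
  · ring
  · ring
  · linear_combination (-sgn δ * sgn δ) * Complex.I_mul_I + h

lemma sum_eq_blockDot {A : Type} [Ring A] (f g : Fin 4 → A) {a b : Fin 2} (h : a ≠ b) :
    ∑ j, f j * g j = blockDot f g a + blockDot f g b := by
  fin_cases a <;> fin_cases b <;>
    first
    | exact absurd rfl h
    | (rw [Fin.sum_univ_four]; simp [blockDot, fstIdx, sndIdx]; abel)

section

variable (m : Fin 2 → ℕ) (κ : rootSystem m → ℂ)

/-- The chirality `-i e_{2a-1} e_{2a}` of a block. -/
def Wb (a : Fin 2) : HC m κ := -(Complex.I • (E m κ (fstIdx a) * E m κ (sndIdx a)))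

/-- The vector variable of a block. -/
abbrev xb (a : Fin 2) : HC m κ := blockDot (X m κ) (E m κ) a

/-- The Dirac operator of a block. -/
abbrev Db (a : Fin 2) : HC m κ := blockDot (Xi m κ) (E m κ) a

lemma E_snd_fst (a : Fin 2) : E m κ (sndIdx a) * E m κ (fstIdx a) =
    -(E m κ (fstIdx a) * E m κ (sndIdx a)) := E_anticomm m κ (fstIdx_ne_sndIdx a).symm

lemma iso_E_mul_self (a : Fin 2) (δ : ℤˣ) : iso (E m κ) a δ * iso (E m κ) a δ = 0 := by
  have h := sgn_mul_self δ
  simp only [iso, mul_add, add_mul, smul_mul_assoc, mul_smul_comm, E_sq, E_snd_fst]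
  match_scalars
  · linear_combination (sgn δ * sgn δ) * Complex.I_mul_I - h
  · ring

lemma iso_E_mul_neg (a : Fin 2) (δ : ℤˣ) :
    iso (E m κ) a δ * iso (E m κ) a (-δ) = (2 : ℂ) • (1 + sgn δ • Wb m κ a) := by
  have h := sgn_mul_self δ
  simp only [iso, mul_add, add_mul, smul_mul_assoc, mul_smul_comm, E_sq, E_snd_fst, sgn_neg, Wb]
  match_scalars
  · linear_combination (-sgn δ * sgn δ) * Complex.I_mul_I + h
  · ring

lemma chirality_iso (a : Fin 2) (δ : ℤˣ) :
    chirality (iso (E m κ) a δ) (iso (E m κ) a (-δ)) = sgn δ • Wb m κ a := by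
  rw [chirality, iso_E_mul_neg]; module

lemma G_mul_iso {F : Fin 4 → HC m κ}
    (hF : ∀ (w : W m) j, G m κ w * F j = (∑ i, entry w i j • F i) * G m κ w)
    (r : PosIdx m) (δ : ℤˣ) :
    G m κ (reflW m (posRoot m r)) * iso F r.1 δ =
      -((iso (coord m r) r.1 δ) ^ 2 • (iso F r.1 (-δ) * G m κ (reflW m (posRoot m r)))) := by
  have hJ := sgn_I_mul_self δ
  have hc := coord_sq_add_sq m r
  simp only [iso, mul_add, add_mul, mul_smul_comm, G_sum m κ hF, sub_mul, smul_mul_assoc, sgn_neg,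
    smul_eq_mul]
  generalize sgn δ = σ at *
  match_scalars
  · linear_combination coord m r (sndIdx r.1) ^ 2 * hJ - hc
  · linear_combination (-2 * coord m r (fstIdx r.1) * coord m r (sndIdx r.1)
      - σ * Complex.I * coord m r (sndIdx r.1) ^ 2) * hJ - σ * Complex.I * hc

lemma iso_coord_mul (r : PosIdx m) (δ : ℤˣ) :
    iso (coord m r) r.1 δ * iso (coord m r) r.1 (-δ) = 1 := by
  have hJ := sgn_I_mul_self δ
  have hc := coord_sq_add_sq m r
  simp only [iso, sgn_neg, smul_eq_mul]
  linear_combination hc - coord m r (sndIdx r.1) ^ 2 * hJ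

lemma iso_coord_of_ne {r : PosIdx m} {a : Fin 2} (h : r.1 ≠ a) (δ : ℤˣ) :
    iso (coord m r) a δ = 0 := by
  rw [iso, coord_of_blk_ne m (by rw [blk_fstIdx]; exact h.symm),
    coord_of_blk_ne m (by rw [blk_sndIdx]; exact h.symm), smul_zero, add_zero]

lemma root_mul_iso_E (r : PosIdx m) (δ : ℤˣ) :
    (coord m r (fstIdx r.1) • E m κ (fstIdx r.1) + coord m r (sndIdx r.1) • E m κ (sndIdx r.1))
      * iso (E m κ) r.1 δ =
    (iso (coord m r) r.1 δ) ^ 2 • (iso (E m κ) r.1 (-δ) *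
      (coord m r (fstIdx r.1) • E m κ (fstIdx r.1)
        + coord m r (sndIdx r.1) • E m κ (sndIdx r.1))) := by
  have hJ := sgn_I_mul_self δ
  have hc := iso_coord_mul m r δ
  simp only [iso, mul_add, add_mul, smul_mul_assoc, mul_smul_comm, E_sq, E_snd_fst, sgn_neg,
    smul_eq_mul] at hc ⊢
  generalize sgn δ = σ at *
  match_scalars
  · linear_combination (-(coord m r (fstIdx r.1) + σ * Complex.I * coord m r (sndIdx r.1))) * hc
  · linear_combination (-(σ * Complex.I) * (coord m r (fstIdx r.1)
        + σ * Complex.I * coord m r (sndIdx r.1))) * hc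
      + (-coord m r (sndIdx r.1) - (coord m r (fstIdx r.1)
        + σ * Complex.I * coord m r (sndIdx r.1)) ^ 2 * coord m r (sndIdx r.1)) * hJ

lemma iso_mul_iso {f g : Fin 4 → HC m κ} (h : ∀ i j, f i * g j = g j * f i) (a : Fin 2)
    (δ ε : ℤˣ) : iso f a δ * iso g a ε = iso g a ε * iso f a δ := by
  simp only [iso, mul_add, add_mul, smul_mul_assoc, mul_smul_comm, h]
  module

/-- With `μ^± = α_1 ± δ i α_2`, the reflection sends `z^±` to `-(μ^±)² z^∓`. On Clifford generators,
conjugation by `γ(α)` is minus the reflection, hence the opposite sign for `c^±`. -/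
lemma reflRel (r : PosIdx m) (δ : ℤˣ) :
    ReflRel (iso (X m κ) r.1 δ) (iso (X m κ) r.1 (-δ)) (iso (Xi m κ) r.1 δ) (iso (Xi m κ) r.1 (-δ))
      (iso (E m κ) r.1 δ) (iso (E m κ) r.1 (-δ)) (sTilde m κ r)
      (iso (coord m r) r.1 δ) (iso (coord m r) r.1 (-δ)) := by
  have hF : ∀ {F : Fin 4 → HC m κ}
      (_ : ∀ (w : W m) j, G m κ w * F j = (∑ i, entry w i j • F i) * G m κ w)
      (_ : ∀ i j, E m κ i * F j = F j * E m κ i) (ε : ℤˣ),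
      sTilde m κ r * iso F r.1 ε
        = -((iso (coord m r) r.1 ε) ^ 2 • (iso F r.1 (-ε) * sTilde m κ r)) := by
    intro F h1 h2 ε
    have e : ∀ i, E m κ i * iso F r.1 ε = iso F r.1 ε * E m κ i := fun i => by
      simp only [iso, mul_add, add_mul, smul_mul_assoc, mul_smul_comm, h2]
    rw [sTilde_eq, mul_assoc, add_mul, smul_mul_assoc, smul_mul_assoc, e, e, ← mul_smul_comm,
      ← mul_smul_comm, ← mul_add, ← mul_assoc, G_mul_iso m κ h1, neg_mul, smul_mul_assoc, mul_assoc]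
  have hE : ∀ ε : ℤˣ, sTilde m κ r * iso (E m κ) r.1 ε
        = (iso (coord m r) r.1 ε) ^ 2 • (iso (E m κ) r.1 (-ε) * sTilde m κ r) := fun ε => by
    have e : iso (E m κ) r.1 (-ε) * G m κ (reflW m (posRoot m r))
        = G m κ (reflW m (posRoot m r)) * iso (E m κ) r.1 (-ε) := by
      simp only [iso, mul_add, add_mul, smul_mul_assoc, mul_smul_comm, E_G]
    rw [sTilde_eq, mul_assoc, root_mul_iso_E, mul_smul_comm, ← mul_assoc, ← e, mul_assoc]
  refine ⟨iso_coord_mul m r δ, hF (G_X m κ) (E_X m κ) δ, ?_, hF (G_Xi m κ) (E_Xi m κ) δ, ?_,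
    hE δ, ?_⟩
  · simpa only [neg_neg] using hF (G_X m κ) (E_X m κ) (-δ)
  · simpa only [neg_neg] using hF (G_Xi m κ) (E_Xi m κ) (-δ)
  · simpa only [neg_neg] using hE (-δ)

/-! ### The Clifford elements of exterior products -/

lemma ι_mul_ι_add (v w : V) :
    CliffordAlgebra.ι quadForm v * CliffordAlgebra.ι quadForm w
      + CliffordAlgebra.ι quadForm w * CliffordAlgebra.ι quadForm v
      = algebraMap ℂ Cl (2 * ∑ j, v j * w j) := by
  rw [CliffordAlgebra.ι_mul_ι_add_swap]
  congr 1
  simp only [QuadraticMap.polar, quadForm, QuadraticMap.weightedSumSquares_apply,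
    Fin.sum_univ_four, Pi.add_apply, smul_eq_mul]
  ring

lemma ι_anticomm {v w : V} (h : ∑ j, v j * w j = 0) :
    CliffordAlgebra.ι quadForm v * CliffordAlgebra.ι quadForm w
      = -(CliffordAlgebra.ι quadForm w * CliffordAlgebra.ι quadForm v) := by
  rw [eq_neg_iff_add_eq_zero, ι_mul_ι_add, h, mul_zero, map_zero]

/-- `γ` is multiplicative on exterior products of orthogonal vectors. -/
lemma gam_ofFn_prod {n : ℕ} {v : Fin n → V} (h : ∀ i j, i < j → ∑ k, v i k * v j k = 0) :
    gam (List.ofFn fun i => ExteriorAlgebra.ι ℂ (v i)).prod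
      = (List.ofFn fun i => CliffordAlgebra.ι quadForm (v i)).prod := by
  rw [← ExteriorAlgebra.ιMulti_apply, gam, ExteriorAlgebra.liftAlternating_apply_ιMulti]
  refine antisym_of_anticomm fun i j hij => ι_anticomm ?_
  rcases lt_or_gt_of_ne hij with hlt | hlt
  · exact h i j hlt
  · rw [← h j i hlt]
    exact Finset.sum_congr rfl fun k _ => mul_comm _ _

/-- The vector `x_{2a-1} ± i x_{2a}`. -/
def zVec (a : Fin 2) (δ : ℤˣ) : V :=
  stdVec (fstIdx a) + (sgn δ * Complex.I) • stdVec (sndIdx a)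

lemma z_eq_ι (a : Fin 2) (δ : ℤˣ) : z a δ = ExteriorAlgebra.ι ℂ (zVec a δ) := rfl

lemma inC_ι_zVec (a : Fin 2) (δ : ℤˣ) :
    inC (CliffordAlgebra.ι quadForm (zVec a δ)) = iso (E m κ) a δ := by
  simp only [zVec, map_add, map_smul]; rfl

lemma inC_ι_stdVec (j : Fin 4) : inC (CliffordAlgebra.ι quadForm (stdVec j)) = E m κ j := rfl

/-- `z_a^+` and `z_a^-` are not orthogonal, so `γ` is not multiplicative on them; the wedge is first
rewritten in the orthogonal vectors `x_{2a-1}`, `x_{2a}`. -/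
lemma z_mul_z_neg (a : Fin 2) : z a 1 * z a (-1) = (-2 * Complex.I) •
    (ExteriorAlgebra.ι ℂ (stdVec (fstIdx a)) * ExteriorAlgebra.ι ℂ (stdVec (sndIdx a))) := by
  have h : ExteriorAlgebra.ι ℂ (stdVec (sndIdx a)) * ExteriorAlgebra.ι ℂ (stdVec (fstIdx a))
      = -(ExteriorAlgebra.ι ℂ (stdVec (fstIdx a)) * ExteriorAlgebra.ι ℂ (stdVec (sndIdx a))) :=
    eq_neg_of_add_eq_zero_left (ExteriorAlgebra.ι_add_mul_swap _ _)
  simp only [z_eq_ι, zVec, map_add, map_smul, mul_add, add_mul, smul_mul_assoc, mul_smul_comm,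
    ExteriorAlgebra.ι_sq_zero, h, sgn_neg, sgn_one]
  module

lemma inC_gam_z (a : Fin 2) (δ : ℤˣ) : inC (gam (z a δ)) = iso (E m κ) a δ := by
  have h := gam_ofFn_prod (v := ![zVec a δ])
    (fun i j hij => by fin_cases i; fin_cases j; simp at hij)
  simp only [List.ofFn_succ, List.ofFn_zero, List.prod_cons, List.prod_nil, mul_one,
    Matrix.cons_val_zero] at h
  rw [z_eq_ι, h, inC_ι_zVec]

lemma inC_gam_z_z_neg (a : Fin 2) : inC (gam (z a 1 * z a (-1))) = (2 : ℂ) • Wb m κ a := by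
  have h := gam_ofFn_prod (v := ![stdVec (fstIdx a), stdVec (sndIdx a)])
    (by fin_cases a <;> simp [Fin.forall_fin_succ, Fin.sum_univ_four, stdVec, fstIdx, sndIdx])
  simp [List.ofFn_succ] at h
  rw [z_mul_z_neg, map_smul, h, map_smul, map_mul, inC_ι_stdVec, inC_ι_stdVec, Wb]
  module

lemma inC_gam_z_z {a b : Fin 2} (hab : a ≠ b) (δ ε : ℤˣ) :
    inC (gam (z a δ * z b ε)) = iso (E m κ) a δ * iso (E m κ) b ε := by
  have h := gam_ofFn_prod (v := ![zVec a δ, zVec b ε])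
    (by
      fin_cases a <;> fin_cases b <;>
      simp [Fin.forall_fin_succ, Fin.sum_univ_four, zVec, stdVec, fstIdx, sndIdx] at hab ⊢)
  simp [List.ofFn_succ] at h
  rw [z_eq_ι, z_eq_ι, h, map_mul, inC_ι_zVec, inC_ι_zVec]

lemma inC_gam_z_z_z {a b : Fin 2} (hab : a ≠ b) (ε : ℤˣ) :
    inC (gam (z b ε * z a 1 * z a (-1))) = (2 : ℂ) • (iso (E m κ) b ε * Wb m κ a) := by
  have h := gam_ofFn_prod (v := ![zVec b ε, stdVec (fstIdx a), stdVec (sndIdx a)])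
    (by
      fin_cases a <;> fin_cases b <;>
      simp [Fin.forall_fin_succ, Fin.sum_univ_four, zVec, stdVec, fstIdx, sndIdx] at hab ⊢)
  simp [List.ofFn_succ] at h
  rw [mul_assoc, z_mul_z_neg, mul_smul_comm, map_smul, z_eq_ι, h, map_smul, map_mul, map_mul,
    inC_ι_stdVec, inC_ι_stdVec, inC_ι_zVec, Wb]
  simp only [mul_neg, mul_smul_comm]
  module

lemma inC_gam_volume : inC (gam (ExteriorAlgebra.ιMulti ℂ 4 stdVec)) = -(Wb m κ 0 * Wb m κ 1) := by
  have h := gam_ofFn_prod (v := stdVec)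
    (by simp [Fin.forall_fin_succ, Fin.sum_univ_four, stdVec])
  rw [ExteriorAlgebra.ιMulti_apply, h]
  simp only [List.ofFn_succ, List.ofFn_zero, List.prod_cons, List.prod_nil, mul_one, map_mul,
    inC_ι_stdVec, Wb, neg_mul_neg, smul_mul_assoc, mul_smul_comm, smul_smul, Complex.I_mul_I,
    neg_smul, one_smul, neg_neg, mul_assoc]
  rfl

end

/-! ### The two blocks -/

section

variable {m : Fin 2 → ℕ} {κ : rootSystem m → ℂ}

namespace BlockHom

lemma neg {a : Fin 2} {p : Bool} {u : HC m κ} (h : BlockHom a p u) : BlockHom a p (-u) := by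
  rw [← neg_one_smul ℂ]
  exact .smul _ _ _ h

lemma sub {a : Fin 2} {p : Bool} {u v : HC m κ} (hu : BlockHom a p u) (hv : BlockHom a p v) :
    BlockHom a p (u - v) := by
  rw [sub_eq_add_neg]
  exact .add _ _ _ hu hv.neg

lemma sum {ι : Type} {a : Fin 2} {p : Bool} {f : ι → HC m κ} (s : Finset ι)
    (h : ∀ i ∈ s, BlockHom a p (f i)) : BlockHom a p (∑ i ∈ s, f i) :=
  Finset.sum_induction _ _ (fun _ _ => .add _ _ _) (.zero _) h

lemma even_mul {a : Fin 2} {p : Bool} {u v : HC m κ} (hu : BlockHom a false u)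
    (hv : BlockHom a p v) : BlockHom a p (u * v) := by
  simpa using BlockHom.mul false p _ _ hu hv

lemma mul_even {a : Fin 2} {p : Bool} {u v : HC m κ} (hu : BlockHom a p u)
    (hv : BlockHom a false v) : BlockHom a p (u * v) := by
  simpa using BlockHom.mul p false _ _ hu hv

lemma odd_mul_odd {a : Fin 2} {u v : HC m κ} (hu : BlockHom a true u)
    (hv : BlockHom a true v) : BlockHom a false (u * v) :=
  BlockHom.mul true true _ _ hu hv

lemma iso {f : Fin 4 → HC m κ} {p : Bool} (a : Fin 2) (h : ∀ j, blk j = a → BlockHom a p (f j))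
    (δ : ℤˣ) : BlockHom a p (iso f a δ) :=
  .add _ _ _ (h _ (blk_fstIdx a)) (.smul _ _ _ (h _ (blk_sndIdx a)))

lemma iso_X (a : Fin 2) (δ : ℤˣ) :
    BlockHom a false (DoubleDihedral.iso (DoubleDihedral.X m κ) a δ) :=
  iso a .X δ

lemma iso_Xi (a : Fin 2) (δ : ℤˣ) :
    BlockHom a false (DoubleDihedral.iso (DoubleDihedral.Xi m κ) a δ) :=
  iso a .Xi δ

lemma iso_E (a : Fin 2) (δ : ℤˣ) :
    BlockHom a true (DoubleDihedral.iso (DoubleDihedral.E m κ) a δ) :=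
  iso a .E δ

lemma xb (a : Fin 2) : BlockHom a true (xb m κ a) :=
  .add _ _ _ (even_mul (.X _ (blk_fstIdx a)) (.E _ (blk_fstIdx a)))
    (even_mul (.X _ (blk_sndIdx a)) (.E _ (blk_sndIdx a)))

lemma Db (a : Fin 2) : BlockHom a true (Db m κ a) :=
  .add _ _ _ (even_mul (.Xi _ (blk_fstIdx a)) (.E _ (blk_fstIdx a)))
    (even_mul (.Xi _ (blk_sndIdx a)) (.E _ (blk_sndIdx a)))

lemma Wb (a : Fin 2) : BlockHom a false (Wb m κ a) :=
  neg (.smul _ _ _ (odd_mul_odd (.E _ (blk_fstIdx a)) (.E _ (blk_sndIdx a))))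

lemma scasimir {a : Fin 2} {x D : HC m κ} (hx : BlockHom a true x) (hD : BlockHom a true D) :
    BlockHom a false (scasimir x D) :=
  .smul _ _ _ (((odd_mul_odd hD hx).sub (odd_mul_odd hx hD)).sub .one)

lemma commute {a b : Fin 2} (hab : a ≠ b) {p : Bool} {u v : HC m κ} (hu : BlockHom a p u)
    (hv : BlockHom b false v) : v * u = u * v := by
  rw [hu.koszul hab hv, koszul_false, one_smul]

lemma anticommute {a b : Fin 2} (hab : a ≠ b) {u v : HC m κ} (hu : BlockHom a true u)
    (hv : BlockHom b true v) : v * u = -(u * v) := by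
  rw [hu.koszul hab hv]
  exact neg_one_smul ℂ _

end BlockHom

variable (m κ)

/-! ### The symmetries `O` in terms of block elements -/

lemma exists_ne (a : Fin 2) : ∃ b, a ≠ b := ⟨1 - a, by fin_cases a <;> decide⟩

lemma vecVar_eq_add {a b : Fin 2} (hab : a ≠ b) : vecVar m κ = xb m κ a + xb m κ b := by
  rw [vecVar_eq, sum_eq_blockDot _ _ hab]

lemma dirac_eq_add {a b : Fin 2} (hab : a ≠ b) : dirac m κ = Db m κ a + Db m κ b := by
  rw [dirac_eq, sum_eq_blockDot _ _ hab]

lemma parity_iso_E (a : Fin 2) (δ : ℤˣ) :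
    parity m κ (iso (E m κ) a δ) = -iso (E m κ) a δ := by
  simp only [iso, map_add, map_smul, parity_E]
  module

lemma parity_Wb (a : Fin 2) : parity m κ (Wb m κ a) = Wb m κ a := by
  simp only [Wb, map_neg, map_smul, map_mul, parity_E, neg_mul_neg]

lemma vecVar_E (j : Fin 4) :
    vecVar m κ * E m κ j + E m κ j * vecVar m κ = (2 : ℂ) • X m κ j := by
  have : vecVar m κ * E m κ j + E m κ j * vecVar m κ =
      ∑ i, X m κ i * (E m κ i * E m κ j + E m κ j * E m κ i) := by
    rw [vecVar_eq, Finset.sum_mul, Finset.mul_sum, ← Finset.sum_add_distrib]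
    refine Finset.sum_congr rfl fun i _ => ?_
    rw [mul_add, mul_assoc, ← mul_assoc (E m κ j), E_X, mul_assoc]
  simp [this, E_E_add]

lemma vecVar_iso_E (a : Fin 2) (δ : ℤˣ) :
    vecVar m κ * iso (E m κ) a δ = (2 : ℂ) • iso (X m κ) a δ - iso (E m κ) a δ * vecVar m κ := by
  rw [eq_sub_iff_add_eq]
  simp only [iso, smul_add, smul_comm (2 : ℂ), ← vecVar_E, mul_add, add_mul, smul_mul_assoc,
    mul_smul_comm]
  module

lemma dirac_E (j : Fin 4) :
    dirac m κ * E m κ j + E m κ j * dirac m κ = (2 : ℂ) • Xi m κ j := by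
  have : dirac m κ * E m κ j + E m κ j * dirac m κ =
      ∑ i, Xi m κ i * (E m κ i * E m κ j + E m κ j * E m κ i) := by
    rw [dirac_eq, Finset.sum_mul, Finset.mul_sum, ← Finset.sum_add_distrib]
    refine Finset.sum_congr rfl fun i _ => ?_
    rw [mul_add, mul_assoc, ← mul_assoc (E m κ j), E_Xi, mul_assoc]
  simp [this, E_E_add]

lemma dirac_iso_E (a : Fin 2) (δ : ℤˣ) :
    dirac m κ * iso (E m κ) a δ = (2 : ℂ) • iso (Xi m κ) a δ - iso (E m κ) a δ * dirac m κ := by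
  rw [eq_sub_iff_add_eq]
  simp only [iso, smul_add, smul_comm (2 : ℂ), ← dirac_E, mul_add, add_mul, smul_mul_assoc,
    mul_smul_comm]
  module

lemma dirac_iso_X (a : Fin 2) (δ : ℤˣ) :
    dirac m κ * iso (X m κ) a δ =
      iso (X m κ) a δ * dirac m κ + iso (E m κ) a δ + (2 : ℂ) • iso (Osum m κ) a δ := by
  have h := fun j => sub_eq_iff_eq_add'.1 (dirac_X m κ j)
  simp only [iso, mul_add, add_mul, smul_mul_assoc, mul_smul_comm, h]
  module

/-- Anticommuting `e^δ` with the vector variable gives `2 z^δ`; the commutator of the Dirac operator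
with this is `2 e^δ` plus four times the sum of lifted reflections. The projection cancels `e^δ`. -/
lemma O1_eq (a : Fin 2) (δ : ℤˣ) : O1 m κ a δ = iso (Osum m κ) a δ := by
  rw [O1, O_of_odd (inC_gam_z m κ a δ) (parity_iso_E m κ a δ), vecVar_iso_E, sub_add_cancel,
    mul_smul_comm, smul_mul_assoc, dirac_iso_X]
  module

lemma O1_eq_sum (a : Fin 2) (δ : ℤˣ) :
    O1 m κ a δ = ∑ r, (κ (posRoot m r) * iso (coord m r) a δ) • sTilde m κ r := by
  rw [O1_eq, iso, Osum, Osum, Finset.smul_sum, ← Finset.sum_add_distrib]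
  refine Finset.sum_congr rfl fun r _ => ?_
  rw [iso, smul_eq_mul]
  module

lemma blockHom_O1 (a : Fin 2) (δ : ℤˣ) : BlockHom a true (O1 m κ a δ) := by
  rw [O1_eq_sum]
  refine BlockHom.sum _ fun r _ => ?_
  by_cases h : r.1 = a
  · subst h
    rw [sTilde_eq]
    exact .smul _ _ _ (.even_mul (.G r rfl)
      (.add _ _ _ (.smul _ _ _ (.E _ (blk_fstIdx _))) (.smul _ _ _ (.E _ (blk_sndIdx _)))))
  · rw [iso_coord_of_ne m h, mul_zero, zero_smul]
    exact .zero _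

lemma Db_iso_X (a : Fin 2) (δ : ℤˣ) :
    Db m κ a * iso (X m κ) a δ =
      iso (X m κ) a δ * Db m κ a + iso (E m κ) a δ + (2 : ℂ) • O1 m κ a δ := by
  obtain ⟨b, hab⟩ := exists_ne a
  have h := dirac_iso_X m κ a δ
  have h' := (BlockHom.Db (m := m) (κ := κ) b).commute hab.symm (BlockHom.iso_X a δ)
  rw [dirac_eq_add m κ hab, mul_add, add_mul, h', ← O1_eq] at h
  linear_combination (norm := module) h

theorem blockRel (a : Fin 2) (δ : ℤˣ) :
    BlockRel (iso (X m κ) a δ) (iso (X m κ) a (-δ)) (iso (Xi m κ) a δ) (iso (Xi m κ) a (-δ))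
      (iso (E m κ) a δ) (iso (E m κ) a (-δ)) (O1 m κ a δ) (O1 m κ a (-δ)) := by
  apply BlockCore.blockRel
  have hc := iso_E_mul_neg m κ a (-δ)
  rw [neg_neg] at hc
  refine ⟨iso_E_mul_self m κ a δ, iso_E_mul_self m κ a (-δ), ?_,
    iso_mul_iso m κ (E_X m κ) a _ _, iso_mul_iso m κ (E_X m κ) a _ _,
    iso_mul_iso m κ (E_X m κ) a _ _, iso_mul_iso m κ (E_X m κ) a _ _,
    iso_mul_iso m κ (E_Xi m κ) a _ _, iso_mul_iso m κ (E_Xi m κ) a _ _,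
    iso_mul_iso m κ (E_Xi m κ) a _ _, iso_mul_iso m κ (E_Xi m κ) a _ _,
    iso_mul_iso m κ (X_X m κ) a _ _, iso_mul_iso m κ (Xi_Xi m κ) a _ _, ?_, ?_,
    ⟨PosIdx m, inferInstance, sTilde m κ, fun r => κ (posRoot m r),
      fun r => iso (coord m r) a δ, fun r => iso (coord m r) a (-δ), fun r => ?_,
      O1_eq_sum m κ a δ, O1_eq_sum m κ a (-δ)⟩⟩
  · rw [hc, iso_E_mul_neg, sgn_neg]
    module
  · rw [pairing_iso, Db_iso_X]
  · rw [pairing_iso, Db_iso_X]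
  · by_cases h : r.1 = a
    · subst h
      exact Or.inr (reflRel m κ r δ)
    · exact Or.inl ⟨iso_coord_of_ne m h δ, iso_coord_of_ne m h (-δ)⟩

/-- The Scasimir element of a block. -/
def Sb (a : Fin 2) : HC m κ := scasimir (xb m κ a) (Db m κ a)

lemma BlockHom.Sb (a : Fin 2) : BlockHom a false (Sb m κ a) :=
  .scasimir (.xb a) (.Db a)

lemma xb_Wb (a : Fin 2) : xb m κ a * Wb m κ a = -(Wb m κ a * xb m κ a) := by
  have h := (blockRel m κ a 1).x_W
  rwa [pairing_iso, chirality_iso, sgn_one, one_smul] at h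

lemma Db_Wb (a : Fin 2) : Db m κ a * Wb m κ a = -(Wb m κ a * Db m κ a) := by
  have h := (blockRel m κ a 1).D_W
  rwa [pairing_iso, chirality_iso, sgn_one, one_smul] at h

lemma Sb_Wb (a : Fin 2) : Sb m κ a * Wb m κ a = Wb m κ a * Sb m κ a := by
  have h := (blockRel m κ a 1).S_W
  rwa [pairing_iso, pairing_iso, chirality_iso, sgn_one, one_smul] at h

lemma vecVar_Wb (a : Fin 2) :
    vecVar m κ * Wb m κ a = Wb m κ a * vecVar m κ + (2 : ℂ) • (xb m κ a * Wb m κ a) := by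
  obtain ⟨b, hab⟩ := exists_ne a
  rw [vecVar_eq_add m κ hab, add_mul, mul_add, xb_Wb,
    (BlockHom.xb b).commute hab.symm (BlockHom.Wb a)]
  module

lemma dirac_Wb (a : Fin 2) :
    dirac m κ * Wb m κ a = Wb m κ a * dirac m κ + (2 : ℂ) • (Db m κ a * Wb m κ a) := by
  obtain ⟨b, hab⟩ := exists_ne a
  rw [dirac_eq_add m κ hab, add_mul, mul_add, Db_Wb,
    (BlockHom.Db b).commute hab.symm (BlockHom.Wb a)]
  module

lemma dirac_xb (a : Fin 2) : dirac m κ * xb m κ a + xb m κ a * dirac m κ =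
    Db m κ a * xb m κ a + xb m κ a * Db m κ a := by
  obtain ⟨b, hab⟩ := exists_ne a
  rw [dirac_eq_add m κ hab, add_mul, mul_add, (BlockHom.xb a).anticommute hab (BlockHom.Db b)]
  abel

lemma Db_xb_sub (a : Fin 2) :
    Db m κ a * xb m κ a = xb m κ a * Db m κ a + (2 : ℂ) • Sb m κ a + 1 := by
  rw [Sb, scasimir]; module

/-- The commutator of the vector variable with `w_a` is `2 x_a w_a`, so the other block disappears
at once, and the remaining anticommutator with the Dirac operator is `2 S_a w_a + w_a`. The
projection cancels the summand `w_a`. -/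
lemma Hop_eq (a : Fin 2) : Hop m κ a = Wb m κ a * Sb m κ a := by
  have hp : parity m κ ((2 : ℂ) • Wb m κ a) = (2 : ℂ) • Wb m κ a := by
    rw [map_smul, parity_Wb]
  rw [Hop, O_of_even (inC_gam_z_z_neg m κ a) hp, mul_smul_comm, smul_mul_assoc, vecVar_Wb]
  have e : dirac m κ * (xb m κ a * Wb m κ a) + xb m κ a * Wb m κ a * dirac m κ =
      (2 : ℂ) • (Sb m κ a * Wb m κ a) + Wb m κ a := by
    have h1 : xb m κ a * Wb m κ a * dirac m κ = xb m κ a * dirac m κ * Wb m κ a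
        - (2 : ℂ) • (xb m κ a * Db m κ a * Wb m κ a) := by
      rw [mul_assoc, mul_assoc, mul_assoc, dirac_Wb, mul_add, mul_smul_comm]
      abel
    rw [h1, ← mul_assoc, add_sub, ← add_mul, dirac_xb, Db_xb_sub]
    simp only [add_mul, smul_mul_assoc, one_mul]
    module
  simp only [← smul_sub, mul_smul_comm, smul_mul_assoc, add_sub_cancel_left, ← smul_add, e]
  rw [← Sb_Wb]
  module

lemma Zop_eq {a b : Fin 2} (hab : a ≠ b) : Zop m κ =
    -((Sb m κ a + Sb m κ b + (2⁻¹ : ℂ) • 1 + Db m κ a * xb m κ b - xb m κ a * Db m κ b)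
      * (Wb m κ a * Wb m κ b)) := by
  have hW : -(Wb m κ 0 * Wb m κ 1) = -(Wb m κ a * Wb m κ b) := by
    fin_cases a <;> fin_cases b <;> first | exact absurd rfl hab | rfl | skip
    exact congrArg _ ((BlockHom.Wb 1).commute (by decide) (BlockHom.Wb 0))
  have hγ := (inC_gam_volume m κ).trans hW
  have hp : parity m κ (-(Wb m κ a * Wb m κ b)) = -(Wb m κ a * Wb m κ b) := by
    rw [map_neg, map_mul, parity_Wb, parity_Wb]
  -- The pseudoscalar anticommutes with the full vector variable and the full Dirac operator, so the
  -- projection depends only on the commutator of these two.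
  have hx : vecVar m κ * (Wb m κ a * Wb m κ b) = -(Wb m κ a * Wb m κ b * vecVar m κ) := by
    rw [vecVar_eq_add m κ hab]
    have e1 := ((BlockHom.xb (m := m) (κ := κ) b).commute hab.symm (BlockHom.Wb a)).symm
    have e2 := ((BlockHom.xb (m := m) (κ := κ) a).commute hab (BlockHom.Wb b)).symm
    simp only [add_mul, mul_add, mul_assoc, mul_mul_of_eq (xb_Wb m κ a), xb_Wb,
      mul_mul_of_eq e1, e2, neg_mul, mul_neg]
    abel
  have hD : dirac m κ * (Wb m κ a * Wb m κ b) = -(Wb m κ a * Wb m κ b * dirac m κ) := by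
    rw [dirac_eq_add m κ hab]
    have e1 := ((BlockHom.Db (m := m) (κ := κ) b).commute hab.symm (BlockHom.Wb a)).symm
    have e2 := ((BlockHom.Db (m := m) (κ := κ) a).commute hab (BlockHom.Wb b)).symm
    simp only [add_mul, mul_add, mul_assoc, mul_mul_of_eq (Db_Wb m κ a), Db_Wb,
      mul_mul_of_eq e1, e2, neg_mul, mul_neg]
    abel
  generalize Wb m κ a * Wb m κ b = ω at *
  have hD' : ω * dirac m κ = -(dirac m κ * ω) := by rw [hD, neg_neg]
  have hx' : ω * vecVar m κ = -(vecVar m κ * ω) := by rw [hx, neg_neg]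
  have hT : dirac m κ * vecVar m κ - vecVar m κ * dirac m κ =
      (2 : ℂ) • (Sb m κ a + Sb m κ b + 1 + Db m κ a * xb m κ b - xb m κ a * Db m κ b) := by
    rw [dirac_eq_add m κ hab, vecVar_eq_add m κ hab]
    simp only [mul_add, add_mul, Db_xb_sub, (BlockHom.xb a).anticommute hab (BlockHom.Db b),
      (BlockHom.Db a).anticommute hab (BlockHom.xb b)]
    module
  rw [Zop, O_of_even hγ hp]
  have e : dirac m κ * (vecVar m κ * -ω - -ω * vecVar m κ)
      + (vecVar m κ * -ω - -ω * vecVar m κ) * dirac m κ =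
      -((2 : ℂ) • ((dirac m κ * vecVar m κ - vecVar m κ * dirac m κ) * ω)) := by
    simp only [mul_neg, neg_mul, hx', mul_sub, sub_mul, mul_assoc, hD', neg_neg]
    module
  rw [e, hT]
  simp only [add_mul, sub_mul, smul_mul_assoc, one_mul]
  module

/-- Vector variable and Dirac operator are moved to the right through the isotropic elements; the
words that end in either of them cancel. -/
lemma O_z_z_eq {a b : Fin 2} (hab : a ≠ b) (δ ε : ℤˣ) : O m κ (z a δ * z b ε) =
    iso (X m κ) a δ * iso (Xi m κ) b ε - iso (Xi m κ) a δ * iso (X m κ) b ε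
      + (2⁻¹ : ℂ) • (iso (E m κ) a δ * iso (E m κ) b ε)
      + O1 m κ a δ * iso (E m κ) b ε + iso (E m κ) a δ * O1 m κ b ε := by
  have hp : parity m κ (iso (E m κ) a δ * iso (E m κ) b ε)
      = iso (E m κ) a δ * iso (E m κ) b ε := by
    rw [map_mul, parity_iso_E, parity_iso_E, neg_mul_neg]
  rw [O_of_even (inC_gam_z_z m κ hab δ ε) hp]
  simp only [mul_add, add_mul, mul_sub, sub_mul, smul_mul_assoc, mul_smul_comm, mul_assoc,
    vecVar_iso_E, dirac_iso_E, dirac_iso_X, mul_mul_of_eq (vecVar_iso_E m κ _ _),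
    mul_mul_of_eq (dirac_iso_E m κ _ _), mul_mul_of_eq (dirac_iso_X m κ _ _), O1_eq]
  module

lemma O_z_z_z_eq {a b : Fin 2} (hab : a ≠ b) (ε : ℤˣ) : O m κ (z b ε * z a 1 * z a (-1)) =
    (iso (E m κ) b ε + (2 : ℂ) • O1 m κ b ε + (2 : ℂ) • (iso (X m κ) b ε * Db m κ a)
      - (2 : ℂ) • (iso (Xi m κ) b ε * xb m κ a) + (2 : ℂ) • (iso (E m κ) b ε * Sb m κ a))
      * Wb m κ a := by
  have hp : parity m κ ((2 : ℂ) • (iso (E m κ) b ε * Wb m κ a))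
      = -((2 : ℂ) • (iso (E m κ) b ε * Wb m κ a)) := by
    rw [map_smul, map_mul, parity_iso_E, parity_Wb, neg_mul, smul_neg]
  have hdx : dirac m κ * xb m κ a = -(xb m κ a * dirac m κ) + (2 : ℂ) • (xb m κ a * Db m κ a)
      + (2 : ℂ) • Sb m κ a + 1 := by
    have h := dirac_xb m κ a
    rw [Db_xb_sub] at h
    linear_combination (norm := module) h
  have hxW : Wb m κ a * vecVar m κ = vecVar m κ * Wb m κ a - (2 : ℂ) • (xb m κ a * Wb m κ a) := by
    rw [vecVar_Wb]; abel
  have hDW : Wb m κ a * dirac m κ = dirac m κ * Wb m κ a - (2 : ℂ) • (Db m κ a * Wb m κ a) := by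
    rw [dirac_Wb]; abel
  rw [O_of_odd (inC_gam_z_z_z m κ hab ε) hp]
  generalize hx : xb m κ a = x at *
  generalize hD : Db m κ a = D at *
  simp only [mul_add, add_mul, mul_sub, sub_mul, mul_neg, neg_mul, smul_mul_assoc, mul_smul_comm,
    mul_assoc, one_mul, hxW, hDW, mul_mul_of_eq (vecVar_iso_E m κ _ _),
    mul_mul_of_eq (dirac_iso_E m κ _ _), mul_mul_of_eq (dirac_iso_X m κ _ _), O1_eq,
    mul_mul_of_eq hdx]
  module

end

/-! ### Ladder elements as words -/

section

variable (m : Fin 2 → ℕ) (κ : rootSystem m → ℂ)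

/-- The ladder vectors of the block `a` for the sign `δ`. -/
def fam (a : Fin 2) (δ : ℤˣ) : Sym → HC m κ :=
  blockFamily (iso (X m κ) a δ) (iso (X m κ) a (-δ)) (iso (Xi m κ) a δ) (iso (Xi m κ) a (-δ))
    (iso (E m κ) a δ) (iso (E m κ) a (-δ)) (O1 m κ a δ) (O1 m κ a (-δ))

lemma ladderRel_fam (a : Fin 2) (δ : ℤˣ) : LadderRel (fam m κ a δ) := (blockRel m κ a δ).ladderRel

lemma oppositeRel_fam (a : Fin 2) (δ : ℤˣ) : OppositeRel (fam m κ a δ) :=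
  (blockRel m κ a δ).oppositeRel

lemma fam_x (a : Fin 2) (δ : ℤˣ) : fam m κ a δ .x = xb m κ a := pairing_iso _ _ a δ

lemma fam_D (a : Fin 2) (δ : ℤˣ) : fam m κ a δ .D = Db m κ a := pairing_iso _ _ a δ

lemma fam_w (a : Fin 2) (δ : ℤˣ) : fam m κ a δ .w = sgn δ • Wb m κ a := chirality_iso m κ a δ

lemma fam_S (a : Fin 2) (δ : ℤˣ) : fam m κ a δ .S = Sb m κ a := by
  simp only [fam, blockFamily]
  rw [pairing_iso, pairing_iso, Sb]

lemma fam_H (a : Fin 2) (δ : ℤˣ) :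
    chirality (iso (E m κ) a δ) (iso (E m κ) a (-δ)) * scasimir
      (pairing (iso (X m κ) a δ) (iso (X m κ) a (-δ)) (iso (E m κ) a δ) (iso (E m κ) a (-δ)))
      (pairing (iso (Xi m κ) a δ) (iso (Xi m κ) a (-δ)) (iso (E m κ) a δ) (iso (E m κ) a (-δ)))
      = sgn δ • Hop m κ a := by
  rw [chirality_iso, pairing_iso, pairing_iso, smul_mul_assoc, Hop_eq, Sb]

lemma smul_mul_add_mul_smul {A : Type} [Ring A] [Algebra ℂ A] (c : ℂ) (H y : A) :
    c • H * y + y * c • H = c • acomm H y := by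
  rw [smul_mul_assoc, mul_smul_comm, ← smul_add, acomm]

lemma fam_c (a : Fin 2) (δ : ℤˣ) :
    fam m κ a δ .c = sgn δ • acomm (Hop m κ a) (iso (E m κ) a δ) := by
  simp only [fam, blockFamily, fam_H, smul_mul_add_mul_smul]

lemma fam_z (a : Fin 2) (δ : ℤˣ) :
    fam m κ a δ .z = sgn δ • acomm (Hop m κ a) (iso (X m κ) a δ) := by
  simp only [fam, blockFamily, fam_H, smul_mul_add_mul_smul]

lemma fam_d (a : Fin 2) (δ : ℤˣ) :
    fam m κ a δ .d = sgn δ • acomm (Hop m κ a) (iso (Xi m κ) a δ) := by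
  simp only [fam, blockFamily, fam_H, smul_mul_add_mul_smul]

lemma fam_c' (a : Fin 2) (δ : ℤˣ) :
    fam m κ a δ .c' = sgn δ • acomm (Hop m κ a) (iso (E m κ) a (-δ)) := by
  simp only [fam, blockFamily, fam_H, smul_mul_add_mul_smul]

lemma fam_z' (a : Fin 2) (δ : ℤˣ) :
    fam m κ a δ .z' = sgn δ • acomm (Hop m κ a) (iso (X m κ) a (-δ)) := by
  simp only [fam, blockFamily, fam_H, smul_mul_add_mul_smul]

lemma fam_d' (a : Fin 2) (δ : ℤˣ) :
    fam m κ a δ .d' = sgn δ • acomm (Hop m κ a) (iso (Xi m κ) a (-δ)) := by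
  simp only [fam, blockFamily, fam_H, smul_mul_add_mul_smul]

/-- The family for the sign `δ` has chirality `δ w_a`, hence `δ H_a` in place of `H_a`; as `δ² = 1`,
this does not change the square. -/
lemma fam_p (a : Fin 2) (δ : ℤˣ) : fam m κ a δ .p = pPoly m κ a δ := by
  simp only [fam, blockFamily, fam_H, pPoly, sc, Algebra.algebraMap_eq_smul_one]
  congr 1
  have h := sgn_mul_self δ
  simp only [sq, mul_sub, sub_mul, smul_mul_assoc, mul_smul_comm, mul_one, one_mul]
  match_scalars
  · linear_combination h
  · ring
  · linear_combination (-4⁻¹ : ℂ) * h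

lemma blockHom_Hop (a : Fin 2) : BlockHom a false (Hop m κ a) := by
  rw [Hop_eq]
  exact .even_mul (.Wb a) (.Sb m κ a)

lemma blockHom_acomm {a : Fin 2} {p : Bool} {y : HC m κ} (h : BlockHom a p y) :
    BlockHom a p (acomm (Hop m κ a) y) := by
  rw [acomm]
  exact .add _ _ _ (.even_mul (blockHom_Hop m κ a) h) (.mul_even h (blockHom_Hop m κ a))

lemma blockHom_pPoly (a : Fin 2) (δ : ℤˣ) : BlockHom a false (pPoly m κ a δ) := by
  have h : BlockHom a false (Hop m κ a - sc m κ (sgn δ / 2)) := by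
    rw [sc, Algebra.algebraMap_eq_smul_one]
    exact (blockHom_Hop m κ a).sub (.smul _ _ _ .one)
  rw [pPoly, sq]
  exact (h.even_mul h).sub (.odd_mul_odd (blockHom_O1 m κ a δ) (blockHom_O1 m κ a (-δ)))

lemma blockHom_fam (a : Fin 2) (δ : ℤˣ) (i : Sym) : BlockHom a i.odd (fam m κ a δ i) :=
  match i with
  | .x => (fam_x m κ a δ).symm ▸ .xb a
  | .D => (fam_D m κ a δ).symm ▸ .Db a
  | .w => (fam_w m κ a δ).symm ▸ .smul _ _ _ (.Wb a)
  | .S => (fam_S m κ a δ).symm ▸ .Sb m κ a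
  | .c => (fam_c m κ a δ).symm ▸ .smul _ _ _ (blockHom_acomm m κ (.iso_E a _))
  | .z => (fam_z m κ a δ).symm ▸ .smul _ _ _ (blockHom_acomm m κ (.iso_X a _))
  | .d => (fam_d m κ a δ).symm ▸ .smul _ _ _ (blockHom_acomm m κ (.iso_Xi a _))
  | .c' => (fam_c' m κ a δ).symm ▸ .smul _ _ _ (blockHom_acomm m κ (.iso_E a _))
  | .z' => (fam_z' m κ a δ).symm ▸ .smul _ _ _ (blockHom_acomm m κ (.iso_X a _))
  | .d' => (fam_d' m κ a δ).symm ▸ .smul _ _ _ (blockHom_acomm m κ (.iso_Xi a _))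
  | .p => (fam_p m κ a δ).symm ▸ blockHom_pPoly m κ a δ

lemma superCommute_fam {a b : Fin 2} (hab : a ≠ b) (δ ε : ℤˣ) :
    SuperCommute (fam m κ a δ) (fam m κ b ε) := fun i j =>
  (blockHom_fam m κ a δ i).koszul hab (blockHom_fam m κ b ε j)

lemma acomm_eq_zero_of_smul {A : Type} [Ring A] [Algebra ℂ A] {c : ℂ} (hc : c ≠ 0) {H y : A}
    (h : c • H * y = -(y * c • H)) : acomm H y = 0 := by
  rw [eq_neg_iff_add_eq_zero, smul_mul_add_mul_smul] at h
  exact (smul_eq_zero_iff_right hc).1 h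

lemma sgn_ne_zero (δ : ℤˣ) : sgn δ ≠ 0 := fun h => by
  simpa [h] using sgn_mul_self δ

lemma acomm_Hop_O1 (a : Fin 2) (δ : ℤˣ) : acomm (Hop m κ a) (O1 m κ a δ) = 0 := by
  have h := (blockRel m κ a δ).H_Op
  rw [fam_H] at h
  exact acomm_eq_zero_of_smul (sgn_ne_zero δ) h

lemma acomm_mul_of_comm {A : Type} [Ring A] {H a b : A} (h : H * b = b * H) :
    acomm H (a * b) = acomm H a * b := by
  rw [acomm, acomm, add_mul, mul_assoc, mul_assoc, mul_assoc, h]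

lemma acomm_mul_of_comm' {A : Type} [Ring A] {H a b : A} (h : H * a = a * H) :
    acomm H (a * b) = a * acomm H b := by
  rw [acomm, acomm, mul_add, ← mul_assoc, ← mul_assoc, h, mul_assoc a b H]

/-- `H_a` and `H_b` are even, so each commutes with the factor from the other block and the double
anticommutator factorises. -/
lemma acomm_acomm_mul {a b : Fin 2} (hab : a ≠ b) {p q : Bool} {y t : HC m κ}
    (hy : BlockHom a p y) (ht : BlockHom b q t) :
    acomm (Hop m κ a) (acomm (Hop m κ b) (y * t))
      = acomm (Hop m κ a) y * acomm (Hop m κ b) t := by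
  rw [acomm_mul_of_comm' (hy.commute hab (blockHom_Hop m κ b)),
    acomm_mul_of_comm ((blockHom_acomm m κ ht).commute hab.symm (blockHom_Hop m κ a))]

lemma acomm_add {A : Type} [Ring A] (H a b : A) : acomm H (a + b) = acomm H a + acomm H b := by
  rw [acomm, acomm, acomm, mul_add, add_mul]; abel

lemma acomm_sub {A : Type} [Ring A] (H a b : A) : acomm H (a - b) = acomm H a - acomm H b := by
  rw [acomm, acomm, acomm, mul_sub, sub_mul]; abel

lemma acomm_smul {A : Type} [Ring A] [Algebra ℂ A] (H : A) (c : ℂ) (a : A) :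
    acomm H (c • a) = c • acomm H a := by
  rw [acomm, acomm, mul_smul_comm, smul_mul_assoc, smul_add]

lemma acomm_acomm_O {a b : Fin 2} (hab : a ≠ b) (δ ε : ℤˣ) :
    acomm (Hop m κ a) (acomm (Hop m κ b) (O m κ (z a δ * z b ε))) =
      acomm (Hop m κ a) (iso (X m κ) a δ) * acomm (Hop m κ b) (iso (Xi m κ) b ε)
      - acomm (Hop m κ a) (iso (Xi m κ) a δ) * acomm (Hop m κ b) (iso (X m κ) b ε)
      + (2⁻¹ : ℂ) • (acomm (Hop m κ a) (iso (E m κ) a δ)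
        * acomm (Hop m κ b) (iso (E m κ) b ε)) := by
  rw [O_z_z_eq m κ hab]
  simp only [acomm_add, acomm_sub, acomm_smul, acomm_acomm_mul m κ hab (.iso_X a δ) (.iso_Xi b ε),
    acomm_acomm_mul m κ hab (.iso_Xi a δ) (.iso_X b ε),
    acomm_acomm_mul m κ hab (.iso_E a δ) (.iso_E b ε),
    acomm_acomm_mul m κ hab (blockHom_O1 m κ a δ) (.iso_E b ε),
    acomm_acomm_mul m κ hab (.iso_E a δ) (blockHom_O1 m κ b ε), acomm_Hop_O1, zero_mul, mul_zero,
    add_zero]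

lemma acomm_O {a b : Fin 2} (hab : a ≠ b) (δ : ℤˣ) :
    acomm (Hop m κ a) (O m κ (z a δ * z b 1 * z b (-1))) =
      (2 : ℂ) • ((acomm (Hop m κ a) (iso (X m κ) a δ) * Db m κ b
        - acomm (Hop m κ a) (iso (Xi m κ) a δ) * xb m κ b
        + acomm (Hop m κ a) (iso (E m κ) a δ) * Sb m κ b
        + (2⁻¹ : ℂ) • acomm (Hop m κ a) (iso (E m κ) a δ)) * Wb m κ b) := by
  have e := fun {p : Bool} {y t : HC m κ} (h : BlockHom b p t) =>
    acomm_mul_of_comm (a := y) (h.commute hab.symm (blockHom_Hop m κ a))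
  rw [O_z_z_z_eq m κ hab.symm, e (.Wb b)]
  simp only [acomm_add, acomm_sub, acomm_smul, e (.Db b), e (.xb b), e (.Sb m κ b), acomm_Hop_O1]
  simp only [add_mul, sub_mul, smul_mul_assoc, smul_zero, zero_mul]
  module

lemma evenLadder_eq (δ ε : ℤˣ) :
    evenLadder m κ δ ε = (sgn δ * sgn ε) • evenWord (fam m κ 0 δ) (fam m κ 1 ε) := by
  have h : sgn δ * sgn ε * (sgn δ * sgn ε) = 1 := by
    linear_combination sgn ε * sgn ε * sgn_mul_self δ + sgn_mul_self ε
  rw [evenLadder, acomm_acomm_O m κ (by decide), evenWord]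
  simp only [fam_z, fam_d, fam_c, smul_mul_assoc, mul_smul_comm]
  match_scalars
  · linear_combination -h
  · linear_combination h
  · linear_combination (-2⁻¹ : ℂ) * h

end

/-! ### Products of ladder elements -/

lemma sgn_mul_sgn_mul_self (δ ε : ℤˣ) : sgn δ * sgn ε * (sgn δ * sgn ε) = 1 := by
  linear_combination sgn ε * sgn ε * sgn_mul_self δ + sgn_mul_self ε

section

variable (m : Fin 2 → ℕ) (κ : rootSystem m → ℂ)

lemma evenLadder_neg_eq (δ ε : ℤˣ) : evenLadder m κ (-δ) (-ε) = (sgn δ * sgn ε) •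
    (fam m κ 0 δ .z' * fam m κ 1 ε .d' - fam m κ 0 δ .d' * fam m κ 1 ε .z'
      + (2⁻¹ : ℂ) • (fam m κ 0 δ .c' * fam m κ 1 ε .c')) := by
  have h := sgn_mul_sgn_mul_self δ ε
  rw [evenLadder, acomm_acomm_O m κ (by decide)]
  simp only [fam_z', fam_d', fam_c', smul_mul_assoc, mul_smul_comm]
  match_scalars
  · linear_combination -h
  · linear_combination h
  · linear_combination (-2⁻¹ : ℂ) * h

lemma oddLadder_eq_acomm {a b : Fin 2} (hab : a ≠ b) (δ : ℤˣ) :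
    oddLadder m κ a δ = acomm (Hop m κ a) (O m κ (z a δ * z b 1 * z b (-1))) := by
  have : 1 - a = b := by omega
  rw [oddLadder, this]

/-- The sign `ε` is free: it enters only through the chirality `ε w_b` and is compensated by the
prefactor. -/
lemma oddLadder_eq {a b : Fin 2} (hab : a ≠ b) (δ ε : ℤˣ) :
    oddLadder m κ a δ = (sgn δ * sgn ε) • oddWord (fam m κ a δ) (fam m κ b ε) := by
  have h := sgn_mul_sgn_mul_self δ ε
  rw [oddLadder_eq_acomm m κ hab, acomm_O m κ hab, oddWord]
  simp only [fam_z, fam_d, fam_c, fam_x, fam_D, fam_S, fam_w, smul_mul_assoc, mul_smul_comm,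
    add_mul, sub_mul]
  match_scalars
  · linear_combination (-2 : ℂ) * h
  · linear_combination (2 : ℂ) * h
  · linear_combination (-2 : ℂ) * h
  · linear_combination -h

lemma oddLadder_neg_eq {a b : Fin 2} (hab : a ≠ b) (δ ε : ℤˣ) :
    oddLadder m κ a (-δ) = (sgn δ * sgn ε) • ((2 : ℂ) •
      ((fam m κ a δ .z' * fam m κ b ε .D - fam m κ a δ .d' * fam m κ b ε .x
        + fam m κ a δ .c' * fam m κ b ε .S + (2⁻¹ : ℂ) • fam m κ a δ .c') * fam m κ b ε .w)) := by
  have h := sgn_mul_sgn_mul_self δ ε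
  rw [oddLadder_eq_acomm m κ hab, acomm_O m κ hab]
  simp only [fam_z', fam_d', fam_c', fam_x, fam_D, fam_S, fam_w, smul_mul_assoc, mul_smul_comm,
    add_mul, sub_mul]
  match_scalars
  · linear_combination (-2 : ℂ) * h
  · linear_combination (2 : ℂ) * h
  · linear_combination (-2 : ℂ) * h
  · linear_combination -h

lemma zWord_fam {a b : Fin 2} (hab : a ≠ b) (δ ε : ℤˣ) :
    zWord (fam m κ a δ) (fam m κ b ε) = (sgn δ * sgn ε) • Zop m κ := by
  rw [Zop_eq m κ hab, zWord, fam_S, fam_S, fam_D, fam_D, fam_x, fam_x, fam_w, fam_w,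
    smul_mul_smul_comm, mul_smul_comm, smul_neg]

lemma fam_w_mul_S (a : Fin 2) (δ : ℤˣ) :
    fam m κ a δ .w * fam m κ a δ .S = sgn δ • Hop m κ a := by
  rw [fam_w, fam_S, smul_mul_assoc, Hop_eq]

/-- The ladder vectors `z`, `d` are even and `c` is odd, so each of the three terms changes sign.
This is the minus sign in the second formula of claim 4. -/
lemma evenWord_fam_swap {a b : Fin 2} (hab : a ≠ b) (δ ε : ℤˣ) :
    evenWord (fam m κ b ε) (fam m κ a δ) = -evenWord (fam m κ a δ) (fam m κ b ε) := by
  have hz := (blockHom_fam m κ a δ .d).commute hab (blockHom_fam m κ b ε .z)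
  have hd := (blockHom_fam m κ a δ .z).commute hab (blockHom_fam m κ b ε .d)
  have hc := (blockHom_fam m κ a δ .c).anticommute hab (blockHom_fam m κ b ε .c)
  rw [evenWord, evenWord, hz, hd, hc]
  module

theorem evenLadder_mul_neg (δ ε : ℤˣ) :
    evenLadder m κ δ ε * evenLadder m κ (-δ) (-ε) =
      (16 : ℂ) • (pPoly m κ 0 δ * pPoly m κ 1 ε *
        ((sgn δ • Hop m κ 0 + sgn ε • Hop m κ 1 - 1) ^ 2
          - (Zop m κ - sc m κ (sgn δ * sgn ε / 2)) ^ 2)) := by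
  have h01 : (0 : Fin 2) ≠ 1 := by decide
  have h := sgn_mul_sgn_mul_self δ ε
  rw [evenLadder_eq, evenLadder_neg_eq, smul_mul_smul_comm, h, one_smul,
    evenWord_mul_opposite (ladderRel_fam m κ 0 δ) (ladderRel_fam m κ 1 ε) (oppositeRel_fam m κ 0 δ)
      (oppositeRel_fam m κ 1 ε) (superCommute_fam m κ h01 δ ε),
    fam_w_mul_S, fam_w_mul_S, zWord_fam m κ h01, fam_p, fam_p]
  have e : ((sgn δ * sgn ε) • Zop m κ - (2⁻¹ : ℂ) • 1) ^ 2
      = (Zop m κ - sc m κ (sgn δ * sgn ε / 2)) ^ 2 := by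
    rw [sc, Algebra.algebraMap_eq_smul_one]
    simp only [sq, mul_sub, sub_mul, smul_mul_assoc, mul_smul_comm, mul_one, one_mul]
    match_scalars
    · linear_combination h
    · ring
    · linear_combination (-4⁻¹ : ℂ) * h
  rw [e]

theorem oddLadder_mul_neg {a b : Fin 2} (hab : a ≠ b) (δ : ℤˣ) :
    oddLadder m κ a δ * oddLadder m κ a (-δ) =
      (16 : ℂ) • (pPoly m κ a δ *
        ((Zop m κ - sgn δ • Hop m κ b) ^ 2 - (Hop m κ a - sc m κ (sgn δ / 2)) ^ 2)) := by
  have h := sgn_mul_self δ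
  -- Choosing the free sign equal to `δ` makes the normalised pseudoscalar equal to `Z` itself.
  rw [oddLadder_eq m κ hab δ δ, oddLadder_neg_eq m κ hab δ δ, smul_mul_smul_comm,
    sgn_mul_sgn_mul_self, one_smul,
    oddWord_mul_opposite (ladderRel_fam m κ a δ) (ladderRel_fam m κ b δ) (oppositeRel_fam m κ a δ)
      (superCommute_fam m κ hab δ δ),
    fam_w_mul_S, fam_w_mul_S, zWord_fam m κ hab, fam_p, h, one_smul]
  have e : (sgn δ • Hop m κ a - (2⁻¹ : ℂ) • 1) ^ 2 = (Hop m κ a - sc m κ (sgn δ / 2)) ^ 2 := by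
    rw [sc, Algebra.algebraMap_eq_smul_one]
    simp only [sq, mul_sub, sub_mul, smul_mul_assoc, mul_smul_comm, mul_one, one_mul]
    match_scalars
    · linear_combination h
    · ring
    · linear_combination (-4⁻¹ : ℂ) * h
  rw [e]

theorem oddLadder_mul_oddLadder {a b : Fin 2} (hab : a ≠ b) (δ ε : ℤˣ) :
    oddLadder m κ a δ * oddLadder m κ b ε =
      (4 : ℂ) • ((sgn δ * sgn ε) • evenWord (fam m κ a δ) (fam m κ b ε) *
        (Zop m κ + sgn ε • Hop m κ a - sgn δ • Hop m κ b - sc m κ (sgn δ * sgn ε / 2))) := by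
  have h := sgn_mul_sgn_mul_self δ ε
  have hδ := sgn_mul_self δ
  have hε := sgn_mul_self ε
  rw [oddLadder_eq m κ hab δ ε, oddLadder_eq m κ hab.symm ε δ, smul_mul_smul_comm,
    mul_comm (sgn ε), h, one_smul,
    oddWord_mul_oddWord (ladderRel_fam m κ a δ) (ladderRel_fam m κ b ε)
      (superCommute_fam m κ hab δ ε),
    fam_w_mul_S, fam_w_mul_S, zWord_fam m κ hab, smul_mul_assoc]
  have e : (sgn δ * sgn ε) • Zop m κ + sgn δ • Hop m κ a - sgn ε • Hop m κ b - (2⁻¹ : ℂ) • 1 =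
      (sgn δ * sgn ε) •
        (Zop m κ + sgn ε • Hop m κ a - sgn δ • Hop m κ b - sc m κ (sgn δ * sgn ε / 2)) := by
    rw [sc, Algebra.algebraMap_eq_smul_one]
    match_scalars
    · ring
    · linear_combination (-sgn δ) * hε
    · linear_combination sgn ε * hδ
    · linear_combination (2⁻¹ : ℂ) * h
  rw [e, mul_smul_comm]

end

/-! ### Products of lifted reflections -/

section

variable (m : Fin 2 → ℕ)

/-- The scalar product of two roots of a block. -/
def rootDot (a : Fin 2) (p q : ℕ) : ℝ :=
  root m a p (fstIdx a) * root m a q (fstIdx a) + root m a p (sndIdx a) * root m a q (sndIdx a)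

/-- The oriented area spanned by two roots of a block. -/
def rootWedge (a : Fin 2) (p q : ℕ) : ℝ :=
  root m a p (fstIdx a) * root m a q (sndIdx a) - root m a p (sndIdx a) * root m a q (fstIdx a)

lemma rootDot_eq (a : Fin 2) (p q : ℕ) :
    rootDot m a p q = Real.cos (q * Real.pi / m a - p * Real.pi / m a) := by
  rw [rootDot, root_fstIdx, root_fstIdx, root_sndIdx, root_sndIdx, Real.cos_sub]
  ring

lemma rootWedge_eq (a : Fin 2) (p q : ℕ) :
    rootWedge m a p q = Real.sin (q * Real.pi / m a - p * Real.pi / m a) := by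
  rw [rootWedge, root_fstIdx, root_fstIdx, root_sndIdx, root_sndIdx, Real.sin_sub]
  ring

lemma root_sq_add_sq (a : Fin 2) (p : ℕ) :
    root m a p (fstIdx a) ^ 2 + root m a p (sndIdx a) ^ 2 = 1 := by
  rw [← inner_root_self m a p, inner_root, sq, sq]

lemma refl_refl_fst (a : Fin 2) (p q : ℕ) (v : VR) :
    refl (root m a p) (refl (root m a q) v) (fstIdx a) =
      (2 * rootDot m a p q ^ 2 - 1) * v (fstIdx a)
        + 2 * (rootDot m a p q * rootWedge m a p q) * v (sndIdx a) := by
  have hp := root_sq_add_sq m a p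
  have hq := root_sq_add_sq m a q
  simp only [refl_apply_of_inner (inner_root_self m _ _), inner_sub_right, inner_smul_right,
    inner_root, PiLp.sub_apply, PiLp.smul_apply, smul_eq_mul, rootDot, rootWedge]
  generalize root m a p (fstIdx a) = px at *
  generalize root m a p (sndIdx a) = py at *
  generalize root m a q (fstIdx a) = qx at *
  generalize root m a q (sndIdx a) = qy at *
  linear_combination (-2 * (1 - qx ^ 2) * v (fstIdx a) + 2 * qx * qy * v (sndIdx a)) * hp
    + (-2 * py ^ 2 * v (fstIdx a) + 2 * px * py * v (sndIdx a)) * hq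

lemma refl_refl_snd (a : Fin 2) (p q : ℕ) (v : VR) :
    refl (root m a p) (refl (root m a q) v) (sndIdx a) =
      (2 * rootDot m a p q ^ 2 - 1) * v (sndIdx a)
        - 2 * (rootDot m a p q * rootWedge m a p q) * v (fstIdx a) := by
  have hp := root_sq_add_sq m a p
  have hq := root_sq_add_sq m a q
  simp only [refl_apply_of_inner (inner_root_self m _ _), inner_sub_right, inner_smul_right,
    inner_root, PiLp.sub_apply, PiLp.smul_apply, smul_eq_mul, rootDot, rootWedge]
  generalize root m a p (fstIdx a) = px at *
  generalize root m a p (sndIdx a) = py at *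
  generalize root m a q (fstIdx a) = qx at *
  generalize root m a q (sndIdx a) = qy at *
  linear_combination (-2 * (1 - qy ^ 2) * v (sndIdx a) + 2 * qx * qy * v (fstIdx a)) * hp
    + (-2 * px ^ 2 * v (sndIdx a) + 2 * px * py * v (fstIdx a)) * hq

lemma refl_apply_of_blk_ne {a : Fin 2} (p : ℕ) (v : VR) {j : Fin 4} (h : blk j ≠ a) :
    refl (root m a p) v j = v j := by
  simp [refl_apply_of_inner (inner_root_self m _ _), root_of_blk_ne m p h]

lemma eq_fstIdx_or_eq_sndIdx (j : Fin 4) : j = fstIdx (blk j) ∨ j = sndIdx (blk j) := by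
  fin_cases j <;> decide

/-- A product of two reflections rotates by twice the angle between the roots. Its matrix is
quadratic in cosine and sine of that angle, so it does not see their common sign, whereas the
Clifford lift is linear in them and does. -/
lemma reflW_mul_reflW_eq {a : Fin 2} {i j k l : Fin (m a)}
    (hd : rootDot m a (i + 1) (j + 1) = -rootDot m a (k + 1) (l + 1))
    (hw : rootWedge m a (i + 1) (j + 1) = -rootWedge m a (k + 1) (l + 1)) :
    reflW m (posRoot m ⟨a, i⟩) * reflW m (posRoot m ⟨a, j⟩)
      = reflW m (posRoot m ⟨a, k⟩) * reflW m (posRoot m ⟨a, l⟩) := by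
  apply Subtype.ext
  apply LinearIsometryEquiv.ext
  intro v
  change refl (root m a (i + 1)) (refl (root m a (j + 1)) v) =
    refl (root m a (k + 1)) (refl (root m a (l + 1)) v)
  ext n
  by_cases hn : blk n = a
  · have h := eq_fstIdx_or_eq_sndIdx n
    rw [hn] at h
    rcases h with rfl | rfl
    · rw [refl_refl_fst, refl_refl_fst, hd, hw, neg_mul_neg, neg_sq]
    · rw [refl_refl_snd, refl_refl_snd, hd, hw, neg_mul_neg, neg_sq]
  · simp only [refl_apply_of_blk_ne m _ _ hn]

variable (κ : rootSystem m → ℂ)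

lemma sTilde_mul_sTilde (a : Fin 2) (i j : Fin (m a)) :
    sTilde m κ ⟨a, i⟩ * sTilde m κ ⟨a, j⟩ =
      G m κ (reflW m (posRoot m ⟨a, i⟩) * reflW m (posRoot m ⟨a, j⟩)) *
        (((rootDot m a (i + 1) (j + 1) : ℝ) : ℂ) • 1
          + ((rootWedge m a (i + 1) (j + 1) : ℝ) : ℂ) • (E m κ (fstIdx a) * E m κ (sndIdx a))) := by
  have key : ∀ (g h u v : HC m κ), u * h = h * u → g * u * (h * v) = g * h * (u * v) := by
    intro g h u v hu
    rw [mul_assoc, ← mul_assoc u, hu, mul_assoc, mul_assoc]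
  rw [sTilde_eq, sTilde_eq, key, G_mul]
  · congr 1
    simp only [mul_add, add_mul, smul_mul_assoc, mul_smul_comm, E_sq, E_snd_fst]
    have hd : ((rootDot m a (i + 1) (j + 1) : ℝ) : ℂ) =
        coord m ⟨a, i⟩ (fstIdx a) * coord m ⟨a, j⟩ (fstIdx a)
          + coord m ⟨a, i⟩ (sndIdx a) * coord m ⟨a, j⟩ (sndIdx a) := by
      rw [rootDot]; push_cast; rfl
    have hw : ((rootWedge m a (i + 1) (j + 1) : ℝ) : ℂ) =
        coord m ⟨a, i⟩ (fstIdx a) * coord m ⟨a, j⟩ (sndIdx a)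
          - coord m ⟨a, i⟩ (sndIdx a) * coord m ⟨a, j⟩ (fstIdx a) := by
      rw [rootWedge]; push_cast; rfl
    rw [hd, hw]
    match_scalars <;> ring
  · simp only [add_mul, mul_add, smul_mul_assoc, mul_smul_comm, E_G]

lemma sTilde_mul_self (a : Fin 2) (i : Fin (m a)) :
    sTilde m κ ⟨a, i⟩ * sTilde m κ ⟨a, i⟩ = 1 := by
  have h : reflW m (posRoot m ⟨a, i⟩) * reflW m (posRoot m ⟨a, i⟩) = 1 := by
    apply Subtype.ext
    apply LinearIsometryEquiv.ext
    intro v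
    change refl (root m a (i + 1)) (refl (root m a (i + 1)) v) = v
    exact Submodule.reflection_reflection _ v
  rw [sTilde_mul_sTilde, h, G_one, rootDot_eq, rootWedge_eq, sub_self, Real.cos_zero, Real.sin_zero,
    Complex.ofReal_one, Complex.ofReal_zero, one_smul, zero_smul, add_zero, one_mul]

lemma sTilde_mul_sTilde_eq_neg {a : Fin 2} {i j k l : Fin (m a)}
    (hd : rootDot m a (i + 1) (j + 1) = -rootDot m a (k + 1) (l + 1))
    (hw : rootWedge m a (i + 1) (j + 1) = -rootWedge m a (k + 1) (l + 1)) :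
    sTilde m κ ⟨a, i⟩ * sTilde m κ ⟨a, j⟩ = -(sTilde m κ ⟨a, k⟩ * sTilde m κ ⟨a, l⟩) := by
  rw [sTilde_mul_sTilde, sTilde_mul_sTilde, reflW_mul_reflW_eq m hd hw, hd, hw, ← mul_neg]
  congr 1
  rw [Complex.ofReal_neg, Complex.ofReal_neg]
  module

variable [∀ a, NeZero (m a)]

lemma sTilde_mul_succ {a : Fin 2} {i j : Fin (m a)} (h : (j : ℕ) = i + 1) :
    sTilde m κ ⟨a, i⟩ * sTilde m κ ⟨a, j⟩ = rTilde m κ a := by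
  have hm : (m a : ℝ) ≠ 0 := Nat.cast_ne_zero.2 (NeZero.ne _)
  -- The index `Fin.rev 0` is `m_a - 1`, which stands for the root numbered `m_a`.
  have hr : ((Fin.rev (0 : Fin (m a)) : ℕ) + 1 : ℕ) = m a := by
    rw [Fin.val_rev, Fin.val_zero]
    have := NeZero.pos (m a)
    omega
  have e1 : ((j + 1 : ℕ) : ℝ) * Real.pi / m a - ((i + 1 : ℕ) : ℝ) * Real.pi / m a
      = Real.pi / m a := by
    rw [h]; push_cast; ring
  -- The angle from root `m_a` to root `1` differs by `π` from the angle `π / m_a` between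
  -- consecutive roots. This flips cosine and sine, and accounts for the sign in `r̃_a`.
  have e2 : (((0 : Fin (m a)) : ℕ) + 1 : ℕ) * Real.pi / m a - ((m a : ℕ) : ℝ) * Real.pi / m a
      = Real.pi / m a - Real.pi := by
    rw [Fin.val_zero]; push_cast; field_simp
  rw [rTilde]
  apply sTilde_mul_sTilde_eq_neg
  · rw [rootDot_eq, rootDot_eq, hr, e1, e2, Real.cos_sub_pi, neg_neg]
  · rw [rootWedge_eq, rootWedge_eq, hr, e1, e2, Real.sin_sub_pi, neg_neg]

/-- The product telescopes through consecutive roots, since lifted reflections square to `1`. -/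
lemma sTilde_mul_eq_pow {a : Fin 2} {n : ℕ} {i j : Fin (m a)} (h : (j : ℕ) = i + n) :
    sTilde m κ ⟨a, i⟩ * sTilde m κ ⟨a, j⟩ = rTilde m κ a ^ n := by
  induction n generalizing j with
  | zero =>
    obtain rfl : j = i := Fin.ext h
    rw [sTilde_mul_self, pow_zero]
  | succ n ih =>
    have hk : (i : ℕ) + n < m a := by have := j.isLt; omega
    rw [pow_succ, ← ih (j := ⟨i + n, hk⟩) rfl, ← sTilde_mul_succ m κ (i := ⟨i + n, hk⟩) (j := j) h,
      mul_assoc, ← mul_assoc (sTilde m κ ⟨a, ⟨i + n, hk⟩⟩), sTilde_mul_self, one_mul]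

lemma rTilde_mem (a : Fin 2) : rTilde m κ a ∈ T0 m κ := by
  apply Algebra.subset_adjoin
  fin_cases a <;> simp

lemma sTilde_mul_mem (a : Fin 2) (i j : Fin (m a)) :
    sTilde m κ ⟨a, i⟩ * sTilde m κ ⟨a, j⟩ ∈ T0 m κ := by
  have hpow : ∀ {i j : Fin (m a)}, i ≤ j →
      sTilde m κ ⟨a, i⟩ * sTilde m κ ⟨a, j⟩ ∈ T0 m κ := by
    intro i j h
    rw [sTilde_mul_eq_pow m κ (n := j - i) (by have : (i : ℕ) ≤ j := h; omega)]
    exact pow_mem (rTilde_mem m κ a) _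
  have hr : i ≤ Fin.rev 0 := by
    rw [Fin.le_def, Fin.val_rev, Fin.val_zero]
    omega
  -- For `i > j` a negative power of `r̃_a` would appear. Passing through the last and the first
  -- root, as `(s̃_i s̃_m) (s̃_m s̃_1) (s̃_1 s̃_j)`, keeps all exponents nonnegative.
  have e : sTilde m κ ⟨a, i⟩ * sTilde m κ ⟨a, j⟩ =
      sTilde m κ ⟨a, i⟩ * sTilde m κ ⟨a, Fin.rev 0⟩ * -rTilde m κ a
        * (sTilde m κ ⟨a, 0⟩ * sTilde m κ ⟨a, j⟩) := by
    rw [rTilde, neg_neg, mul_assoc, mul_assoc, mul_assoc, ← mul_assoc (sTilde m κ ⟨a, 0⟩),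
      sTilde_mul_self, one_mul, ← mul_assoc (sTilde m κ ⟨a, Fin.rev 0⟩), sTilde_mul_self, one_mul]
  rw [e]
  exact mul_mem (mul_mem (hpow hr) (neg_mem (rTilde_mem m κ a))) (hpow (Fin.zero_le _))

theorem O1_mul_mem (a : Fin 2) (δ ε : ℤˣ) : O1 m κ a δ * O1 m κ a ε ∈ T0 m κ := by
  rw [O1_eq_sum, O1_eq_sum, Finset.sum_mul_sum]
  refine sum_mem fun r _ => sum_mem fun s _ => ?_
  rw [smul_mul_smul_comm]
  by_cases hr : r.1 = a
  · by_cases hs : s.1 = a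
    · obtain ⟨r, i⟩ := r
      obtain ⟨s, j⟩ := s
      obtain rfl : r = a := hr
      obtain rfl : s = r := hs
      exact Subalgebra.smul_mem _ (sTilde_mul_mem m κ _ i j) _
    · rw [iso_coord_of_ne m hs, mul_zero, mul_zero, zero_smul]
      exact zero_mem _
  · rw [iso_coord_of_ne m hr, mul_zero, zero_mul, zero_smul]
    exact zero_mem _

end

end DoubleDihedral

end

open DoubleDihedral in
theorem mainTheorem3 (m : Fin 2 → ℕ) [∀ a, NeZero (m a)]
    (κ : rootSystem m → ℂ) (hκ : IsInvariant m κ) :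
    -- the products `O_a^δ O_a^{-δ}` are polynomials in `t_0`
    (∀ (a : Fin 2) (δ : ℤˣ), O1 m κ a δ * O1 m κ a (-δ) ∈ T0 m κ) ∧
    -- products of opposite odd ladder elements
    (∀ (a b : Fin 2) (δ : ℤˣ), a ≠ b →
      oddLadder m κ a δ * oddLadder m κ a (-δ) =
        (16 : ℂ) • (pPoly m κ a δ *
          ((Zop m κ - sgn δ • Hop m κ b) ^ 2 - (Hop m κ a - sc m κ (sgn δ / 2)) ^ 2))) ∧
    -- products of opposite even ladder elements
    (∀ δ ε : ℤˣ,
      evenLadder m κ δ ε * evenLadder m κ (-δ) (-ε) =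
        (16 : ℂ) • (pPoly m κ 0 δ * pPoly m κ 1 ε *
          ((sgn δ • Hop m κ 0 + sgn ε • Hop m κ 1 - 1) ^ 2
            - (Zop m κ - sc m κ (sgn δ * sgn ε / 2)) ^ 2))) ∧
    -- products of two odd ladder elements of different blocks, in both orders
    (∀ δ ε : ℤˣ,
      oddLadder m κ 0 δ * oddLadder m κ 1 ε =
        (4 : ℂ) • (evenLadder m κ δ ε *
          (Zop m κ + sgn ε • Hop m κ 0 - sgn δ • Hop m κ 1 - sc m κ (sgn δ * sgn ε / 2)))) ∧
    (∀ δ ε : ℤˣ,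
      oddLadder m κ 1 δ * oddLadder m κ 0 ε =
        -((4 : ℂ) • (evenLadder m κ ε δ *
          (Zop m κ + sgn ε • Hop m κ 1 - sgn δ • Hop m κ 0
            - sc m κ (sgn δ * sgn ε / 2))))) := by
  have h01 : (0 : Fin 2) ≠ 1 := by decide
  refine ⟨fun a δ => O1_mul_mem m κ a δ (-δ), fun a b δ hab => oddLadder_mul_neg m κ hab δ,
    evenLadder_mul_neg m κ, fun δ ε => ?_, fun δ ε => ?_⟩
  · rw [evenLadder_eq, oddLadder_mul_oddLadder m κ h01]
  · rw [evenLadder_eq, oddLadder_mul_oddLadder m κ h01.symm, evenWord_fam_swap m κ h01, smul_neg,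
      neg_mul, smul_neg, mul_comm (sgn δ)]
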